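/- Let $U\subseteq\mathbb{C}^n$ be open with coordinates $v=(v^1,\dots,v^n)$, let $\eta=(\eta^{\alpha\beta})$ be a constant symmetric invertible matrix and $h_0$ a holomorphic function on $U$. A differential polynomial is a polynomial in $v^\alpha_\ell=\partial_x^\ell v^\alpha$, $\ell\ge1$, with holomorphic coefficients in $v$; $\deg v^\alpha_\ell=\ell$. Local functionals $\int f\,dx$ are differential polynomials modulo total $x$-derivatives, and $\{F,G\}=\int\frac{\delta F}{\delta v^\alpha}\,\eta^{\alpha\beta}\partial_x\frac{\delta G}{\delta v^\beta}\,dx$. Put $H_0=\int h_0\,dx$ and $A^\alpha_\gamma=\eta^{\alpha\beta}\partial_\beta\partial_\gamma h_0$, so that the dispersionless system is $v^\alpha_t=A^\alpha_\gamma v^\gamma_x$. A conservation law on an open $W\subseteq U$ is $F_0=\int f(v)\,dx$, $f$ holomorphic on $W$, with $\{H_0,F_0\}=0$ on $W$; it is generic if $M^\alpha_\gamma=\eta^{\alpha\beta}\partial_\beta\partial_\gamma f$ has $n$ pairwise distinct eigenvalues at every point of $W$. The dispersionless system is integrable if near every point its conservation laws are parametrized by $n$ arbitrary functions of one variable: through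 each $v_0\in U$ there are analytic curves $\gamma_1,\dots,\gamma_n$, $\gamma_i(0)=v_0$, with linearly independent $\gamma_i'(0)$, such that for all analytic germs $g_1,\dots,g_n$ at $0\in\mathbb{C}$ there is a conservation law $f$ near $v_0$ with $M(\gamma_i(t))\,\gamma_i'(t)=g_i(t)\,\gamma_i'(t)$ for $t$ near $0$ and all $i$. A perturbation is $H=\sum_{j\ge0}\epsilon^jH_j$ with $H_j=\int h_j\,dx$ and $h_j$ a differential polynomial on $U$ homogeneous of degree $j$. It is $O(\epsilon^N)$-integrable if the dispersionless system is integrable and each generic conservation law $F_0$ on each open $W\subseteq U$ extends, near each point of $W$, to $F=\sum_j\epsilon^jF_j$, $F_j$ given by a differential polynomial homogeneous of degree $j$, with $\{H,F\}=O(\epsilon^{N+1})$; it is integrable if the same holds with $\{H,F\}=0$. **Theorem 1.** Assume that the dispersionless system is integrable and has complete Riemann invariants $R_1,\dots,R_n$: holomorphic functions on $U$ with nondegenerate Jacobian such that $A^\alpha_\beta\,\partial_\alpha R_i=\lambda_i\,\partial_\beta R_i$, where the $\lambda_i$ are holomorphic and pairwise distinct at every point of $U$. Let $f_{,i}=\partial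 f/\partial R_i$ and $$a_{ij}=\frac{\lambda_{i,j}}{\lambda_i-\lambda_j},\qquad \omega_{ij}=\frac{p_{i,j}-p_{j,i}}{\lambda_i-\lambda_j}\qquad(i\ne j).$$ (1) Let $H=H_0+\epsilon H_1+O(\epsilon^2)$ be a perturbation with $H_1=\int\sum_i p_i\,R_{i,x}\,dx$, $p_i$ holomorphic on $U$. Then the following are equivalent: (a) $H$ is integrable at first order, i.e. $O(\epsilon)$-integrable; (b) all conservation laws of the dispersionless system, generic or not, extend in the above sense with $N=1$; (c) for all pairwise distinct $i,j,k$, $$\omega_{ij,k}-\omega_{ik,j}=a_{ij}\omega_{ik}+a_{ji}\omega_{jk}-a_{ik}\omega_{ij}-a_{ki}\omega_{kj}.$$ (2) Assume moreover that no $\lambda_{i,i}$ vanishes at any point of $U$. Let $H=H_0+\epsilon^2H_2+O(\epsilon^3)$ be a perturbation with $H_2=\int\sum_{i,j}d_{ij}\,R_{i,x}R_{j,x}\,dx$, $d_{ij}=d_{ji}$ holomorphic on $U$. If $H$ is integrable, or only $O(\epsilon^N)$-integrable for some $N\ge2$, then there are holomorphic functions $C_i=C_i(R_i)$ of one variable with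 $d_{ii}=-C_i(R_i)\,\lambda_{i,i}$, and for all pairwise distinct $i,j,k$, $$\Bigl(\frac{d_{ij}}{\lambda_i-\lambda_j}\Bigr)_{,k}+\Bigl(\frac{d_{jk}}{\lambda_j-\lambda_k}\Bigr)_{,i}+\Bigl(\frac{d_{ki}}{\lambda_k-\lambda_i}\Bigr)_{,j}=0.$$ Here $C_i=C_i(R_i)$ means: $C_i$ is a holomorphic function on $U$ which is near every point of $U$ of the form $c\circ R_i$ with $c$ holomorphic in one variable, and which is of this form, with a single $c$, on every open subset of $U$ in which the level sets of $R_i$ are connected. -/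

import Mathlib

open scoped Topology

noncomputable section

namespace HamPert

variable {n : ℕ}

/-! ### Holomorphic functions on an open subset of `ℂⁿ` -/

/-- The partial derivative `∂f/∂v^α` of a function `f` on an open set `W ⊆ ℂⁿ`
(`f` is extended by `0` outside `W`, which does not matter, as `W` is open). -/
def pd {W : TopologicalSpace.Opens (Fin n → ℂ)} (α : Fin n) (f : W → ℂ) : W → ℂ :=
  fun w => fderiv ℂ (Function.extend Subtype.val f 0) w (Pi.single α 1)

/-- The algebra of holomorphic (i.e. complex analytic) functions on the open set `W ⊆ ℂⁿ`. -/
def Hol (W : TopologicalSpace.Opens (Fin n → ℂ)) : Subalgebra ℂ (W → ℂ) where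
  carrier := {f | ∃ F : (Fin n → ℂ) → ℂ, AnalyticOnNhd ℂ F W ∧ ∀ w : W, f w = F w}
  mul_mem' := by
    rintro f g ⟨F, hF, hfF⟩ ⟨G, hG, hgG⟩
    exact ⟨F * G, hF.mul hG, fun w => by simp [hfF, hgG]⟩
  add_mem' := by
    rintro f g ⟨F, hF, hfF⟩ ⟨G, hG, hgG⟩
    exact ⟨F + G, hF.add hG, fun w => by simp [hfF, hgG]⟩
  algebraMap_mem' := fun r => ⟨fun _ => r, analyticOnNhd_const, fun _ => rfl⟩

instance (W : TopologicalSpace.Opens (Fin n → ℂ)) : CoeFun (Hol W) (fun _ => W → ℂ) :=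
  ⟨Subtype.val⟩

theorem pd_mem {W : TopologicalSpace.Opens (Fin n → ℂ)} (α : Fin n) (f : Hol W) :
    pd α f ∈ Hol W := by
  obtain ⟨f, F, hF, hfF⟩ := f
  refine ⟨fun v => fderiv ℂ F v (Pi.single α 1), fun v hv => ?_, fun w => ?_⟩
  · exact ((ContinuousLinearMap.apply ℂ ℂ (Pi.single α (1 : ℂ) : Fin n → ℂ)).analyticAt _).comp
      (hF.fderiv v hv)
  · have h : Function.extend Subtype.val f 0 =ᶠ[𝓝 (w : Fin n → ℂ)] F := by
      filter_upwards [W.isOpen.mem_nhds w.2] with v hv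
      exact (Subtype.val_injective.extend_apply f 0 ⟨v, hv⟩).trans (hfF ⟨v, hv⟩)
    change fderiv ℂ _ _ _ = _
    rw [h.fderiv_eq]

/-- The partial derivative `∂/∂v^α` on holomorphic functions. -/
def Hol.pd {W : TopologicalSpace.Opens (Fin n → ℂ)} (α : Fin n) (f : Hol W) : Hol W :=
  ⟨HamPert.pd α f, pd_mem α f⟩

/-- Restriction of holomorphic functions to a smaller open set. -/
def Hol.res {U W : TopologicalSpace.Opens (Fin n → ℂ)} (h : W ≤ U) : Hol U →+* Hol W where
  toFun f := ⟨fun w => f ⟨w, h w.2⟩, by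
    obtain ⟨f, F, hF, hfF⟩ := f
    exact ⟨F, fun v hv => hF v (h hv), fun w => hfF ⟨w, h w.2⟩⟩⟩
  map_one' := rfl
  map_mul' _ _ := rfl
  map_zero' := rfl
  map_add' _ _ := rfl

/-! ### Differential polynomials and local functionals -/

/-- Differential polynomials of `v = (v^1, …, v^n)` over `W`: polynomials in the jet variables
`v^α_ℓ`, `ℓ ≥ 1`, with holomorphic coefficients on `W`. The variable `(α, k)` is `v^α_{k+1}`. -/
abbrev DiffPoly (W : TopologicalSpace.Opens (Fin n → ℂ)) : Type :=
  MvPolynomial (Fin n × ℕ) (Hol W)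

namespace DiffPoly

variable {U W : TopologicalSpace.Opens (Fin n → ℂ)}

/-- A function of `v` as a differential polynomial of degree `0`. -/
def ofHol (f : Hol W) : DiffPoly W := MvPolynomial.C f

/-- Restriction to a smaller open set. -/
def res (h : W ≤ U) : DiffPoly U → DiffPoly W := MvPolynomial.map (Hol.res h)

/-- The partial derivative `∂/∂v^α_ℓ`; for `ℓ = 0` it acts on the coefficients. -/
def jetDeriv (α : Fin n) (ℓ : ℕ) (P : DiffPoly W) : DiffPoly W :=
  match ℓ with
  | 0 => ∑ m ∈ P.support, MvPolynomial.monomial m (Hol.pd α (P.coeff m))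
  | k + 1 => MvPolynomial.pderiv (α, k) P

/-- The total derivative `∂ₓ = ∑_{ℓ ≥ 0} v^α_{ℓ+1} ∂/∂v^α_ℓ`. -/
def totalDeriv (P : DiffPoly W) : DiffPoly W :=
  (∑ α, MvPolynomial.X (α, 0) * jetDeriv α 0 P) +
    MvPolynomial.mkDerivation (Hol W) (fun i => MvPolynomial.X (i.1, i.2 + 1)) P

/-- The variational derivative `δ/δv^α = ∑_ℓ (-∂ₓ)^ℓ ∂/∂v^α_ℓ` (a finite sum). -/
def varDeriv (α : Fin n) (P : DiffPoly W) : DiffPoly W :=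
  ∑ᶠ ℓ : ℕ, (-1 : DiffPoly W) ^ ℓ * totalDeriv^[ℓ] (jetDeriv α ℓ P)

/-- Homogeneity of degree `j` with respect to `deg v^α_ℓ = ℓ`. -/
def IsHomogeneousOfDegree (P : DiffPoly W) (j : ℕ) : Prop :=
  MvPolynomial.IsWeightedHomogeneous (fun i : Fin n × ℕ => i.2 + 1) P j

/-- `P` and `Q` are densities of the same local functional, `∫ P dx = ∫ Q dx`:
they differ by a total `x`-derivative. -/
def SameFunctional (P Q : DiffPoly W) : Prop := ∃ G : DiffPoly W, P - Q = totalDeriv G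

/-- The density `(δF/δv^α) η^{αβ} ∂ₓ(δG/δv^β)` of the Poisson bracket of the local functionals
`F = ∫ P dx` and `G = ∫ Q dx`. -/
def bracket (η : Matrix (Fin n) (Fin n) ℂ) (P Q : DiffPoly W) : DiffPoly W :=
  ∑ α, ∑ β, η α β • (varDeriv α P * totalDeriv (varDeriv β Q))

end DiffPoly

variable {U W : TopologicalSpace.Opens (Fin n → ℂ)}

/-! ### The dispersionless system -/

/-- The matrix `η^{αβ} ∂²f/∂v^β∂v^γ` at the point `w`; rows `α`, columns `γ`. -/
def hess (η : Matrix (Fin n) (Fin n) ℂ) (f : Hol W) (w : W) : Matrix (Fin n) (Fin n) ℂ :=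
  Matrix.of fun α γ => ∑ β, η α β * Hol.pd β (Hol.pd γ f) w

/-- `F₀ = ∫ f dx` is a conservation law, on the open set `W ⊆ U`, of the system with
Hamiltonian `H₀ = ∫ h₀ dx`: `{H₀, F₀} = 0`. -/
def IsConserved (η : Matrix (Fin n) (Fin n) ℂ) (h₀ : Hol U) (hW : W ≤ U) (f : Hol W) : Prop :=
  DiffPoly.SameFunctional
    (DiffPoly.bracket η (DiffPoly.ofHol (Hol.res hW h₀)) (DiffPoly.ofHol f)) 0

/-- `f` is generic: `(η^{αβ} ∂_β∂_γ f)` has `n` pairwise distinct eigenvalues at all points. -/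
def IsGeneric (η : Matrix (Fin n) (Fin n) ℂ) (f : Hol W) : Prop :=
  ∀ w : W, ∃ μ : Fin n → ℂ, Function.Injective μ ∧
    ∀ i, Module.End.HasEigenvalue (Matrix.toLin' (hess η f w)) (μ i)

/-- Integrability of the dispersionless system: near every point the conservation laws are
parametrized by `n` arbitrary functions of one variable. Precisely, through every `v₀ ∈ U` pass
`n` analytic curves `γ_i` with independent velocities such that for arbitrary analytic `g_1, …, g_n`
some conservation law near `v₀` has the characteristic speed `g_i` along `γ_i`, i.e.
`(η^{αβ} ∂_β∂_γ f)(γ_i(t)) γ_i'(t) = g_i(t) γ_i'(t)`. -/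
def IsIntegrable (η : Matrix (Fin n) (Fin n) ℂ) (h₀ : Hol U) : Prop :=
  ∀ v₀ ∈ U, ∃ γ : Fin n → ℂ → (Fin n → ℂ),
    (∀ i, AnalyticAt ℂ (γ i) 0 ∧ γ i 0 = v₀) ∧
    LinearIndependent ℂ (fun i => deriv (γ i) 0) ∧
    ∀ g : Fin n → ℂ → ℂ, (∀ i, AnalyticAt ℂ (g i) 0) →
      ∃ (W : TopologicalSpace.Opens (Fin n → ℂ)) (hW : W ≤ U) (f : Hol W),
        v₀ ∈ W ∧ IsConserved η h₀ hW f ∧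
        ∀ i, ∀ᶠ t in 𝓝 (0 : ℂ), ∃ ht : γ i t ∈ W,
          (hess η f ⟨γ i t, ht⟩).mulVec (deriv (γ i) t) = g i t • deriv (γ i) t

/-- The Jacobian matrix `(R_{i,α})`. -/
def jacobian (R : Fin n → Hol U) (v : U) : Matrix (Fin n) (Fin n) ℂ :=
  Matrix.of fun i α => Hol.pd α (R i) v

/-- `R_1, …, R_n` are a complete set of Riemann invariants, with characteristic speeds
`lam_1, …, lam_n`: the Jacobian of `R` is nondegenerate, and `A^α_β R_{i,α} = lam_i R_{i,β}`. -/
def IsCompleteRiemannInvariants (η : Matrix (Fin n) (Fin n) ℂ) (h₀ : Hol U)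
    (lam R : Fin n → Hol U) : Prop :=
  (∀ v, IsUnit (jacobian R v).det) ∧
  ∀ i β v, ∑ α, hess η h₀ v α β * Hol.pd α (R i) v = lam i v * Hol.pd β (R i) v

/-- The derivative `f_{,i} = ∂f/∂R_i = ∑_α (∂v^α/∂R_i) ∂f/∂v^α` in the coordinates `R`. -/
def dR (R : Fin n → Hol U) (i : Fin n) (f : U → ℂ) : U → ℂ :=
  fun v => ∑ α, (jacobian R v)⁻¹ α i * pd α f v

/-- The differential polynomial `R_{i,x}`. -/
def Rx (R : Fin n → Hol U) (i : Fin n) : DiffPoly U :=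
  DiffPoly.totalDeriv (DiffPoly.ofHol (R i))

/-- `a_{ij} = lam_{i,j} / (lam_i - lam_j)`. -/
def aCoef (lam R : Fin n → Hol U) (i j : Fin n) : U → ℂ :=
  fun v => dR R j (lam i) v / (lam i v - lam j v)

/-- `ω_{ij} = (p_{i,j} - p_{j,i}) / (lam_i - lam_j)`. -/
def omega (lam R p : Fin n → Hol U) (i j : Fin n) : U → ℂ :=
  fun v => (dR R j (p i) v - dR R i (p j) v) / (lam i v - lam j v)

/-- `C` is a function `c(r)` of the single variable `r`: it is so near every point of `U`, with `c`
holomorphic, and with one holomorphic `c` on each open set in which the level sets of `r` are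
connected. -/
def IsFunctionOf (r C : Hol U) : Prop :=
  (∀ v : U, ∃ c : ℂ → ℂ, AnalyticAt ℂ c (r v) ∧ ∀ᶠ w in 𝓝 v, C w = c (r w)) ∧
  ∀ W : Set U, IsOpen W → (∀ z : ℂ, IsPreconnected {w | w ∈ W ∧ r w = z}) →
    ∃ c : ℂ → ℂ, AnalyticOnNhd ℂ c ((fun w => r w) '' W) ∧ ∀ w ∈ W, C w = c (r w)

/-! ### Perturbations -/

/-- `H = ∑_j ε^j ∫ H_j dx` is a Hamiltonian perturbation of `H₀ = ∫ h₀ dx`: `H_j` is a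
differential polynomial, homogeneous of degree `j`, and the term of order `0` is `h₀`. -/
def IsPerturbation (h₀ : Hol U) (H : ℕ → DiffPoly U) : Prop :=
  H 0 = DiffPoly.ofHol h₀ ∧ ∀ j, (H j).IsHomogeneousOfDegree j

/-- Near every point of `W`, `∫ f dx` extends to `F = ∑_j ε^j F_j` with
`{H, F} = O(ε^{N+1})` (with `{H, F} = 0`, if `N = ⊤`). -/
def Extends (η : Matrix (Fin n) (Fin n) ℂ) (H : ℕ → DiffPoly U) (N : ℕ∞) (hW : W ≤ U)
    (f : Hol W) : Prop :=
  ∀ w ∈ W, ∃ (W' : TopologicalSpace.Opens (Fin n → ℂ)) (hW' : W' ≤ W) (F : ℕ → DiffPoly W'),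
    w ∈ W' ∧ F 0 = DiffPoly.ofHol (Hol.res hW' f) ∧ (∀ j, (F j).IsHomogeneousOfDegree j) ∧
    ∀ m : ℕ, (m : ℕ∞) ≤ N → DiffPoly.SameFunctional
      (∑ a ∈ Finset.range (m + 1),
        DiffPoly.bracket η (DiffPoly.res (hW'.trans hW) (H a)) (F (m - a))) 0

/-- `O(ε^N)`-integrability of the perturbation `H` (integrability, if `N = ⊤`): the dispersionless
limit is integrable, and all its generic conservation laws extend up to order `N`. -/
def IsIntegrableUpTo (η : Matrix (Fin n) (Fin n) ℂ) (h₀ : Hol U) (H : ℕ → DiffPoly U)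
    (N : ℕ∞) : Prop :=
  IsIntegrable η h₀ ∧
  ∀ (W : TopologicalSpace.Opens (Fin n → ℂ)) (hW : W ≤ U) (f : Hol W),
    IsConserved η h₀ hW f → IsGeneric η f → Extends η H N hW f

/-- The variant in which all conservation laws, generic or not, have to extend. -/
def IsStronglyIntegrableUpTo (η : Matrix (Fin n) (Fin n) ℂ) (h₀ : Hol U) (H : ℕ → DiffPoly U)
    (N : ℕ∞) : Prop :=
  IsIntegrable η h₀ ∧
  ∀ (W : TopologicalSpace.Opens (Fin n → ℂ)) (hW : W ≤ U) (f : Hol W),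
    IsConserved η h₀ hW f → Extends η H N hW f

end HamPert

end

/-!
# First and second order integrability of Hamiltonian perturbations

Everything is computed in the coordinates `R_i`. The operators `∂/∂R_i` form a frame of commuting
derivations `dRh R i` of the ring of holomorphic functions. A conservation law `∫ f dx` has a matrix
of second derivatives that commutes with that of `h₀`; as the speeds `λ_i` are distinct, it is
diagonal in the same frame, with speeds `μ_i` that satisfy `μ_{i,j} = a_{ij} (μ_i - μ_j)`
(`HasSpeeds.exists_of_involution`, `HasSpeeds.dRh_eq`). Conversely, integrability of the
dispersionless system gives conservation laws with arbitrary distinct values of `μ_i` and arbitrary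
values of `μ_{i,i}` at a point (`exists_conserved`); this is all that is used of it.

The bracket of a functional of order one with `∫ f dx` is the derivative of its density along the
flow `R_{i,s} = μ_i R_{i,x}`. Hence for `F₁ = ∫ ∑ q_i R_{i,x} dx` the bracket
`{H₀, F₁} + {H₁, F₀}` is a quadratic form in the `R_{i,x}`, and such a form is a total derivative
only if it is zero. This gives
`q_{i,j} - q_{j,i} = ω_{ij} (μ_i - μ_j)` (`HasSpeeds.first_order_iff`).
The exterior derivative of the right hand side is `∑ μ_i E_{ijk}` over cyclic permutations, where
`E_{ijk} = 0` is the compatibility condition (`cyclic_sum_eq_compatDefect`). As the values of the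
`μ_i` are arbitrary, the condition is necessary already for the generic conservation laws
(`compatDefect_eq_zero`). If it holds, the two-form is closed and the Poincaré lemma, proved here
for analytic germs by inverting `y · ∂ + 2` on power series, yields the `q_i`, whatever the
conservation law (`extends_of_compatDefect`).

At second order, `F₂` is a quadratic form `∑ e_{ij} R_{i,x} R_{j,x}` modulo total derivatives, and
`{H₀, F₂} + {H₂, F₀}` is a density of degree three. For it to be a total derivative, the second
derivatives give `e_{ij} (λ_i - λ_j) = d_{ij} (μ_i - μ_j)`, and the cubic terms give one equation for
each triple of indices (`HasSpeeds.quadratic_condition`).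
* The triples `i, i, i` and `i, i, j` determine and then eliminate `e_{ii}`. There remains the
  vanishing of the product of `(λ_i - λ_j) μ_{i,i} - (μ_i - μ_j) λ_{i,i}`, which is made nonzero by
  the choice of `μ_{i,i}`, and the Wronskian `d_{ii,j} λ_{i,i} - d_{ii} λ_{i,ij}`
  (`HasSpeeds.diagonal_condition`). So `d_{ii} / λ_{i,i}` depends on `R_i` only, locally and then
  also along connected level sets (`IsCoord.isFunctionOf`).
* For distinct `i, j, k` the equation is the product of the cyclic sum in the theorem and a function
  that is affine in `μ_k` with slope `λ_i - λ_j` (`HasSpeeds.cyclic_condition`).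
-/


noncomputable section

namespace HamPert

variable {n : ℕ}

/-! ### Calculus in the algebra of holomorphic functions -/

section HolCalculus

variable {U W : TopologicalSpace.Opens (Fin n → ℂ)}

/-- The ring structure of `Hol W`, put together so that its underlying semiring is, by unfolding
instances only, the one over which `DiffPoly W` is defined. -/
instance Hol.instCommRing : CommRing (Hol W) :=
  { (inferInstance : CommSemiring (Hol W)) with
    neg := fun f => -f
    sub := fun f g => f - g
    sub_eq_add_neg := fun f g => sub_eq_add_neg f g
    zsmul := fun k f => k • f
    zsmul_zero' := fun f => zero_zsmul f
    zsmul_succ' := fun k f => SubNegMonoid.zsmul_succ' k f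
    zsmul_neg' := fun k f => SubNegMonoid.zsmul_neg' k f
    neg_add_cancel := fun f => neg_add_cancel f
    intCast := fun k => (k : Hol W)
    intCast_ofNat := fun k => Int.cast_natCast k
    intCast_negSucc := fun k => Int.cast_negSucc k }

/-- The extension by zero of a holomorphic function on `W` to all of `ℂⁿ`. -/
def Hol.ext0 (f : Hol W) : (Fin n → ℂ) → ℂ := Function.extend Subtype.val f.1 0

theorem Hol.ext0_coe (f : Hol W) (w : W) : Hol.ext0 f w = f w :=
  Subtype.val_injective.extend_apply _ _ _

theorem Hol.ext0_of_mem (f : Hol W) {v : Fin n → ℂ} (hv : v ∈ W) : Hol.ext0 f v = f ⟨v, hv⟩ :=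
  Hol.ext0_coe f ⟨v, hv⟩

theorem Hol.ext_iff' {f g : Hol W} : f = g ↔ ∀ w, f w = g w :=
  ⟨fun h _ => h ▸ rfl, fun h => Subtype.ext (funext h)⟩

theorem Hol.analyticAt (f : Hol W) {v : Fin n → ℂ} (hv : v ∈ W) : AnalyticAt ℂ (Hol.ext0 f) v := by
  obtain ⟨F, hF, hfF⟩ := f.2
  refine (hF v hv).congr ?_
  filter_upwards [W.isOpen.mem_nhds hv] with u hu
  rw [Hol.ext0_of_mem f hu, hfF]

theorem Hol.differentiableAt (f : Hol W) {v : Fin n → ℂ} (hv : v ∈ W) :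
    DifferentiableAt ℂ (Hol.ext0 f) v := (Hol.analyticAt f hv).differentiableAt

theorem Hol.continuous (f : Hol W) : Continuous f.1 := by
  rw [continuous_iff_continuousAt]
  intro w
  have h := (Hol.analyticAt f w.2).continuousAt.comp (f := fun w : W => (w : Fin n → ℂ))
    (x := w) continuous_subtype_val.continuousAt
  exact h.congr (Filter.Eventually.of_forall fun w => Hol.ext0_coe f w)

/-- A function that is analytic at all points of `W` restricts to an element of `Hol W`. -/
def Hol.mk' (F : (Fin n → ℂ) → ℂ) (hF : AnalyticOnNhd ℂ F W) : Hol W :=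
  ⟨fun w => F w, F, hF, fun _ => rfl⟩

theorem Hol.ext0_eventuallyEq (f : Hol W) {F : (Fin n → ℂ) → ℂ} {v : Fin n → ℂ} (hv : v ∈ W)
    (h : ∀ᶠ u in 𝓝 v, ∀ hu : u ∈ W, f ⟨u, hu⟩ = F u) : Hol.ext0 f =ᶠ[𝓝 v] F := by
  filter_upwards [h, W.isOpen.mem_nhds hv] with u hu hu'
  rw [Hol.ext0_of_mem f hu', hu hu']

theorem Hol.pd_apply (α : Fin n) (f : Hol W) (w : W) :
    Hol.pd α f w = fderiv ℂ (Hol.ext0 f) w (Pi.single α 1) := rfl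

theorem Hol.ext0_add (f g : Hol W) {v : Fin n → ℂ} (hv : v ∈ W) :
    Hol.ext0 (f + g) =ᶠ[𝓝 v] Hol.ext0 f + Hol.ext0 g :=
  Hol.ext0_eventuallyEq _ hv (Filter.Eventually.of_forall fun u hu => by
    simp [Hol.ext0_of_mem _ hu])

theorem Hol.ext0_mul (f g : Hol W) {v : Fin n → ℂ} (hv : v ∈ W) :
    Hol.ext0 (f * g) =ᶠ[𝓝 v] Hol.ext0 f * Hol.ext0 g :=
  Hol.ext0_eventuallyEq _ hv (Filter.Eventually.of_forall fun u hu => by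
    simp [Hol.ext0_of_mem _ hu])

theorem Hol.ext0_smul (c : ℂ) (f : Hol W) {v : Fin n → ℂ} (hv : v ∈ W) :
    Hol.ext0 (c • f) =ᶠ[𝓝 v] c • Hol.ext0 f :=
  Hol.ext0_eventuallyEq _ hv (Filter.Eventually.of_forall fun u hu => by
    simp [Hol.ext0_of_mem _ hu])

/-- `∂/∂v^α` as a derivation of the algebra `Hol W`. -/
def Hol.pdD (α : Fin n) : Derivation ℂ (Hol W) (Hol W) :=
  Derivation.mk'
    { toFun := Hol.pd α
      map_add' := fun f g => Hol.ext_iff'.2 fun w => by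
        have : Hol.ext0 (f + g) =ᶠ[𝓝 (w : Fin n → ℂ)] Hol.ext0 f + Hol.ext0 g :=
          Hol.ext0_add f g w.2
        change fderiv ℂ (Hol.ext0 (f + g)) w _ =
          fderiv ℂ (Hol.ext0 f) w _ + fderiv ℂ (Hol.ext0 g) w _
        rw [this.fderiv_eq, fderiv_add (Hol.differentiableAt f w.2) (Hol.differentiableAt g w.2)]
        rfl
      map_smul' := fun c f => Hol.ext_iff'.2 fun w => by
        have : Hol.ext0 (c • f) =ᶠ[𝓝 (w : Fin n → ℂ)] c • Hol.ext0 f := Hol.ext0_smul c f w.2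
        change fderiv ℂ (Hol.ext0 (c • f)) w _ = c • fderiv ℂ (Hol.ext0 f) w _
        rw [this.fderiv_eq, fderiv_const_smul (Hol.differentiableAt f w.2)]
        rfl }
    fun f g => Hol.ext_iff'.2 fun w => by
      have : Hol.ext0 (f * g) =ᶠ[𝓝 (w : Fin n → ℂ)] Hol.ext0 f * Hol.ext0 g := Hol.ext0_mul f g w.2
      change fderiv ℂ (Hol.ext0 (f * g)) w _ =
        f w * fderiv ℂ (Hol.ext0 g) w _ + g w * fderiv ℂ (Hol.ext0 f) w _
      rw [this.fderiv_eq, fderiv_mul (Hol.differentiableAt f w.2) (Hol.differentiableAt g w.2)]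
      simp [Hol.ext0_coe]

theorem Hol.pdD_apply (α : Fin n) (f : Hol W) : Hol.pdD α f = Hol.pd α f := rfl

theorem Hol.pd_comm (α β : Fin n) (f : Hol W) :
    Hol.pd α (Hol.pd β f) = Hol.pd β (Hol.pd α f) := by
  refine Hol.ext_iff'.2 fun w => ?_
  have key : ∀ α β : Fin n, Hol.pd α (Hol.pd β f) w
      = fderiv ℂ (fderiv ℂ (Hol.ext0 f)) w (Pi.single α 1) (Pi.single β 1) := by
    intro α β
    have h : Hol.ext0 (Hol.pd β f) =ᶠ[𝓝 (w : Fin n → ℂ)]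
        fun v => fderiv ℂ (Hol.ext0 f) v (Pi.single β 1) :=
      Hol.ext0_eventuallyEq _ w.2 (Filter.Eventually.of_forall fun u hu => rfl)
    rw [Hol.pd_apply, h.fderiv_eq, fderiv_clm_apply (Hol.analyticAt f w.2).fderiv.differentiableAt
      (differentiableAt_const _)]
    simp
  rw [key, key]
  have := (Hol.analyticAt f w.2).contDiffAt (n := ⊤)
  exact (this.isSymmSndFDerivAt (by simp)).eq _ _

theorem Hol.res_apply (h : W ≤ U) (f : Hol U) (w : W) : Hol.res h f w = f ⟨w, h w.2⟩ := rfl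

theorem Hol.pd_res (h : W ≤ U) (α : Fin n) (f : Hol U) :
    Hol.pd α (Hol.res h f) = Hol.res h (Hol.pd α f) := by
  refine Hol.ext_iff'.2 fun w => ?_
  have : Hol.ext0 (Hol.res h f) =ᶠ[𝓝 (w : Fin n → ℂ)] Hol.ext0 f :=
    Hol.ext0_eventuallyEq _ w.2 (Filter.Eventually.of_forall fun u hu => by
      rw [Hol.ext0_of_mem f (h hu)]; rfl)
  rw [Hol.pd_apply, this.fderiv_eq]
  rfl

theorem Hol.isUnit_of_forall_ne_zero {f : Hol W} (hf : ∀ w, f w ≠ 0) : IsUnit f := by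
  obtain ⟨F, hF, hfF⟩ := f.2
  refine IsUnit.of_mul_eq_one ⟨fun w => (f w)⁻¹, fun v => (F v)⁻¹, fun v hv => ?_, fun w => ?_⟩ ?_
  · exact (hF v hv).inv (by rw [← hfF ⟨v, hv⟩]; exact hf _)
  · simp [hfF]
  · exact Hol.ext_iff'.2 fun w => mul_inv_cancel₀ (hf w)

/-- Evaluation at a point, as a ring homomorphism. -/
def Hol.ev (w : W) : Hol W →+* ℂ := (Pi.evalRingHom (fun _ : W => ℂ) w).comp (Hol W).subtype

theorem Hol.ev_apply (w : W) (f : Hol W) : Hol.ev w f = f w := rfl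

theorem Hol.sum_apply {ι : Type*} (s : Finset ι) (f : ι → Hol W) (w : W) :
    (∑ i ∈ s, f i : Hol W) w = ∑ i ∈ s, f i w := map_sum (Hol.ev w) f s

theorem Hol.sub_apply (f g : Hol W) (w : W) : (f - g : Hol W) w = f w - g w := rfl
theorem Hol.mul_apply (f g : Hol W) (w : W) : (f * g : Hol W) w = f w * g w := rfl

theorem Hol.natCast_mul_eq_zero {m : ℕ} (hm : m ≠ 0) {f : Hol W} (h : (m : Hol W) * f = 0) :
    f = 0 :=
  Hol.ext_iff'.2 fun w => by
    have h1 := congrArg (Hol.ev w) h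
    rw [map_mul, map_zero, map_natCast] at h1
    exact (mul_eq_zero.1 h1).resolve_left (Nat.cast_ne_zero.2 hm)

theorem Hol.two_mul_eq_zero {f : Hol W} (h : 2 * f = 0) : f = 0 :=
  Hol.natCast_mul_eq_zero two_ne_zero (by rwa [Nat.cast_ofNat])

end HolCalculus

/-! ### Derivations of differential polynomials -/

namespace DiffPoly

open MvPolynomial

variable {U W : TopologicalSpace.Opens (Fin n → ℂ)}

theorem coeff_jetDeriv_zero (α : Fin n) (P : DiffPoly W) (m : Fin n × ℕ →₀ ℕ) :
    coeff m (jetDeriv α 0 P) = Hol.pd α (coeff m P) := by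
  classical
  change coeff m (∑ k ∈ P.support, monomial k (Hol.pd α (P.coeff k))) = _
  rw [coeff_sum]
  simp only [coeff_monomial]
  rw [Finset.sum_ite_eq']
  split_ifs with h
  · rfl
  · rw [notMem_support_iff.1 h, ← Hol.pdD_apply, map_zero]

/-- The derivation `∂/∂v^α` of differential polynomials, acting on the coefficients. -/
def coeffD (α : Fin n) : Derivation ℂ (DiffPoly W) (DiffPoly W) where
  toFun := jetDeriv α 0
  map_add' P Q := by
    ext1 m
    rw [coeff_add, coeff_jetDeriv_zero, coeff_jetDeriv_zero, coeff_jetDeriv_zero, coeff_add]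
    exact map_add (Hol.pdD α) _ _
  map_smul' c P := by
    ext1 m
    rw [RingHom.id_apply, coeff_smul, coeff_jetDeriv_zero, coeff_jetDeriv_zero, coeff_smul]
    exact (Hol.pdD α).map_smul c _
  map_one_eq_zero' := by
    classical
    ext1 m
    change coeff m (jetDeriv α 0 1) = _
    rw [coeff_jetDeriv_zero, coeff_one, coeff_zero]
    split_ifs
    · exact (Hol.pdD α).map_one_eq_zero
    · exact map_zero (Hol.pdD α)
  leibniz' P Q := by
    classical
    change jetDeriv α 0 (P * Q) = P * jetDeriv α 0 Q + Q * jetDeriv α 0 P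
    rw [mul_comm Q]
    ext1 m
    simp only [coeff_add, coeff_mul, coeff_jetDeriv_zero]
    rw [← Hol.pdD_apply, map_sum, ← Finset.sum_add_distrib]
    refine Finset.sum_congr rfl fun x _ => ?_
    rw [Derivation.leibniz, Hol.pdD_apply, Hol.pdD_apply, smul_eq_mul, smul_eq_mul,
      mul_comm (coeff x.2 Q)]

/-- The operator `jetDeriv α ℓ = ∂/∂v^α_ℓ` as a derivation over `ℂ`. -/
def jetD (α : Fin n) : ℕ → Derivation ℂ (DiffPoly W) (DiffPoly W)
  | 0 => coeffD α
  | k + 1 => (pderiv (α, k)).restrictScalars ℂ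

theorem jetD_apply (α : Fin n) (ℓ : ℕ) (P : DiffPoly W) : jetD α ℓ P = jetDeriv α ℓ P := by
  cases ℓ <;> rfl

theorem jetD_zero_C (α : Fin n) (f : Hol W) :
    jetD α 0 (C f : DiffPoly W) = C (Hol.pd α f) := by
  classical
  ext1 m
  rw [jetD_apply, coeff_jetDeriv_zero, coeff_C, coeff_C]
  split_ifs
  · rfl
  · exact map_zero (Hol.pdD α)

theorem jetD_zero_X (α : Fin n) (i : Fin n × ℕ) : jetD α 0 (X i : DiffPoly W) = 0 := by
  classical
  ext1 m
  rw [jetD_apply, coeff_jetDeriv_zero, coeff_X, coeff_zero]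
  split_ifs
  · exact (Hol.pdD α).map_one_eq_zero
  · exact map_zero (Hol.pdD α)

theorem jetD_succ_C (α : Fin n) (k : ℕ) (f : Hol W) :
    jetD α (k + 1) (C f : DiffPoly W) = 0 := pderiv_C

theorem jetD_succ_X (α : Fin n) (k : ℕ) (i : Fin n × ℕ) :
    jetD α (k + 1) (X i : DiffPoly W) = if i = (α, k) then 1 else 0 := by
  classical
  change pderiv (α, k) (X i) = _
  rw [pderiv_X, Pi.single_apply]

/-- A shortcut: the search for this instance is slow. -/
instance : SMul (DiffPoly W) (Derivation ℂ (DiffPoly W) (DiffPoly W)) :=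
  (inferInstance : Module (DiffPoly W) (Derivation ℂ (DiffPoly W) (DiffPoly W))).toSMul

/-- The total derivative `∂ₓ` as a derivation over `ℂ`. -/
def totalD : Derivation ℂ (DiffPoly W) (DiffPoly W) :=
  (∑ α, (X (α, 0) : DiffPoly W) • jetD α 0) +
    (mkDerivation (Hol W) (fun i : Fin n × ℕ => (X (i.1, i.2 + 1) : DiffPoly W))).restrictScalars ℂ

theorem totalD_apply (P : DiffPoly W) : totalD P = totalDeriv P := by
  unfold totalD totalDeriv
  rw [Derivation.add_apply]
  congr 1
  have h := map_sum (Derivation.coeFnAddMonoidHom (R := ℂ) (A := DiffPoly W) (M := DiffPoly W))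
    (fun α => (X (α, 0) : DiffPoly W) • jetD α 0) Finset.univ
  refine (congrFun h P).trans ?_
  rw [Finset.sum_apply]
  rfl

theorem totalD_C (f : Hol W) :
    totalD (C f : DiffPoly W) = ∑ α, X (α, 0) * C (Hol.pd α f) := by
  rw [totalD_apply]
  unfold totalDeriv
  simp [← jetD_apply, jetD_zero_C]

theorem totalD_X (i : Fin n × ℕ) : totalD (X i : DiffPoly W) = X (i.1, i.2 + 1) := by
  rw [totalD_apply]
  unfold totalDeriv
  simp [← jetD_apply, jetD_zero_X, mkDerivation_X]

/-- Two `ℂ`-derivations of differential polynomials agree if they agree on functions and on jet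
variables. -/
theorem derivation_ext' {D₁ D₂ : Derivation ℂ (DiffPoly W) (DiffPoly W)}
    (hC : ∀ f, D₁ (C f) = D₂ (C f)) (hX : ∀ i, D₁ (X i) = D₂ (X i)) : D₁ = D₂ := by
  ext1 P
  induction P using MvPolynomial.induction_on with
  | C f => exact hC f
  | add P Q hP hQ => rw [map_add, map_add, hP, hQ]
  | mul_X P i hP => rw [Derivation.leibniz, Derivation.leibniz, hP, hX]

theorem jetD_zero_totalD (α : Fin n) (P : DiffPoly W) :
    jetD α 0 (totalD P) = totalD (jetD α 0 P) := by
  have : ⁅(jetD α 0 : Derivation ℂ (DiffPoly W) (DiffPoly W)), totalD⁆ =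
      (0 : Derivation ℂ (DiffPoly W) (DiffPoly W)) := by
    refine derivation_ext' (fun f => ?_) fun i => ?_
    · rw [Derivation.commutator_apply, totalD_C, jetD_zero_C, totalD_C, map_sum]
      simp [jetD_zero_C, jetD_zero_X, Hol.pd_comm α]
    · rw [Derivation.commutator_apply, totalD_X, jetD_zero_X, jetD_zero_X]
      simp
  have h := congrArg (fun D => D P) this
  simpa [Derivation.commutator_apply, sub_eq_zero] using h

theorem jetD_succ_totalD (α : Fin n) (k : ℕ) (P : DiffPoly W) :
    jetD α (k + 1) (totalD P) = totalD (jetD α (k + 1) P) + jetD α k P := by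
  classical
  have : ⁅(jetD α (k + 1) : Derivation ℂ (DiffPoly W) (DiffPoly W)), totalD⁆ =
      (jetD α k : Derivation ℂ (DiffPoly W) (DiffPoly W)) := by
    refine derivation_ext' (fun f => ?_) fun i => ?_
    · rw [Derivation.commutator_apply, totalD_C, jetD_succ_C, map_zero, sub_zero, map_sum]
      rcases k with _ | k
      · simp [jetD_succ_C, jetD_succ_X, jetD_zero_C, Prod.ext_iff]
      · simp [jetD_succ_C, jetD_succ_X, Prod.ext_iff]
    · rw [Derivation.commutator_apply, totalD_X, jetD_succ_X, jetD_succ_X]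
      have : totalD (if i = (α, k) then 1 else 0 : DiffPoly W) = 0 := by split_ifs <;> simp
      rw [this, sub_zero]
      rcases k with _ | k
      · simp [jetD_zero_X]
      · rw [jetD_succ_X]
        simp [Prod.ext_iff]
  have h := congrArg (fun D => D P) this
  simp only [Derivation.commutator_apply] at h
  exact sub_eq_iff_eq_add'.1 h

/-! ### Variational derivatives -/

/-- `P` does not depend on the jet variables of order `N` and higher. -/
theorem exists_jetD_eq_zero (P : DiffPoly W) : ∃ N, ∀ ℓ ≥ N, ∀ α, jetD α ℓ P = 0 := by
  classical
  refine ⟨P.vars.sup Prod.snd + 2, fun ℓ hℓ α => ?_⟩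
  obtain ⟨k, rfl⟩ : ∃ k, ℓ = k + 1 := ⟨ℓ - 1, by omega⟩
  refine pderiv_eq_zero_of_notMem_vars fun h => ?_
  have := Finset.le_sup (f := Prod.snd) h
  simp only at this
  omega

theorem varDeriv_eq_sum (α : Fin n) (P : DiffPoly W) {N : ℕ} (h : ∀ ℓ ≥ N, jetD α ℓ P = 0) :
    varDeriv α P = ∑ ℓ ∈ Finset.range N, (-1 : DiffPoly W) ^ ℓ * totalD^[ℓ] (jetD α ℓ P) := by
  have h0 : ∀ ℓ, totalDeriv^[ℓ] (jetDeriv α ℓ P) = totalD^[ℓ] (jetD α ℓ P) := fun ℓ => by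
    rw [jetD_apply, funext totalD_apply]
  unfold varDeriv
  simp only [h0]
  refine finsum_eq_sum_of_support_subset _ fun ℓ hℓ => ?_
  by_contra hN
  refine hℓ ?_
  change (-1 : DiffPoly W) ^ ℓ * totalD^[ℓ] (jetD α ℓ P) = 0
  rw [h ℓ (by simpa using hN), Function.iterate_fixed (map_zero _), mul_zero]

theorem iterate_totalD_add (ℓ : ℕ) (P Q : DiffPoly W) :
    totalD^[ℓ] (P + Q) = totalD^[ℓ] P + totalD^[ℓ] Q :=
  iterate_map_add totalD ℓ P Q

theorem varDeriv_add (α : Fin n) (P Q : DiffPoly W) :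
    varDeriv α (P + Q) = varDeriv α P + varDeriv α Q := by
  obtain ⟨N₁, h₁⟩ := exists_jetD_eq_zero P
  obtain ⟨N₂, h₂⟩ := exists_jetD_eq_zero Q
  have h₁' : ∀ ℓ ≥ max N₁ N₂, jetD α ℓ P = 0 := fun ℓ h => h₁ ℓ (le_trans (le_max_left _ _) h) α
  have h₂' : ∀ ℓ ≥ max N₁ N₂, jetD α ℓ Q = 0 := fun ℓ h => h₂ ℓ (le_trans (le_max_right _ _) h) α
  rw [varDeriv_eq_sum α P h₁', varDeriv_eq_sum α Q h₂', varDeriv_eq_sum α (P + Q)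
    (N := max N₁ N₂) (fun ℓ h => by rw [map_add, h₁' ℓ h, h₂' ℓ h, add_zero]),
    ← Finset.sum_add_distrib]
  refine Finset.sum_congr rfl fun ℓ _ => ?_
  rw [map_add, iterate_totalD_add, mul_add]

/-- The variational derivatives of a total derivative vanish: the sum telescopes. -/
theorem varDeriv_totalD (α : Fin n) (G : DiffPoly W) : varDeriv α (totalD G) = 0 := by
  obtain ⟨N, hN⟩ := exists_jetD_eq_zero G
  rw [varDeriv_eq_sum α (totalD G) (N := N + 1) fun ℓ h => by
    obtain ⟨k, rfl⟩ : ∃ k, ℓ = k + 1 := ⟨ℓ - 1, by omega⟩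
    rw [jetD_succ_totalD, hN _ (by omega), hN _ (by omega), map_zero, zero_add]]
  have key : ∀ M, ∑ ℓ ∈ Finset.range (M + 1),
      (-1 : DiffPoly W) ^ ℓ * totalD^[ℓ] (jetD α ℓ (totalD G))
      = (-1) ^ M * totalD^[M + 1] (jetD α M G) := by
    intro M
    induction M with
    | zero => simp [jetD_zero_totalD]
    | succ M ih =>
      rw [Finset.sum_range_succ, ih, jetD_succ_totalD, iterate_totalD_add,
        ← Function.iterate_succ_apply (f := totalD)]
      ring
  rw [key, hN N le_rfl, Function.iterate_fixed (map_zero _), mul_zero]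

theorem varDeriv_C (α : Fin n) (f : Hol W) : varDeriv α (C f : DiffPoly W) = C (Hol.pd α f) := by
  rw [varDeriv_eq_sum α _ (N := 1) fun ℓ h => by
    obtain ⟨k, rfl⟩ : ∃ k, ℓ = k + 1 := ⟨ℓ - 1, by omega⟩
    exact jetD_succ_C _ _ _]
  simp [jetD_zero_C]

theorem varDeriv_of_order_le_one (α : Fin n) {P : DiffPoly W} (h : ∀ ℓ, jetD α (ℓ + 2) P = 0) :
    varDeriv α P = jetD α 0 P - totalD (jetD α 1 P) := by
  rw [varDeriv_eq_sum α _ (N := 2) fun ℓ hℓ => by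
    obtain ⟨k, rfl⟩ : ∃ k, ℓ = k + 2 := ⟨ℓ - 2, by omega⟩
    exact h k]
  rw [Finset.sum_range_succ, Finset.sum_range_one, pow_zero, pow_one]
  simp
  ring

/-! ### Local functionals and the bracket -/

theorem sameFunctional_iff {P Q : DiffPoly W} :
    SameFunctional P Q ↔ ∃ G : DiffPoly W, P - Q = totalD G := by
  simp only [totalD_apply]; rfl

theorem SameFunctional.rfl' (P : DiffPoly W) : SameFunctional P P :=
  sameFunctional_iff.2 ⟨0, by simp⟩

theorem SameFunctional.symm {P Q : DiffPoly W} (h : SameFunctional P Q) : SameFunctional Q P := by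
  obtain ⟨G, hG⟩ := sameFunctional_iff.1 h
  exact sameFunctional_iff.2 ⟨-G, by rw [map_neg, ← hG]; ring⟩

theorem SameFunctional.trans {P Q S : DiffPoly W} (h : SameFunctional P Q)
    (h' : SameFunctional Q S) : SameFunctional P S := by
  obtain ⟨G, hG⟩ := sameFunctional_iff.1 h
  obtain ⟨G', hG'⟩ := sameFunctional_iff.1 h'
  exact sameFunctional_iff.2 ⟨G + G', by rw [map_add, ← hG, ← hG']; ring⟩

theorem SameFunctional.add {P Q P' Q' : DiffPoly W} (h : SameFunctional P Q)
    (h' : SameFunctional P' Q') : SameFunctional (P + P') (Q + Q') := by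
  obtain ⟨G, hG⟩ := sameFunctional_iff.1 h
  obtain ⟨G', hG'⟩ := sameFunctional_iff.1 h'
  exact sameFunctional_iff.2 ⟨G + G', by rw [map_add, ← hG, ← hG']; ring⟩

theorem SameFunctional.neg {P Q : DiffPoly W} (h : SameFunctional P Q) :
    SameFunctional (-P) (-Q) := by
  obtain ⟨G, hG⟩ := sameFunctional_iff.1 h
  exact sameFunctional_iff.2 ⟨-G, by rw [map_neg, ← hG]; ring⟩

theorem SameFunctional.sub {P Q P' Q' : DiffPoly W} (h : SameFunctional P Q)
    (h' : SameFunctional P' Q') : SameFunctional (P - P') (Q - Q') := by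
  rw [sub_eq_add_neg, sub_eq_add_neg]; exact h.add h'.neg

theorem SameFunctional.sum {ι : Type*} (s : Finset ι) {P Q : ι → DiffPoly W}
    (h : ∀ i ∈ s, SameFunctional (P i) (Q i)) : SameFunctional (∑ i ∈ s, P i) (∑ i ∈ s, Q i) := by
  classical
  induction s using Finset.induction_on with
  | empty => simpa using SameFunctional.rfl' _
  | insert a s ha ih =>
    rw [Finset.sum_insert ha, Finset.sum_insert ha]
    exact (h a (Finset.mem_insert_self _ _)).add
      (ih fun i hi => h i (Finset.mem_insert_of_mem hi))

/-- Integration by parts. -/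
theorem SameFunctional.parts (P Q : DiffPoly W) :
    SameFunctional (totalD P * Q) (-(P * totalD Q)) :=
  sameFunctional_iff.2 ⟨P * Q, by rw [Derivation.leibniz, smul_eq_mul, smul_eq_mul]; ring⟩

theorem SameFunctional.varDeriv_eq {P Q : DiffPoly W} (h : SameFunctional P Q) (α : Fin n) :
    varDeriv α P = varDeriv α Q := by
  obtain ⟨G, hG⟩ := sameFunctional_iff.1 h
  rw [sub_eq_iff_eq_add.1 hG, varDeriv_add, varDeriv_totalD, zero_add]

theorem SameFunctional.bracket_eq {P Q P' Q' : DiffPoly W} (η : Matrix (Fin n) (Fin n) ℂ)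
    (h : SameFunctional P Q) (h' : SameFunctional P' Q') :
    bracket η P P' = bracket η Q Q' := by
  unfold bracket
  simp only [h.varDeriv_eq, h'.varDeriv_eq]

theorem bracket_skew {η : Matrix (Fin n) (Fin n) ℂ} (hη : η.IsSymm) (P Q : DiffPoly W) :
    SameFunctional (bracket η P Q) (-bracket η Q P) := by
  have h : -bracket η Q P = ∑ α, ∑ β, -(η β α • (varDeriv β Q * totalDeriv (varDeriv α P))) := by
    unfold bracket
    rw [Finset.sum_comm]
    simp only [Finset.sum_neg_distrib]
  rw [h]
  refine SameFunctional.sum _ fun α _ => SameFunctional.sum _ fun β _ => ?_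
  obtain ⟨G, hG⟩ := sameFunctional_iff.1 (SameFunctional.parts (varDeriv β Q) (varDeriv α P))
  refine sameFunctional_iff.2 ⟨η α β • G, ?_⟩
  rw [Derivation.map_smul, ← hG, hη.apply α β, ← totalD_apply, ← totalD_apply, sub_neg_eq_add,
    sub_neg_eq_add, smul_add, mul_comm (varDeriv α P)]

end DiffPoly

namespace DiffPoly

open MvPolynomial

variable {U W : TopologicalSpace.Opens (Fin n → ℂ)}

/-! ### Restriction to a smaller open set -/

theorem res_C (h : W ≤ U) (f : Hol U) : res h (C f) = C (Hol.res h f) := map_C _ _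

theorem res_X (h : W ≤ U) (i : Fin n × ℕ) : res h (X i) = X i := map_X _ _

theorem res_add (h : W ≤ U) (P Q : DiffPoly U) : res h (P + Q) = res h P + res h Q :=
  map_add (MvPolynomial.map (Hol.res h)) P Q

theorem res_sub (h : W ≤ U) (P Q : DiffPoly U) : res h (P - Q) = res h P - res h Q :=
  map_sub (MvPolynomial.map (Hol.res h)) P Q

theorem res_mul (h : W ≤ U) (P Q : DiffPoly U) : res h (P * Q) = res h P * res h Q :=
  map_mul (MvPolynomial.map (Hol.res h)) P Q

theorem res_zero (h : W ≤ U) : res h 0 = 0 := map_zero (MvPolynomial.map (Hol.res h))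

theorem res_sum (h : W ≤ U) {ι : Type*} (s : Finset ι) (P : ι → DiffPoly U) :
    res h (∑ i ∈ s, P i) = ∑ i ∈ s, res h (P i) := map_sum (MvPolynomial.map (Hol.res h)) P s

theorem res_totalD (h : W ≤ U) (P : DiffPoly U) : res h (totalD P) = totalD (res h P) := by
  induction P using MvPolynomial.induction_on with
  | C f =>
    rw [totalD_C, res_C, totalD_C, res_sum]
    simp only [res_mul, res_X, res_C, Hol.pd_res]
  | add P Q hP hQ => rw [map_add, res_add, res_add, map_add, hP, hQ]
  | mul_X P i hP =>
    rw [Derivation.leibniz, res_mul, Derivation.leibniz, smul_eq_mul, smul_eq_mul, smul_eq_mul,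
      smul_eq_mul, res_add, res_mul, res_mul, hP, res_X, totalD_X, totalD_X, res_X]

theorem SameFunctional.res (h : W ≤ U) {P Q : DiffPoly U} (hPQ : SameFunctional P Q) :
    SameFunctional (DiffPoly.res h P) (DiffPoly.res h Q) := by
  obtain ⟨G, hG⟩ := sameFunctional_iff.1 hPQ
  exact sameFunctional_iff.2 ⟨DiffPoly.res h G, by rw [← res_sub, hG, res_totalD]⟩

theorem res_Rx (h : W ≤ U) (R : Fin n → Hol U) (i : Fin n) :
    res h (Rx R i) = Rx (fun j => Hol.res h (R j)) i := by
  unfold Rx ofHol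
  rw [← totalD_apply, ← totalD_apply, res_totalD, res_C]

/-! ### The grading -/

theorem isHomogeneous_totalD {P : DiffPoly W} {d : ℕ} (hP : P.IsHomogeneousOfDegree d) :
    (totalD P).IsHomogeneousOfDegree (d + 1) := by
  classical
  have hmon : ∀ (m : Fin n × ℕ →₀ ℕ) (f : Hol W),
      (totalD (monomial m f) : DiffPoly W).IsHomogeneousOfDegree
        (Finsupp.weight (fun i : Fin n × ℕ => i.2 + 1) m + 1) := by
    intro m
    induction m using Finsupp.induction_linear with
    | zero =>
      intro f
      change (totalD (C f)).IsHomogeneousOfDegree _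
      rw [totalD_C, map_zero]
      refine IsWeightedHomogeneous.sum _ _ _ fun α _ => ?_
      exact (isWeightedHomogeneous_X (Hol W) (fun i : Fin n × ℕ => i.2 + 1) (α, 0)).mul
        (isWeightedHomogeneous_C _ _)
    | add m m' hm hm' =>
      intro f
      rw [← mul_one f, ← monomial_mul, Derivation.leibniz, map_add, smul_eq_mul, smul_eq_mul]
      refine IsWeightedHomogeneous.add ?_ ?_
      · rw [add_assoc]
        exact (isWeightedHomogeneous_monomial _ _ _ rfl).mul (hm' 1)
      · rw [add_comm (Finsupp.weight _ m), add_assoc]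
        exact (isWeightedHomogeneous_monomial _ _ _ rfl).mul (hm f)
    | single i k =>
      intro f
      rw [← C_mul_X_pow_eq_monomial, Derivation.leibniz, smul_eq_mul, smul_eq_mul]
      have hX : ∀ j : Fin n × ℕ, IsWeightedHomogeneous (fun i : Fin n × ℕ => i.2 + 1)
          (X j : DiffPoly W) (j.2 + 1) := fun j => isWeightedHomogeneous_X _ _ _
      have hw : Finsupp.weight (fun i : Fin n × ℕ => i.2 + 1) (Finsupp.single i k)
          = k * (i.2 + 1) := by
        simp [Finsupp.weight_apply]
      rw [hw]
      refine IsWeightedHomogeneous.add (IsWeightedHomogeneous.C_mul ?_ _) ?_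
      · rw [Derivation.leibniz_pow, totalD_X]
        rcases k with _ | k
        · simpa using isWeightedHomogeneous_zero _ _ _
        · have h := ((hX i).pow k).mul (hX (i.1, i.2 + 1))
          have h2 := IsWeightedHomogeneous.C_mul h ((k + 1 : ℕ) : Hol W)
          have e : k • (i.2 + 1) + (i.2 + 1 + 1) = (k + 1) * (i.2 + 1) + 1 := by
            rw [smul_eq_mul]; ring
          rw [e] at h2
          convert h2 using 1
          simp [nsmul_eq_mul]
      · rw [totalD_C]
        have h1 : IsWeightedHomogeneous (fun i : Fin n × ℕ => i.2 + 1)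
            (∑ α, X (α, 0) * C (Hol.pd α f) : DiffPoly W) 1 :=
          IsWeightedHomogeneous.sum _ _ _ fun α _ => (hX (α, 0)).mul (isWeightedHomogeneous_C _ _)
        have h2 := ((hX i).pow k).mul h1
        rwa [smul_eq_mul] at h2
  rw [P.as_sum, map_sum]
  refine IsWeightedHomogeneous.sum _ _ _ fun m hm => ?_
  rw [← hP (mem_support_iff.1 hm)]
  exact hmon m _

/-- A primitive of a homogeneous differential polynomial may be replaced by its homogeneous component
of one degree less, as `∂ₓ` raises the degree by one. -/
theorem exists_homogeneous_primitive {P G : DiffPoly W} {d : ℕ}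
    (hP : P.IsHomogeneousOfDegree (d + 1)) (hG : P = totalD G) :
    ∃ G' : DiffPoly W, G'.IsHomogeneousOfDegree d ∧ P = totalD G' := by
  classical
  set w : Fin n × ℕ → ℕ := fun i => i.2 + 1
  refine ⟨weightedHomogeneousComponent w d G,
    weightedHomogeneousComponent_isWeightedHomogeneous _ _, ?_⟩
  have key : ∀ Q : DiffPoly W, weightedHomogeneousComponent w (d + 1) (totalD Q)
      = totalD (weightedHomogeneousComponent w d Q) := by
    intro Q
    rw [Q.as_sum]
    simp only [map_sum]
    refine Finset.sum_congr rfl fun m _ => ?_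
    have h0 : IsHomogeneousOfDegree (W := W) (monomial m (coeff m Q)) (Finsupp.weight w m) :=
      isWeightedHomogeneous_monomial _ _ _ rfl
    have h1 := isHomogeneous_totalD h0
    by_cases hd : Finsupp.weight w m = d
    · rw [hd] at h0 h1
      rw [h0.weightedHomogeneousComponent_same, h1.weightedHomogeneousComponent_same]
    · rw [h0.weightedHomogeneousComponent_ne d (by omega),
        h1.weightedHomogeneousComponent_ne (d + 1) (by omega), map_zero]
  rw [← key, ← hG]
  exact (IsWeightedHomogeneous.weightedHomogeneousComponent_same hP).symm

/-- Induction principle for homogeneous differential polynomials of low degree. -/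
theorem homogeneous_mem (S : Submodule (Hol W) (DiffPoly W)) {d : ℕ} {P : DiffPoly W}
    (hP : P.IsHomogeneousOfDegree d)
    (h : ∀ m : Fin n × ℕ →₀ ℕ, Finsupp.weight (fun i : Fin n × ℕ => i.2 + 1) m = d →
      (monomial m 1 : DiffPoly W) ∈ S) : P ∈ S := by
  rw [P.as_sum]
  refine Submodule.sum_mem _ fun m hm => ?_
  have := S.smul_mem (coeff m P) (h m (hP (mem_support_iff.1 hm)))
  rwa [smul_monomial, smul_eq_mul, mul_one] at this

theorem monomial_of_weight_zero {m : Fin n × ℕ →₀ ℕ}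
    (hm : Finsupp.weight (fun i : Fin n × ℕ => i.2 + 1) m = 0) : m = 0 := by
  ext i
  have := Finsupp.le_weight (fun i : Fin n × ℕ => i.2 + 1) (s := i) (by simp) m
  simp only [Finsupp.coe_zero, Pi.zero_apply]
  omega

theorem monomial_of_weight_succ {m : Fin n × ℕ →₀ ℕ} {d : ℕ}
    (hm : Finsupp.weight (fun i : Fin n × ℕ => i.2 + 1) m = d + 1) :
    ∃ (i : Fin n × ℕ) (m' : Fin n × ℕ →₀ ℕ), m = Finsupp.single i 1 + m' ∧
      i.2 + 1 + Finsupp.weight (fun i : Fin n × ℕ => i.2 + 1) m' = d + 1 := by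
  have hm0 : m ≠ 0 := by rintro rfl; simp at hm
  obtain ⟨i, hi⟩ := Finsupp.ne_iff.1 hm0
  have hle : Finsupp.single i 1 ≤ m := by
    rw [Finsupp.single_le_iff]; exact Nat.one_le_iff_ne_zero.2 hi
  refine ⟨i, m - Finsupp.single i 1, (add_tsub_cancel_of_le hle).symm, ?_⟩
  rw [← hm]
  conv_rhs => rw [← add_tsub_cancel_of_le hle, map_add]
  simp [Finsupp.weight_apply]

theorem exists_eq_C_of_degree_zero {P : DiffPoly W} (hP : P.IsHomogeneousOfDegree 0) :
    ∃ f : Hol W, P = C f := by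
  have : P ∈ Submodule.span (Hol W) {(1 : DiffPoly W)} :=
    homogeneous_mem _ hP fun m hm => by
      rw [monomial_of_weight_zero hm]; exact Submodule.subset_span rfl
  obtain ⟨f, hf⟩ := Submodule.mem_span_singleton.1 this
  exact ⟨f, by rw [← hf, smul_eq_C_mul, mul_one]⟩

theorem mem_span_of_degree_one {P : DiffPoly W} (hP : P.IsHomogeneousOfDegree 1) :
    P ∈ Submodule.span (Hol W) (Set.range fun α : Fin n => (X (α, 0) : DiffPoly W)) := by
  refine homogeneous_mem _ hP fun m hm => ?_
  obtain ⟨⟨α, k⟩, m', rfl, h⟩ := monomial_of_weight_succ hm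
  obtain rfl : k = 0 := by simp at h; omega
  rw [monomial_of_weight_zero (m := m') (by simp at h; omega), add_zero]
  exact Submodule.subset_span ⟨α, rfl⟩

theorem mem_span_of_degree_two {P : DiffPoly W} (hP : P.IsHomogeneousOfDegree 2) :
    P ∈ Submodule.span (Hol W) (Set.range fun α : Fin n => (X (α, 1) : DiffPoly W)) ⊔
      Submodule.span (Hol W) (Set.range fun α : Fin n × Fin n =>
        (X (α.1, 0) * X (α.2, 0) : DiffPoly W)) := by
  refine homogeneous_mem _ hP fun m hm => ?_
  obtain ⟨⟨α, k⟩, m', rfl, h⟩ := monomial_of_weight_succ hm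
  simp only at h
  rcases k with _ | k
  · obtain ⟨⟨β, l⟩, m'', rfl, h'⟩ := monomial_of_weight_succ (d := 0) (m := m') (by omega)
    obtain rfl : l = 0 := by simp at h'; omega
    rw [monomial_of_weight_zero (m := m'') (by simp at h'; omega), add_zero]
    refine Submodule.mem_sup_right (Submodule.subset_span ⟨(α, β), ?_⟩)
    simp [X, monomial_mul]
  · obtain rfl : k = 0 := by omega
    rw [monomial_of_weight_zero (m := m') (by omega), add_zero]
    exact Submodule.mem_sup_left (Submodule.subset_span ⟨α, rfl⟩)

end DiffPoly

section RiemannCoordinates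

open MvPolynomial DiffPoly

variable {U W : TopologicalSpace.Opens (Fin n → ℂ)}

/-! ### The coordinate frame of the Riemann invariants -/

theorem derivation_sum_apply {A : Type*} [CommRing A] [Algebra ℂ A] {ι : Type*} (s : Finset ι)
    (D : ι → Derivation ℂ A A) (a : A) : (∑ i ∈ s, D i) a = ∑ i ∈ s, D i a := by
  have h := map_sum (Derivation.coeFnAddMonoidHom (R := ℂ) (A := A) (M := A)) D s
  exact (congrFun h a).trans (Finset.sum_apply _ _ _)

/-- The Jacobian matrix of `R`, with entries in `Hol W`. -/
def jac (R : Fin n → Hol W) : Matrix (Fin n) (Fin n) (Hol W) :=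
  Matrix.of fun i α => Hol.pd α (R i)

/-- The inverse of the Jacobian matrix; its `i`-th column is the vector field `∂/∂R_i`. -/
def frame (R : Fin n → Hol W) : Matrix (Fin n) (Fin n) (Hol W) := (jac R)⁻¹

/-- The functions `R` form a coordinate system at all points: their Jacobian is invertible. -/
def IsCoord (R : Fin n → Hol W) : Prop := ∀ v, IsUnit (jacobian R v).det

theorem jac_apply (R : Fin n → Hol W) (i α : Fin n) : jac R i α = Hol.pd α (R i) := rfl

theorem map_ev_jac (R : Fin n → Hol W) (w : W) : (jac R).map (Hol.ev w) = jacobian R w := rfl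

theorem IsCoord.isUnit_det {R : Fin n → Hol W} (hR : IsCoord R) : IsUnit (jac R).det := by
  refine Hol.isUnit_of_forall_ne_zero fun w => ?_
  have h : (Hol.ev w) (jac R).det = (jacobian R w).det := by
    rw [RingHom.map_det]; rfl
  rw [← Hol.ev_apply, h]
  exact (hR w).ne_zero

theorem IsCoord.jac_mul_frame {R : Fin n → Hol W} (hR : IsCoord R) : jac R * frame R = 1 :=
  Matrix.mul_nonsing_inv _ hR.isUnit_det

theorem IsCoord.frame_mul_jac {R : Fin n → Hol W} (hR : IsCoord R) : frame R * jac R = 1 :=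
  Matrix.nonsing_inv_mul _ hR.isUnit_det

theorem IsCoord.sum_jac_frame {R : Fin n → Hol W} (hR : IsCoord R) (i j : Fin n) :
    ∑ α, jac R i α * frame R α j = if i = j then 1 else 0 := by
  rw [← Matrix.mul_apply, hR.jac_mul_frame, Matrix.one_apply]

theorem IsCoord.sum_frame_jac {R : Fin n → Hol W} (hR : IsCoord R) (α β : Fin n) :
    ∑ i, frame R α i * jac R i β = if α = β then 1 else 0 := by
  rw [← Matrix.mul_apply, hR.frame_mul_jac, Matrix.one_apply]

theorem IsCoord.frame_apply {R : Fin n → Hol W} (hR : IsCoord R) (w : W) (α i : Fin n) :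
    frame R α i w = (jacobian R w)⁻¹ α i := by
  have h : (frame R).map (Hol.ev w) * jacobian R w = 1 := by
    rw [← map_ev_jac, ← Matrix.map_mul, hR.frame_mul_jac, Matrix.map_one _ (map_zero _) (map_one _)]
  rw [Matrix.inv_eq_left_inv h]
  rfl

/-- The derivation `∂/∂R_i` of `Hol W`. -/
def dRh (R : Fin n → Hol W) (i : Fin n) : Derivation ℂ (Hol W) (Hol W) :=
  ∑ α, frame R α i • Hol.pdD α

theorem dRh_apply (R : Fin n → Hol W) (i : Fin n) (f : Hol W) :
    dRh R i f = ∑ α, frame R α i * Hol.pd α f := by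
  unfold dRh
  rw [derivation_sum_apply]
  rfl

theorem IsCoord.dR_eq {R : Fin n → Hol W} (hR : IsCoord R) (i : Fin n) (f : Hol W) (w : W) :
    dR R i f w = dRh R i f w := by
  rw [dRh_apply, Hol.sum_apply]
  refine Finset.sum_congr rfl fun α _ => ?_
  rw [Hol.mul_apply, hR.frame_apply]
  rfl

theorem IsCoord.dRh_self {R : Fin n → Hol W} (hR : IsCoord R) (i j : Fin n) :
    dRh R i (R j) = if j = i then 1 else 0 := by
  rw [dRh_apply, ← hR.sum_jac_frame]
  exact Finset.sum_congr rfl fun α _ => mul_comm _ _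

theorem IsCoord.pd_eq {R : Fin n → Hol W} (hR : IsCoord R) (α : Fin n) (f : Hol W) :
    Hol.pd α f = ∑ i, jac R i α * dRh R i f := by
  simp only [dRh_apply, Finset.mul_sum]
  rw [Finset.sum_comm]
  have : ∀ β, ∑ i, jac R i α * (frame R β i * Hol.pd β f)
      = (if β = α then 1 else 0) * Hol.pd β f := fun β => by
    rw [← hR.sum_frame_jac, Finset.sum_mul]
    exact Finset.sum_congr rfl fun i _ => by ring
  simp [this]

/-- A bilinear form vanishes if its components in the coordinates `v` do. -/
theorem IsCoord.eq_zero_of_contract {R : Fin n → Hol W} (hR : IsCoord R)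
    {T : Fin n → Fin n → Hol W}
    (h : ∀ α β, ∑ i, ∑ j, jac R i α * jac R j β * T i j = 0) (i j : Fin n) : T i j = 0 := by
  have h1 : (jac R).transpose * Matrix.of T * jac R = 0 := by
    ext1 α β
    rw [Matrix.mul_apply, Matrix.zero_apply, ← h α β, Finset.sum_comm]
    refine Finset.sum_congr rfl fun j _ => ?_
    rw [Matrix.mul_apply, Finset.sum_mul]
    refine Finset.sum_congr rfl fun i _ => ?_
    rw [Matrix.transpose_apply, Matrix.of_apply]
    ring
  have h2 : (frame R).transpose * ((jac R).transpose * Matrix.of T * jac R) * frame R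
      = Matrix.of T := by
    have h3 : (frame R).transpose * (jac R).transpose = 1 := by
      rw [← Matrix.transpose_mul, hR.jac_mul_frame, Matrix.transpose_one]
    calc _ = ((frame R).transpose * (jac R).transpose) * Matrix.of T * (jac R * frame R) := by
          simp only [Matrix.mul_assoc]
      _ = _ := by rw [h3, hR.jac_mul_frame, Matrix.one_mul, Matrix.mul_one]
  have h4 := congrFun (congrFun h2 i) j
  rw [h1, Matrix.mul_zero, Matrix.zero_mul] at h4
  exact h4.symm

/-- The derivations `∂/∂R_i` commute: the second derivatives in the coordinates `R` and `v` differ by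
terms that are symmetric. -/
theorem IsCoord.dRh_comm {R : Fin n → Hol W} (hR : IsCoord R) (i j : Fin n) (f : Hol W) :
    dRh R i (dRh R j f) = dRh R j (dRh R i f) := by
  rw [← sub_eq_zero]
  refine hR.eq_zero_of_contract (T := fun i j => dRh R i (dRh R j f) - dRh R j (dRh R i f))
    (fun α β => ?_) i j
  have key : ∀ α β, Hol.pd α (Hol.pd β f) = (∑ i, Hol.pd α (Hol.pd β (R i)) * dRh R i f)
      + ∑ i, ∑ j, jac R i α * jac R j β * dRh R i (dRh R j f) := by
    intro α β
    rw [hR.pd_eq β f, ← Hol.pdD_apply, map_sum]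
    simp only [Derivation.leibniz, smul_eq_mul, Hol.pdD_apply]
    rw [Finset.sum_add_distrib, add_comm]
    congr 1
    · exact Finset.sum_congr rfl fun i _ => mul_comm _ _
    · rw [Finset.sum_comm]
      refine Finset.sum_congr rfl fun j _ => ?_
      rw [hR.pd_eq α (dRh R j f), Finset.mul_sum]
      exact Finset.sum_congr rfl fun i _ => by ring
  have h1 := key α β
  rw [Hol.pd_comm α β, key β α] at h1
  simp only [Hol.pd_comm β α, add_right_inj] at h1
  simp only [mul_sub, Finset.sum_sub_distrib]
  rw [← h1, sub_eq_zero, Finset.sum_comm]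
  exact Finset.sum_congr rfl fun i _ => Finset.sum_congr rfl fun j _ => by ring

/-- The coordinate function `v^α`. -/
def Hol.coord (W : TopologicalSpace.Opens (Fin n → ℂ)) (α : Fin n) : Hol W :=
  Hol.mk' (fun v => v α) fun _ _ =>
    (ContinuousLinearMap.proj (R := ℂ) (φ := fun _ : Fin n => ℂ) α).analyticAt _

theorem Hol.pd_coord (α β : Fin n) :
    Hol.pd β (Hol.coord W α) = if β = α then 1 else 0 := by
  refine Hol.ext_iff'.2 fun w => ?_
  have h : Hol.ext0 (Hol.coord W α) =ᶠ[𝓝 (w : Fin n → ℂ)]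
      (ContinuousLinearMap.proj (R := ℂ) (φ := fun _ : Fin n => ℂ) α) :=
    Hol.ext0_eventuallyEq _ w.2 (Filter.Eventually.of_forall fun u hu => rfl)
  rw [Hol.pd_apply, h.fderiv_eq, ContinuousLinearMap.fderiv]
  by_cases hβ : β = α
  · subst hβ; simp
  · rw [if_neg hβ]; simp [Ne.symm hβ]

theorem dRh_coord (R : Fin n → Hol W) (i α : Fin n) :
    dRh R i (Hol.coord W α) = frame R α i := by
  simp [dRh_apply, Hol.pd_coord]

/-- The coordinate vector fields `∂/∂R_i` commute. -/
theorem IsCoord.frame_comm {R : Fin n → Hol W} (hR : IsCoord R) (i j α : Fin n) :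
    dRh R i (frame R α j) = dRh R j (frame R α i) := by
  rw [← dRh_coord, ← dRh_coord, hR.dRh_comm]

theorem jacobian_res (h : W ≤ U) (R : Fin n → Hol U) (w : W) :
    jacobian (fun j => Hol.res h (R j)) w = jacobian R ⟨w, h w.2⟩ := by
  ext i α
  change Hol.pd α (Hol.res h (R i)) w = Hol.pd α (R i) ⟨w, h w.2⟩
  rw [Hol.pd_res]
  rfl

theorem IsCoord.res (h : W ≤ U) {R : Fin n → Hol U} (hR : IsCoord R) :
    IsCoord (fun j => Hol.res h (R j)) := fun w => by
  rw [jacobian_res]; exact hR _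

theorem IsCoord.dRh_res (h : W ≤ U) {R : Fin n → Hol U} (hR : IsCoord R) (i : Fin n)
    (f : Hol U) : dRh (fun j => Hol.res h (R j)) i (Hol.res h f) = Hol.res h (dRh R i f) := by
  refine Hol.ext_iff'.2 fun w => ?_
  rw [dRh_apply, dRh_apply, map_sum, Hol.sum_apply, Hol.sum_apply]
  refine Finset.sum_congr rfl fun α _ => ?_
  rw [map_mul, Hol.mul_apply, Hol.mul_apply, (hR.res h).frame_apply, jacobian_res, Hol.res_apply,
    hR.frame_apply, Hol.pd_res]

/-! ### The jets of the Riemann invariants -/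

theorem Rx_eq (R : Fin n → Hol W) (i : Fin n) : Rx R i = totalD (C (R i)) :=
  (totalD_apply _).symm

theorem Rx_eq_sum (R : Fin n → Hol W) (i : Fin n) : Rx R i = ∑ α, C (jac R i α) * X (α, 0) := by
  rw [Rx_eq, totalD_C]
  exact Finset.sum_congr rfl fun α _ => mul_comm _ _

theorem IsCoord.totalD_C {R : Fin n → Hol W} (hR : IsCoord R) (f : Hol W) :
    totalD (C f : DiffPoly W) = ∑ i, C (dRh R i f) * Rx R i := by
  rw [DiffPoly.totalD_C]
  simp only [Rx_eq_sum, Finset.mul_sum]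
  rw [Finset.sum_comm]
  refine Finset.sum_congr rfl fun α _ => ?_
  rw [hR.pd_eq, map_sum, Finset.mul_sum]
  refine Finset.sum_congr rfl fun i _ => ?_
  rw [map_mul]; ring

theorem IsCoord.X_zero_eq {R : Fin n → Hol W} (hR : IsCoord R) (α : Fin n) :
    (X (α, 0) : DiffPoly W) = ∑ i, C (frame R α i) * Rx R i := by
  have h := hR.totalD_C (Hol.coord W α)
  simp only [dRh_coord] at h
  rw [← h, DiffPoly.totalD_C]
  simp [Hol.pd_coord]

theorem IsCoord.totalD_C_mul_Rx {R : Fin n → Hol W} (hR : IsCoord R) (g : Hol W) (i : Fin n) :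
    totalD (C g * Rx R i) = C g * totalD (Rx R i) + ∑ k, C (dRh R k g) * (Rx R i * Rx R k) := by
  rw [Derivation.leibniz, smul_eq_mul, smul_eq_mul, hR.totalD_C, Finset.mul_sum]
  refine congrArg₂ _ rfl (Finset.sum_congr rfl fun j _ => ?_)
  rw [mul_left_comm]

theorem IsCoord.X_one_eq {R : Fin n → Hol W} (hR : IsCoord R) (α : Fin n) :
    (X (α, 1) : DiffPoly W) = (∑ i, C (frame R α i) * totalD (Rx R i))
      + ∑ i, ∑ j, C (dRh R j (frame R α i)) * (Rx R i * Rx R j) := by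
  have h : totalD (X (α, 0) : DiffPoly W) = X (α, 1) := totalD_X _
  rw [← h, hR.X_zero_eq, map_sum, ← Finset.sum_add_distrib]
  exact Finset.sum_congr rfl fun i _ => hR.totalD_C_mul_Rx _ i

theorem C_mul_mem (S : Submodule (Hol W) (DiffPoly W)) (f : Hol W) {P : DiffPoly W} (h : P ∈ S) :
    C f * P ∈ S := by
  rw [← smul_eq_C_mul]; exact S.smul_mem f h

theorem IsCoord.exists_degree_one {R : Fin n → Hol W} (hR : IsCoord R) {P : DiffPoly W}
    (hP : P.IsHomogeneousOfDegree 1) : ∃ q : Fin n → Hol W, P = ∑ i, C (q i) * Rx R i := by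
  have h : P ∈ Submodule.span (Hol W) (Set.range (Rx R)) := by
    refine Submodule.span_le.2 ?_ (mem_span_of_degree_one hP)
    rintro _ ⟨α, rfl⟩
    change (X (α, 0) : DiffPoly W) ∈ _
    rw [hR.X_zero_eq]
    exact Submodule.sum_mem _ fun i _ => C_mul_mem _ _ (Submodule.subset_span ⟨i, rfl⟩)
  obtain ⟨q, hq⟩ := (Submodule.mem_span_range_iff_exists_fun _).1 h
  exact ⟨q, by simp only [← hq, smul_eq_C_mul]⟩

theorem IsCoord.exists_degree_two {R : Fin n → Hol W} (hR : IsCoord R) {P : DiffPoly W}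
    (hP : P.IsHomogeneousOfDegree 2) : ∃ (ρ : Fin n → Hol W) (σ : Fin n → Fin n → Hol W),
      P = ∑ i, C (ρ i) * totalD (Rx R i) + ∑ i, ∑ j, C (σ i j) * (Rx R i * Rx R j) := by
  set S := Submodule.span (Hol W) (Set.range fun i => totalD (Rx R i)) ⊔
      Submodule.span (Hol W) (Set.range fun i : Fin n × Fin n => Rx R i.1 * Rx R i.2) with hS
  have h1 : ∀ i, totalD (Rx R i) ∈ S := fun i =>
    Submodule.mem_sup_left (Submodule.subset_span ⟨i, rfl⟩)
  have h2 : ∀ i j, Rx R i * Rx R j ∈ S := fun i j =>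
    Submodule.mem_sup_right (Submodule.subset_span ⟨(i, j), rfl⟩)
  have h : P ∈ S := by
    have hle₁ : Submodule.span (Hol W) (Set.range fun α : Fin n => (X (α, 1) : DiffPoly W)) ≤ S := by
      refine Submodule.span_le.2 ?_
      rintro _ ⟨α, rfl⟩
      change (X (α, 1) : DiffPoly W) ∈ S
      rw [hR.X_one_eq]
      exact S.add_mem (S.sum_mem fun i _ => C_mul_mem _ _ (h1 i))
        (S.sum_mem fun i _ => S.sum_mem fun j _ => C_mul_mem _ _ (h2 i j))
    have hle₂ : Submodule.span (Hol W) (Set.range fun α : Fin n × Fin n =>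
        (X (α.1, 0) * X (α.2, 0) : DiffPoly W)) ≤ S := by
      refine Submodule.span_le.2 ?_
      rintro _ ⟨⟨α, β⟩, rfl⟩
      change (X (α, 0) * X (β, 0) : DiffPoly W) ∈ S
      rw [hR.X_zero_eq α, hR.X_zero_eq β, Finset.sum_mul_sum]
      refine S.sum_mem fun i _ => S.sum_mem fun j _ => ?_
      rw [mul_mul_mul_comm, ← map_mul]
      exact C_mul_mem _ _ (h2 i j)
    exact sup_le hle₁ hle₂ (mem_span_of_degree_two hP)
  obtain ⟨P₁, hP₁, P₂, hP₂, rfl⟩ := Submodule.mem_sup.1 h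
  obtain ⟨ρ, hρ⟩ := (Submodule.mem_span_range_iff_exists_fun _).1 hP₁
  obtain ⟨σ, hσ⟩ := (Submodule.mem_span_range_iff_exists_fun _).1 hP₂
  refine ⟨ρ, fun i j => σ (i, j), ?_⟩
  rw [← hρ, ← hσ, Fintype.sum_prod_type]
  simp only [smul_eq_C_mul]

/-- The derivation `∂/∂R_{i,ℓ}` with respect to the jet of order `ℓ` of `R_i`; it is the partial
derivative in the coordinates `R` on polynomials of order at most `ℓ`. -/
def jetR (R : Fin n → Hol W) (ℓ : ℕ) (i : Fin n) : Derivation ℂ (DiffPoly W) (DiffPoly W) :=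
  ∑ α, (C (frame R α i) : DiffPoly W) • jetD α ℓ

theorem jetR_apply (R : Fin n → Hol W) (ℓ : ℕ) (i : Fin n) (P : DiffPoly W) :
    jetR R ℓ i P = ∑ α, C (frame R α i) * jetD α ℓ P := by
  unfold jetR
  rw [derivation_sum_apply]
  rfl

theorem jetR_mul (R : Fin n → Hol W) (ℓ : ℕ) (i : Fin n) (P Q : DiffPoly W) :
    jetR R ℓ i (P * Q) = P * jetR R ℓ i Q + Q * jetR R ℓ i P := Derivation.leibniz _ _ _

theorem jetR_C_mul (R : Fin n → Hol W) (ℓ : ℕ) (i : Fin n) (f : Hol W) (P : DiffPoly W) :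
    jetR R (ℓ + 1) i (C f * P) = C f * jetR R (ℓ + 1) i P := by
  have h : jetR R (ℓ + 1) i (C f) = 0 := by simp [jetR_apply, jetD_succ_C]
  rw [jetR_mul, h, mul_zero, add_zero]

/-- On the jets of highest order, `∂ₓ` acts as the shift. -/
theorem jetR_succ_totalD (R : Fin n → Hol W) (ℓ : ℕ) (i : Fin n) {P : DiffPoly W}
    (hP : ∀ α, jetD α (ℓ + 1) P = 0) : jetR R (ℓ + 1) i (totalD P) = jetR R ℓ i P := by
  simp [jetR_apply, DiffPoly.jetD_succ_totalD, hP]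

theorem jetD_Rx (R : Fin n → Hol W) (i α : Fin n) (ℓ : ℕ) : jetD α (ℓ + 2) (Rx R i) = 0 := by
  rw [Rx_eq, DiffPoly.jetD_succ_totalD, jetD_succ_C, jetD_succ_C, map_zero, add_zero]

theorem jetD_one_Rx (R : Fin n → Hol W) (i α : Fin n) : jetD α 1 (Rx R i) = C (jac R i α) := by
  rw [Rx_eq, DiffPoly.jetD_succ_totalD, jetD_succ_C, jetD_zero_C, map_zero, zero_add, jac_apply]

theorem jetD_totalD_Rx (R : Fin n → Hol W) (i α : Fin n) (ℓ : ℕ) :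
    jetD α (ℓ + 3) (totalD (Rx R i)) = 0 := by
  rw [DiffPoly.jetD_succ_totalD, jetD_Rx, jetD_Rx, map_zero, add_zero]

theorem jetR_Rx (R : Fin n → Hol W) (ℓ : ℕ) (i j : Fin n) : jetR R (ℓ + 2) i (Rx R j) = 0 := by
  simp [jetR_apply, jetD_Rx]

theorem jetR_totalD_Rx (R : Fin n → Hol W) (ℓ : ℕ) (i j : Fin n) :
    jetR R (ℓ + 3) i (totalD (Rx R j)) = 0 := by
  simp [jetR_apply, jetD_totalD_Rx]

theorem IsCoord.jetR_one_Rx {R : Fin n → Hol W} (hR : IsCoord R) (i j : Fin n) :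
    jetR R 1 i (Rx R j) = if j = i then 1 else 0 := by
  rw [jetR_apply]
  simp only [jetD_one_Rx, ← map_mul]
  rw [← map_sum]
  have := hR.sum_jac_frame j i
  simp only [mul_comm (frame R _ _)]
  rw [this]
  split_ifs <;> simp

theorem IsCoord.jetR_two_totalD_Rx {R : Fin n → Hol W} (hR : IsCoord R) (i j : Fin n) :
    jetR R 2 i (totalD (Rx R j)) = if j = i then 1 else 0 := by
  rw [jetR_succ_totalD R 1 i fun α => jetD_Rx R j α 0, hR.jetR_one_Rx]

theorem IsCoord.jetR_three_totalD_Rx {R : Fin n → Hol W} (hR : IsCoord R) (i j : Fin n) :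
    jetR R 3 i (totalD (totalD (Rx R j))) = if j = i then 1 else 0 := by
  rw [jetR_succ_totalD R 2 i fun α => jetD_totalD_Rx R j α 0, hR.jetR_two_totalD_Rx]

theorem Rx_homogeneous (R : Fin n → Hol W) (i : Fin n) : (Rx R i).IsHomogeneousOfDegree 1 := by
  rw [Rx_eq]; exact isHomogeneous_totalD (isWeightedHomogeneous_C _ _)

end RiemannCoordinates

section TotalDerivatives

open MvPolynomial DiffPoly

variable {U W : TopologicalSpace.Opens (Fin n → ℂ)}

/-! ### Total derivatives in terms of the jets of the Riemann invariants -/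

theorem jetR_C (R : Fin n → Hol W) (ℓ : ℕ) (i : Fin n) (f : Hol W) :
    jetR R (ℓ + 1) i (C f) = 0 := by
  simp [jetR_apply, jetD_succ_C]

theorem IsCoord.linear_eq_zero {R : Fin n → Hol W} (hR : IsCoord R) {q : Fin n → Hol W}
    (h : ∑ i, C (q i) * Rx R i = 0) (l : Fin n) : q l = 0 := by
  have h1 := congrArg (jetR R 1 l) h
  rw [map_sum, map_zero] at h1
  simp only [jetR_C_mul, hR.jetR_one_Rx] at h1
  simp only [mul_ite, mul_one, mul_zero, Finset.sum_ite_eq', Finset.mem_univ, if_true] at h1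
  exact C_eq_zero.1 h1

theorem IsCoord.jetR_one_quadratic {R : Fin n → Hol W} (hR : IsCoord R)
    (S : Fin n → Fin n → Hol W) (l : Fin n) :
    jetR R 1 l (∑ i, ∑ j, C (S i j) * (Rx R i * Rx R j))
      = ∑ i, C (S i l + S l i) * Rx R i := by
  simp only [map_sum, jetR_C, jetR_mul, hR.jetR_one_Rx]
  simp only [mul_ite, mul_one, mul_zero, add_zero, mul_add, Finset.sum_add_distrib, Finset.sum_ite_eq',
    Finset.mem_univ, if_true, map_add, add_mul]
  rw [Finset.sum_comm (s := Finset.univ) (t := Finset.univ)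
    (f := fun i j => if i = l then C (S i j) * Rx R j else 0)]
  simp only [Finset.sum_ite_eq', Finset.mem_univ, if_true]

theorem IsCoord.quadratic_eq_zero {R : Fin n → Hol W} (hR : IsCoord R)
    {S : Fin n → Fin n → Hol W} (h : ∑ i, ∑ j, C (S i j) * (Rx R i * Rx R j) = 0)
    (i j : Fin n) : S i j + S j i = 0 := by
  have h1 := congrArg (jetR R 1 j) h
  rw [hR.jetR_one_quadratic, map_zero] at h1
  exact hR.linear_eq_zero h1 i

theorem IsCoord.jetR_one_cubic {R : Fin n → Hol W} (hR : IsCoord R)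
    (T : Fin n → Fin n → Fin n → Hol W) (l : Fin n) :
    jetR R 1 l (∑ i, ∑ j, ∑ k, C (T i j k) * (Rx R i * Rx R j * Rx R k))
      = ∑ i, ∑ j, C (T i j l + T i l j + T l i j) * (Rx R i * Rx R j) := by
  simp only [map_sum, jetR_C, jetR_mul, hR.jetR_one_Rx]
  simp only [mul_ite, mul_one, mul_zero, add_zero, mul_add, Finset.sum_add_distrib, Finset.sum_ite_eq',
    Finset.mem_univ, if_true, map_add, add_mul]
  have h1 : ∀ i, ∑ j, ∑ k, (if j = l then C (T i j k) * (Rx R k * Rx R i) else 0)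
      = ∑ j, C (T i l j) * (Rx R i * Rx R j) := fun i => by
    rw [Finset.sum_comm]
    simp only [Finset.sum_ite_eq', Finset.mem_univ, if_true, mul_comm (Rx R i)]
  have h2 : ∑ i, ∑ j, ∑ k, (if i = l then C (T i j k) * (Rx R k * Rx R j) else 0)
      = ∑ i, ∑ j, C (T l i j) * (Rx R i * Rx R j) := by
    rw [Finset.sum_comm]
    refine Finset.sum_congr rfl fun j _ => ?_
    rw [Finset.sum_comm]
    simp only [Finset.sum_ite_eq', Finset.mem_univ, if_true, mul_comm (Rx R j)]
  simp only [h1, h2]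
  ring

theorem IsCoord.cubic_eq_zero {R : Fin n → Hol W} (hR : IsCoord R)
    {T : Fin n → Fin n → Fin n → Hol W}
    (h : ∑ i, ∑ j, ∑ k, C (T i j k) * (Rx R i * Rx R j * Rx R k) = 0) (i j k : Fin n) :
    T i j k + T i k j + T k i j + (T j i k + T j k i + T k j i) = 0 := by
  have h1 := congrArg (jetR R 1 k) h
  rw [hR.jetR_one_cubic, map_zero] at h1
  exact hR.quadratic_eq_zero h1 i j

theorem Rx_mul_homogeneous (R : Fin n → Hol W) (i j : Fin n) (f : Hol W) :
    IsHomogeneousOfDegree (W := W) (C f * (Rx R i * Rx R j)) 2 :=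
  IsWeightedHomogeneous.C_mul ((Rx_homogeneous R i).mul (Rx_homogeneous R j)) f

theorem IsCoord.totalD_linear {R : Fin n → Hol W} (hR : IsCoord R) (q : Fin n → Hol W) :
    totalD (∑ i, C (q i) * Rx R i) = ∑ i, C (q i) * totalD (Rx R i)
      + ∑ i, ∑ k, C (dRh R k (q i)) * (Rx R i * Rx R k) := by
  rw [map_sum, ← Finset.sum_add_distrib]
  exact Finset.sum_congr rfl fun i _ => hR.totalD_C_mul_Rx _ i

/-- A quadratic form in the `R_{i,x}` is a total derivative only if it vanishes. -/
theorem IsCoord.symm_eq_zero_of_sameFunctional {R : Fin n → Hol W} (hR : IsCoord R)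
    {S : Fin n → Fin n → Hol W}
    (h : SameFunctional (∑ i, ∑ j, C (S i j) * (Rx R i * Rx R j)) 0) (i j : Fin n) :
    S i j + S j i = 0 := by
  obtain ⟨G, hG⟩ := sameFunctional_iff.1 h
  rw [sub_zero] at hG
  obtain ⟨G', hG', hSG⟩ := exists_homogeneous_primitive (d := 1)
    (IsWeightedHomogeneous.sum _ _ _ fun i _ => IsWeightedHomogeneous.sum _ _ _ fun j _ =>
      Rx_mul_homogeneous R i j (S i j)) hG
  obtain ⟨g, rfl⟩ := hR.exists_degree_one hG'
  refine hR.quadratic_eq_zero ?_ i j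
  -- `g l` is the coefficient of the second derivative of `R_l` in the total derivative.
  have hg : ∀ l, g l = 0 := fun l => by
    have h1 := congrArg (jetR R 2 l) hSG
    rw [hR.totalD_linear, map_add] at h1
    simp only [map_sum, jetR_C, jetR_mul, jetR_Rx, hR.jetR_two_totalD_Rx] at h1
    simp only [mul_ite, mul_one, mul_zero, add_zero, Finset.sum_const_zero, Finset.sum_ite_eq',
      Finset.mem_univ, if_true] at h1
    exact C_eq_zero.1 h1.symm
  rw [hSG]
  simp [hg]

theorem IsCoord.totalD_quadratic {R : Fin n → Hol W} (hR : IsCoord R)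
    (σ : Fin n → Fin n → Hol W) :
    totalD (∑ i, ∑ j, C (σ i j) * (Rx R i * Rx R j))
      = ∑ i, ∑ j, C (σ i j + σ j i) * (Rx R i * totalD (Rx R j))
        + ∑ i, ∑ j, ∑ k, C (dRh R k (σ i j)) * (Rx R i * Rx R j * Rx R k) := by
  have h1 : ∀ i j, totalD (C (σ i j) * (Rx R i * Rx R j))
      = C (σ i j) * (Rx R i * totalD (Rx R j)) + C (σ i j) * (Rx R j * totalD (Rx R i))
        + ∑ k, C (dRh R k (σ i j)) * (Rx R i * Rx R j * Rx R k) := fun i j => by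
    rw [Derivation.leibniz, Derivation.leibniz, smul_eq_mul, smul_eq_mul, smul_eq_mul, smul_eq_mul,
      hR.totalD_C, Finset.mul_sum, mul_add]
    refine congrArg₂ _ rfl (Finset.sum_congr rfl fun k _ => ?_)
    rw [mul_left_comm]
  simp only [map_sum, h1, Finset.sum_add_distrib, map_add, add_mul]
  rw [Finset.sum_comm (f := fun i j => C (σ i j) * (Rx R j * totalD (Rx R i)))]

/-- The condition for a density of degree `3` without third derivatives to be a total derivative:
the part linear in the second derivatives determines the primitive, and then the cubic parts have
to agree. -/
theorem IsCoord.cubic_of_sameFunctional {R : Fin n → Hol W} (hR : IsCoord R)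
    {B : Fin n → Fin n → Hol W} {T : Fin n → Fin n → Fin n → Hol W}
    (h : SameFunctional (∑ i, ∑ j, C (B i j) * (Rx R i * totalD (Rx R j))
      + ∑ i, ∑ j, ∑ k, C (T i j k) * (Rx R i * Rx R j * Rx R k)) 0) :
    (∀ i j, B i j = B j i) ∧ ∀ i j k,
      2 * (T i j k + T i k j + T k i j + (T j i k + T j k i + T k j i))
        = 2 * (dRh R k (B i j) + dRh R j (B i k) + dRh R i (B j k)) := by
  obtain ⟨G, hG⟩ := sameFunctional_iff.1 h
  rw [sub_zero] at hG
  have hhom : IsHomogeneousOfDegree (W := W) (∑ i, ∑ j, C (B i j) * (Rx R i * totalD (Rx R j))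
      + ∑ i, ∑ j, ∑ k, C (T i j k) * (Rx R i * Rx R j * Rx R k)) (2 + 1) := by
    refine IsWeightedHomogeneous.add ?_ ?_
    · refine IsWeightedHomogeneous.sum _ _ _ fun i _ => IsWeightedHomogeneous.sum _ _ _ fun j _ => ?_
      exact IsWeightedHomogeneous.C_mul
        ((Rx_homogeneous R i).mul (isHomogeneous_totalD (Rx_homogeneous R j))) _
    · refine IsWeightedHomogeneous.sum _ _ _ fun i _ => IsWeightedHomogeneous.sum _ _ _ fun j _ =>
        IsWeightedHomogeneous.sum _ _ _ fun k _ => ?_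
      exact IsWeightedHomogeneous.C_mul
        (((Rx_homogeneous R i).mul (Rx_homogeneous R j)).mul (Rx_homogeneous R k)) _
  obtain ⟨G', hG', hPG⟩ := exists_homogeneous_primitive hhom hG
  obtain ⟨ρ, σ, rfl⟩ := hR.exists_degree_two hG'
  -- `ρ l` is the coefficient of the third derivative of `R_l` in the total derivative.
  have hρ : ∀ l, ρ l = 0 := fun l => by
    have h1 := congrArg (jetR R 3 l) hPG
    rw [map_add (totalD (W := W)), hR.totalD_quadratic, map_sum (totalD (W := W))] at h1
    simp only [Derivation.leibniz (totalD (W := W)), smul_eq_mul, hR.totalD_C] at h1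
    simp only [map_add, map_sum, jetR_C, jetR_mul, jetR_Rx, jetR_totalD_Rx,
      hR.jetR_three_totalD_Rx, Finset.mul_sum] at h1
    simp only [mul_ite, mul_one, mul_zero, add_zero, Finset.sum_const_zero, Finset.sum_ite_eq',
      Finset.mem_univ, if_true] at h1
    exact C_eq_zero.1 h1.symm
  simp only [hρ, map_zero, zero_mul, Finset.sum_const_zero, zero_add] at hPG
  rw [hR.totalD_quadratic] at hPG
  -- Comparison of the terms with a second derivative of `R_l`.
  have hB : ∀ m l, B m l = σ m l + σ l m := fun m l => by
    have h1 := congrArg (jetR R 2 l) hPG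
    simp only [map_add (jetR R 2 l), map_sum (jetR R 2 l), jetR_C, jetR_mul, jetR_Rx,
      hR.jetR_two_totalD_Rx] at h1
    simp only [mul_ite, mul_one, mul_zero, add_zero, Finset.sum_const_zero, Finset.sum_ite_eq',
      Finset.mem_univ, if_true] at h1
    rw [← sub_eq_zero, ← Finset.sum_sub_distrib] at h1
    simp only [← sub_mul, ← map_sub] at h1
    exact sub_eq_zero.1 (hR.linear_eq_zero h1 m)
  refine ⟨fun i j => by rw [hB, hB, add_comm], fun i j k => ?_⟩
  simp only [← hB, add_right_inj] at hPG
  rw [← sub_eq_zero] at hPG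
  simp only [← Finset.sum_sub_distrib, ← sub_mul, ← map_sub] at hPG
  have h2 := hR.cubic_eq_zero hPG i j k
  simp only [hB, map_add]
  linear_combination 2 * h2

end TotalDerivatives

section ConservationLaws

open MvPolynomial DiffPoly

variable {U W : TopologicalSpace.Opens (Fin n → ℂ)} {η : Matrix (Fin n) (Fin n) ℂ}

/-! ### Characteristic speeds of conservation laws -/

/-- The components `η^{αβ} ∂_β f` of the gradient of `f`. -/
def grad (η : Matrix (Fin n) (Fin n) ℂ) (f : Hol W) (α : Fin n) : Hol W :=
  ∑ β, η α β • Hol.pd β f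

/-- The matrix `η^{αβ} ∂_β ∂_γ f`, with entries in `Hol W`. -/
def hessH (η : Matrix (Fin n) (Fin n) ℂ) (f : Hol W) : Matrix (Fin n) (Fin n) (Hol W) :=
  Matrix.of fun α γ => Hol.pd γ (grad η f α)

/-- The functions `μ_i` are the characteristic speeds of the flow generated by `f`, and the `R_i`
are its Riemann invariants: `dR_i M = μ_i dR_i` for the matrix `M` of second derivatives of `f`. -/
def HasSpeeds (η : Matrix (Fin n) (Fin n) ℂ) (R : Fin n → Hol W) (f : Hol W)
    (μ : Fin n → Hol W) : Prop :=
  jac R * hessH η f = Matrix.diagonal μ * jac R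

theorem hessH_eq (η : Matrix (Fin n) (Fin n) ℂ) (f : Hol W) (α γ : Fin n) :
    hessH η f α γ = ∑ β, η α β • Hol.pd γ (Hol.pd β f) := by
  change Hol.pdD γ (∑ β, η α β • Hol.pd β f) = _
  rw [map_sum]
  exact Finset.sum_congr rfl fun β _ => (Hol.pdD γ).map_smul _ _

theorem hessH_apply (η : Matrix (Fin n) (Fin n) ℂ) (f : Hol W) (w : W) (α γ : Fin n) :
    hessH η f α γ w = hess η f w α γ := by
  rw [hessH_eq, Hol.sum_apply]
  change _ = ∑ β, η α β * Hol.pd β (Hol.pd γ f) w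
  refine Finset.sum_congr rfl fun β _ => ?_
  rw [Hol.pd_comm]
  rfl

theorem hessH_res (h : W ≤ U) (f : Hol U) (α γ : Fin n) :
    hessH η (Hol.res h f) α γ = Hol.res h (hessH η f α γ) := by
  rw [hessH_eq, hessH_eq, map_sum]
  refine Finset.sum_congr rfl fun β _ => ?_
  rw [Hol.pd_res, Hol.pd_res]
  rfl

theorem HasSpeeds.res (h : W ≤ U) {R : Fin n → Hol U} {f : Hol U} {μ : Fin n → Hol U}
    (hf : HasSpeeds η R f μ) :
    HasSpeeds η (fun i => Hol.res h (R i)) (Hol.res h f) (fun i => Hol.res h (μ i)) := by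
  ext1 i γ
  have h1 := congrArg (Hol.res h) (congrFun (congrFun hf i) γ)
  rw [Matrix.mul_apply, Matrix.diagonal_mul] at h1 ⊢
  rw [map_sum, map_mul] at h1
  simp only [jac_apply, Hol.pd_res, hessH_res, ← map_mul] at h1 ⊢
  exact h1

theorem hasSpeeds_of_isCompleteRiemannInvariants {h₀ : Hol U} {lam R : Fin n → Hol U}
    (hR : IsCompleteRiemannInvariants η h₀ lam R) : HasSpeeds η R h₀ lam := by
  ext1 i γ
  refine Hol.ext_iff'.2 fun v => ?_
  rw [Matrix.mul_apply, Matrix.diagonal_mul, Hol.sum_apply]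
  refine Eq.trans (Finset.sum_congr rfl fun α _ => ?_) (hR.2 i γ v)
  rw [Hol.mul_apply, hessH_apply, mul_comm]
  rfl

theorem IsConserved.res {h₀ : Hol U} {hW : W ≤ U} {f : Hol W} (hf : IsConserved η h₀ hW f)
    {W' : TopologicalSpace.Opens (Fin n → ℂ)} (h : W' ≤ W) :
    IsConserved η h₀ (h.trans hW) (Hol.res h f) := by
  have h1 := SameFunctional.res h hf
  rw [res_zero] at h1
  unfold IsConserved
  convert h1 using 1
  unfold bracket
  have hsmul : ∀ (c : ℂ) (P : DiffPoly W), DiffPoly.res h (c • P) = c • DiffPoly.res h P :=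
    fun c P => by
      rw [Algebra.smul_def, Algebra.smul_def, res_mul]
      refine congrArg₂ _ ?_ rfl
      exact res_C _ _
  have hv : ∀ (g : Hol W) (α : Fin n), DiffPoly.res h (varDeriv α (C g)) =
      varDeriv α (C (Hol.res h g)) := fun g α => by
    rw [varDeriv_C, varDeriv_C, res_C, Hol.pd_res]
  simp only [res_sum, hsmul, res_mul, ← totalD_apply, res_totalD, ofHol, hv]
  rfl

theorem bracket_C (η : Matrix (Fin n) (Fin n) ℂ) (P : DiffPoly W) (f : Hol W) :
    bracket η P (C f) = ∑ α, varDeriv α P * totalD (C (grad η f α)) := by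
  unfold bracket
  refine Finset.sum_congr rfl fun α _ => ?_
  have h : (C (grad η f α) : DiffPoly W) = ∑ β, η α β • C (Hol.pd β f) := by
    unfold grad
    rw [map_sum]
    exact Finset.sum_congr rfl fun β _ => by
      rw [Algebra.smul_def, Algebra.smul_def, map_mul]
      rfl
  rw [h, map_sum, Finset.mul_sum]
  refine Finset.sum_congr rfl fun β _ => ?_
  rw [Derivation.map_smul, varDeriv_C, totalD_apply, mul_smul_comm]

/-- The second derivatives of two functions in involution define commuting endomorphisms. -/
theorem hessH_mul_comm (hη : η.IsSymm) {h f : Hol W}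
    (hf : SameFunctional (bracket η (C h) (C f)) 0) :
    hessH η h * hessH η f = hessH η f * hessH η h := by
  obtain ⟨G, hG⟩ := sameFunctional_iff.1 hf
  set u : Fin n → Hol W := fun γ => ∑ α, Hol.pd α h * hessH η f α γ with hu
  have hbr : bracket η (C h) (C f) = ∑ γ, C (u γ) * X (γ, 0) := by
    rw [bracket_C]
    simp only [varDeriv_C, DiffPoly.totalD_C, Finset.mul_sum, hu, map_sum, map_mul, Finset.sum_mul]
    rw [Finset.sum_comm]
    refine Finset.sum_congr rfl fun γ _ => Finset.sum_congr rfl fun α _ => ?_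
    rw [mul_assoc, mul_comm (X _)]
    rfl
  rw [sub_zero, hbr] at hG
  obtain ⟨G', hG', hPG⟩ := exists_homogeneous_primitive (d := 0)
    (IsWeightedHomogeneous.sum _ _ _ fun γ _ =>
      IsWeightedHomogeneous.C_mul (isWeightedHomogeneous_X _ _ (γ, 0)) _) hG
  obtain ⟨g, rfl⟩ := exists_eq_C_of_degree_zero hG'
  have hug : ∀ γ, u γ = Hol.pd γ g := fun γ => by
    have h1 := congrArg (jetD γ 1) hPG
    rw [DiffPoly.totalD_C, map_sum, map_sum] at h1
    simpa [jetD_succ_C, jetD_succ_X, Prod.ext_iff] using h1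
  -- The mixed third derivatives of `f` cancel in `∂_δ u_γ = ∂_γ u_δ`.
  set Hh : Matrix (Fin n) (Fin n) (Hol W) := Matrix.of fun β γ => Hol.pd γ (Hol.pd β h)
  set Hf : Matrix (Fin n) (Fin n) (Hol W) := Matrix.of fun β γ => Hol.pd γ (Hol.pd β f)
  set N : Matrix (Fin n) (Fin n) (Hol W) := η.map (algebraMap ℂ (Hol W))
  have hA : hessH η h = N * Hh := by
    ext1 α γ
    rw [hessH_eq, Matrix.mul_apply]
    exact Finset.sum_congr rfl fun β _ => Algebra.smul_def _ _
  have hM : hessH η f = N * Hf := by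
    ext1 α γ
    rw [hessH_eq, Matrix.mul_apply]
    exact Finset.sum_congr rfl fun β _ => Algebra.smul_def _ _
  have hK : (Hh * (N * Hf)).transpose = Hh * (N * Hf) := by
    have h2 : ∀ γ δ, Hol.pd δ (u γ) = (Hh * (N * Hf)) δ γ
        + ∑ α, Hol.pd α h * Hol.pd δ (Hol.pd γ (grad η f α)) := fun γ δ => by
      rw [← hM, Matrix.mul_apply, ← Finset.sum_add_distrib, ← Hol.pdD_apply, map_sum]
      refine Finset.sum_congr rfl fun α _ => ?_
      rw [Derivation.leibniz, smul_eq_mul, smul_eq_mul, add_comm, mul_comm (hessH η f α γ)]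
      refine congrArg₂ _ ?_ rfl
      change Hol.pd δ (Hol.pd α h) * _ = Hol.pd α (Hol.pd δ h) * _
      rw [Hol.pd_comm]
    ext1 γ δ
    have h3 := h2 γ δ
    have h4 := h2 δ γ
    rw [hug, Hol.pd_comm, ← hug, h4] at h3
    simp only [Hol.pd_comm γ δ, add_left_inj] at h3
    exact h3.symm
  have hsym : ∀ g : Hol W, (Matrix.of fun β γ => Hol.pd γ (Hol.pd β g)).transpose
      = Matrix.of fun β γ => Hol.pd γ (Hol.pd β g) := fun g => by
    ext1 β γ
    exact Hol.pd_comm _ _ _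
  have hN : N.transpose = N := by
    rw [← Matrix.transpose_map, hη]
  rw [hA, hM, Matrix.mul_assoc, ← hK, Matrix.transpose_mul, Matrix.transpose_mul, hN, hsym, hsym]
  simp only [Matrix.mul_assoc]
  rfl

theorem HasSpeeds.hessH_mul_frame {R : Fin n → Hol W} (hR : IsCoord R) {f : Hol W}
    {μ : Fin n → Hol W} (hf : HasSpeeds η R f μ) :
    hessH η f * frame R = frame R * Matrix.diagonal μ := by
  calc hessH η f * frame R = frame R * (jac R * hessH η f) * frame R := by
        rw [← Matrix.mul_assoc, hR.frame_mul_jac, Matrix.one_mul]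
    _ = frame R * Matrix.diagonal μ * (jac R * frame R) := by rw [hf]; simp only [Matrix.mul_assoc]
    _ = _ := by rw [hR.jac_mul_frame, Matrix.mul_one]

/-- A function in involution with `h` has the same Riemann invariants as `h`, if the
characteristic speeds of `h` are distinct. -/
theorem HasSpeeds.exists_of_involution (hη : η.IsSymm) {R : Fin n → Hol W} (hR : IsCoord R)
    {h f : Hol W} {lam : Fin n → Hol W} (hh : HasSpeeds η R h lam)
    (hlam : ∀ i j, i ≠ j → ∀ w, lam i w ≠ lam j w)
    (hf : SameFunctional (bracket η (C h) (C f)) 0) : ∃ μ, HasSpeeds η R f μ := by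
  -- In the frame of the `R_i` the matrix of `h` is diagonal with distinct entries.
  set N := jac R * hessH η f * frame R with hN
  have hcomm : Matrix.diagonal lam * N = N * Matrix.diagonal lam := by
    calc Matrix.diagonal lam * N = Matrix.diagonal lam * jac R * hessH η f * frame R := by
          simp only [hN, Matrix.mul_assoc]
      _ = jac R * (hessH η h * hessH η f) * frame R := by
          rw [← hh]; simp only [Matrix.mul_assoc]
      _ = jac R * hessH η f * (hessH η h * frame R) := by
          rw [hessH_mul_comm hη hf]; simp only [Matrix.mul_assoc]
      _ = N * Matrix.diagonal lam := by
          rw [hh.hessH_mul_frame hR]; simp only [hN, Matrix.mul_assoc]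
  have hdiag : N = Matrix.diagonal fun i => N i i := by
    ext1 i j
    by_cases hij : i = j
    · subst hij; simp
    · rw [Matrix.diagonal_apply_ne _ hij]
      have h1 := congrFun (congrFun hcomm i) j
      rw [Matrix.diagonal_mul, Matrix.mul_diagonal] at h1
      refine Hol.ext_iff'.2 fun w => ?_
      have h2 : lam i w * N i j w = N i j w * lam j w := congrArg (Hol.ev w) h1
      have h3 : (lam i w - lam j w) * N i j w = 0 := by linear_combination h2
      exact (mul_eq_zero.1 h3).resolve_left (sub_ne_zero.2 (hlam i j hij w))
  refine ⟨fun i => N i i, ?_⟩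
  unfold HasSpeeds
  rw [← hdiag, hN, Matrix.mul_assoc, hR.frame_mul_jac, Matrix.mul_one]

/-- The columns of the frame are eigenvectors of the matrix of second derivatives. -/
theorem HasSpeeds.dRh_grad {R : Fin n → Hol W} (hR : IsCoord R) {f : Hol W} {μ : Fin n → Hol W}
    (hf : HasSpeeds η R f μ) (i α : Fin n) : dRh R i (grad η f α) = frame R α i * μ i := by
  have h1 := congrFun (congrFun (hf.hessH_mul_frame hR) α) i
  rw [Matrix.mul_diagonal, Matrix.mul_apply] at h1
  rw [← h1, dRh_apply]
  exact Finset.sum_congr rfl fun γ _ => mul_comm _ _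

/-- The system satisfied by the characteristic speeds of all functions with Riemann invariants
`R`: `μ_{i,j} / (μ_i - μ_j) = λ_{i,j} / (λ_i - λ_j)`. -/
theorem HasSpeeds.dRh_eq {R : Fin n → Hol W} (hR : IsCoord R) {h f : Hol W}
    {lam μ : Fin n → Hol W} (hh : HasSpeeds η R h lam) (hf : HasSpeeds η R f μ) {i j : Fin n}
    (hij : i ≠ j) :
    (lam i - lam j) * dRh R j (μ i) = (μ i - μ j) * dRh R j (lam i) := by
  -- The derivatives `∂/∂R_i` and `∂/∂R_j` of the gradient of `g` commute.
  have key : ∀ {g : Hol W} {ν : Fin n → Hol W}, HasSpeeds η R g ν → ∀ α,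
      frame R α i * dRh R j (ν i) + ν i * dRh R j (frame R α i)
        = frame R α j * dRh R i (ν j) + ν j * dRh R j (frame R α i) := fun {g} {ν} hg α => by
    have h1 := hR.dRh_comm j i (grad η g α)
    rw [hg.dRh_grad hR, hg.dRh_grad hR, Derivation.leibniz, Derivation.leibniz] at h1
    simp only [smul_eq_mul] at h1
    rw [h1, hR.frame_comm i j]
  have h2 : ∀ α, frame R α i * ((lam i - lam j) * dRh R j (μ i) - (μ i - μ j) * dRh R j (lam i))
      = frame R α j * ((lam i - lam j) * dRh R i (μ j) - (μ i - μ j) * dRh R i (lam j)) :=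
    fun α => by linear_combination (lam i - lam j) * key hf α - (μ i - μ j) * key hh α
  have h3 : ∀ (k : Fin n) (Z : Hol W), ∑ α, jac R i α * (frame R α k * Z)
      = if i = k then Z else 0 := fun k Z => by
    have h4 := congrArg (· * Z) (hR.sum_jac_frame i k)
    simp only [Finset.sum_mul, mul_assoc, ite_mul, one_mul, zero_mul] at h4
    exact h4
  have h5 := h3 i ((lam i - lam j) * dRh R j (μ i) - (μ i - μ j) * dRh R j (lam i))
  simp only [h2] at h5
  rw [h3, if_neg hij, if_pos trivial] at h5
  exact sub_eq_zero.1 h5.symm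

end ConservationLaws

section Brackets

open MvPolynomial DiffPoly

variable {U W : TopologicalSpace.Opens (Fin n → ℂ)} {η : Matrix (Fin n) (Fin n) ℂ}

/-! ### Brackets with a function of order zero -/

/-- The derivation of differential polynomials of order at most one along the flow
`v^α_s = η^{αβ} ∂ₓ ∂_β f` generated by `f`. -/
def evolD (η : Matrix (Fin n) (Fin n) ℂ) (f : Hol W) : Derivation ℂ (DiffPoly W) (DiffPoly W) :=
  ∑ α, ((totalD (C (grad η f α)) : DiffPoly W) • jetD α 0
    + (totalD (totalD (C (grad η f α))) : DiffPoly W) • jetD α 1)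

theorem evolD_apply (f : Hol W) (P : DiffPoly W) :
    evolD η f P = ∑ α, (totalD (C (grad η f α)) * jetD α 0 P
      + totalD (totalD (C (grad η f α))) * jetD α 1 P) := by
  unfold evolD
  rw [derivation_sum_apply]
  rfl

/-- Up to a total derivative, the bracket with `f` is the derivative along the flow of `f`. -/
theorem bracket_C_sameFunctional (f : Hol W) {P : DiffPoly W}
    (hP : ∀ α ℓ, jetD α (ℓ + 2) P = 0) :
    SameFunctional (bracket η P (C f)) (evolD η f P) := by
  rw [bracket_C, evolD_apply]
  refine SameFunctional.sum _ fun α _ => sameFunctional_iff.2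
    ⟨-(jetD α 1 P * totalD (C (grad η f α))), ?_⟩
  rw [varDeriv_of_order_le_one α (hP α), map_neg, Derivation.leibniz, smul_eq_mul, smul_eq_mul]
  ring

/-- The flow of `f` in the coordinates `R` is `R_{k,s} = μ_k R_{k,x}`. -/
theorem HasSpeeds.sum_jac_totalD {R : Fin n → Hol W} (hR : IsCoord R) {f : Hol W}
    {μ : Fin n → Hol W} (hf : HasSpeeds η R f μ) (k : Fin n) :
    ∑ α, totalD (C (grad η f α)) * C (jac R k α) = C (μ k) * Rx R k := by
  simp only [hR.totalD_C, hf.dRh_grad hR, Finset.sum_mul]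
  rw [Finset.sum_comm]
  have h1 : ∀ i, ∑ α, C (frame R α i * μ i) * Rx R i * C (jac R k α)
      = (if k = i then C (μ i) * Rx R i else 0 : DiffPoly W) := fun i => by
    have h2 := congrArg (fun g : Hol W => C g * (C (μ i) * Rx R i)) (hR.sum_jac_frame k i)
    simp only [map_sum, Finset.sum_mul] at h2
    refine Eq.trans (Finset.sum_congr rfl fun α _ => ?_) (h2.trans ?_)
    · rw [map_mul, map_mul]; ring
    · split_ifs <;> simp
  simp only [h1, Finset.sum_ite_eq, Finset.mem_univ, if_true]

theorem HasSpeeds.evolD_C {R : Fin n → Hol W} (hR : IsCoord R) {f : Hol W}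
    {μ : Fin n → Hol W} (hf : HasSpeeds η R f μ) (g : Hol W) :
    evolD η f (C g) = ∑ k, C (dRh R k g * μ k) * Rx R k := by
  rw [evolD_apply]
  have h1 : ∀ k, C (dRh R k g * μ k) * Rx R k
      = ∑ α, totalD (C (grad η f α)) * C (jac R k α) * C (dRh R k g) := fun k => by
    rw [← Finset.sum_mul, hf.sum_jac_totalD hR, map_mul]; ring
  simp only [h1, jetD_succ_C, jetD_zero_C, mul_zero, add_zero]
  rw [Finset.sum_comm]
  refine Finset.sum_congr rfl fun α _ => ?_
  rw [hR.pd_eq, map_sum, Finset.mul_sum]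
  refine Finset.sum_congr rfl fun k _ => ?_
  rw [map_mul, mul_assoc]

theorem HasSpeeds.evolD_Rx {R : Fin n → Hol W} (hR : IsCoord R) {f : Hol W}
    {μ : Fin n → Hol W} (hf : HasSpeeds η R f μ) (k : Fin n) :
    evolD η f (Rx R k) = totalD (C (μ k) * Rx R k) := by
  rw [← hf.sum_jac_totalD hR, map_sum, evolD_apply]
  refine Finset.sum_congr rfl fun α _ => ?_
  rw [jetD_one_Rx, Rx_eq, jetD_zero_totalD, jetD_zero_C, Derivation.leibniz, smul_eq_mul,
    smul_eq_mul, jac_apply]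
  ring

theorem jetD_C_mul_Rx (R : Fin n → Hol W) (i α : Fin n) (ℓ : ℕ) (f : Hol W) :
    jetD α (ℓ + 2) (C f * Rx R i) = 0 := by
  rw [Derivation.leibniz, jetD_Rx, jetD_succ_C, smul_zero, smul_zero, add_zero]

theorem jetD_C_mul_Rx_mul_Rx (R : Fin n → Hol W) (i j α : Fin n) (ℓ : ℕ) (f : Hol W) :
    jetD α (ℓ + 2) (C f * (Rx R i * Rx R j)) = 0 := by
  simp only [Derivation.leibniz, jetD_Rx, jetD_succ_C, smul_zero, add_zero]

/-- The derivative of `∑ i, p_i R_{i,x}` along the flow `R_{k,s} = μ_k R_{k,x}`, integrated by parts so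
that no second derivatives occur. -/
theorem HasSpeeds.bracket_linear {R : Fin n → Hol W} (hR : IsCoord R) {f : Hol W}
    {μ : Fin n → Hol W} (hf : HasSpeeds η R f μ) (p : Fin n → Hol W) :
    SameFunctional (bracket η (∑ i, C (p i) * Rx R i) (C f))
      (∑ i, ∑ k, C (dRh R k (p i) * (μ k - μ i)) * (Rx R i * Rx R k)) := by
  refine (bracket_C_sameFunctional f fun α ℓ => by
    rw [map_sum]; simp only [jetD_C_mul_Rx, Finset.sum_const_zero]).trans ?_
  rw [map_sum]
  refine SameFunctional.sum _ fun i _ => sameFunctional_iff.2 ⟨C (p i) * (C (μ i) * Rx R i), ?_⟩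
  rw [Derivation.leibniz, Derivation.leibniz totalD (C (p i)), hf.evolD_C hR, hf.evolD_Rx hR,
    hR.totalD_C (p i)]
  simp only [smul_eq_mul, Finset.mul_sum]
  rw [add_sub_assoc, ← Finset.sum_sub_distrib]
  refine congrArg₂ _ rfl (Finset.sum_congr rfl fun k _ => ?_)
  rw [map_mul, map_mul, map_sub]
  ring

/-- The derivative of `∑ i, ∑ j, d_{ij} R_{i,x} R_{j,x}` along the flow `R_{k,s} = μ_k R_{k,x}`. -/
theorem HasSpeeds.bracket_quadratic {R : Fin n → Hol W} (hR : IsCoord R) {f : Hol W}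
    {μ : Fin n → Hol W} (hf : HasSpeeds η R f μ) (d : Fin n → Fin n → Hol W) :
    SameFunctional (bracket η (∑ i, ∑ j, C (d i j) * (Rx R i * Rx R j)) (C f))
      (∑ i, ∑ j, C ((d i j + d j i) * μ j) * (Rx R i * totalD (Rx R j))
      + ∑ i, ∑ j, ∑ k, C (dRh R k (d i j) * μ k + d i j * dRh R k (μ i) + d i j * dRh R k (μ j))
          * (Rx R i * Rx R j * Rx R k)) := by
  refine (bracket_C_sameFunctional f fun α ℓ => by
    simp only [map_sum, jetD_C_mul_Rx_mul_Rx, Finset.sum_const_zero]).trans ?_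
  refine (?_ : evolD η f _ = _) ▸ SameFunctional.rfl' _
  have h1 : ∀ i j, evolD η f (C (d i j) * (Rx R i * Rx R j))
      = C (d i j * μ j) * (Rx R i * totalD (Rx R j)) + C (d i j * μ i) * (Rx R j * totalD (Rx R i))
        + ∑ k, C (dRh R k (d i j) * μ k + d i j * dRh R k (μ i) + d i j * dRh R k (μ j))
          * (Rx R i * Rx R j * Rx R k) := fun i j => by
    rw [Derivation.leibniz, Derivation.leibniz, hf.evolD_C hR, hf.evolD_Rx hR, hf.evolD_Rx hR,
      hR.totalD_C_mul_Rx, hR.totalD_C_mul_Rx]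
    simp only [smul_eq_mul, map_add, map_mul, add_mul, mul_add, Finset.sum_add_distrib,
      Finset.mul_sum]
    have e1 : ∀ k, C (d i j) * (Rx R i * (C (dRh R k (μ j)) * (Rx R j * Rx R k)))
        = C (d i j) * C (dRh R k (μ j)) * (Rx R i * Rx R j * Rx R k) := fun k => by ring
    have e2 : ∀ k, C (d i j) * (Rx R j * (C (dRh R k (μ i)) * (Rx R i * Rx R k)))
        = C (d i j) * C (dRh R k (μ i)) * (Rx R i * Rx R j * Rx R k) := fun k => by ring
    have e3 : ∀ k, Rx R i * Rx R j * (C (dRh R k (d i j)) * C (μ k) * Rx R k)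
        = C (dRh R k (d i j)) * C (μ k) * (Rx R i * Rx R j * Rx R k) := fun k => by ring
    simp only [e1, e2, e3]
    ring
  simp only [map_sum, h1, Finset.sum_add_distrib, add_mul, map_add]
  rw [Finset.sum_comm (f := fun i j => C (d i j * μ i) * (Rx R j * totalD (Rx R i)))]

/-! ### The conditions for an extension to first and second order -/

/-- The equation for the first order correction `∑ i, q_i R_{i,x}` of a conservation law. -/
theorem HasSpeeds.linear_condition {R : Fin n → Hol W} (hR : IsCoord R) {h f : Hol W}
    {lam μ : Fin n → Hol W} (hh : HasSpeeds η R h lam) (hf : HasSpeeds η R f μ)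
    (p q : Fin n → Hol W) :
    SameFunctional (bracket η (∑ i, C (p i) * Rx R i) (C f)
      - bracket η (∑ i, C (q i) * Rx R i) (C h)) 0 ↔
    ∀ i k, (dRh R k (p i) - dRh R i (p k)) * (μ k - μ i)
      = (dRh R k (q i) - dRh R i (q k)) * (lam k - lam i) := by
  have h1 := (hf.bracket_linear hR p).sub (hh.bracket_linear hR q)
  simp only [← Finset.sum_sub_distrib, ← sub_mul, ← map_sub] at h1
  constructor
  · intro h2 i k
    have h3 := hR.symm_eq_zero_of_sameFunctional (h1.symm.trans h2) i k
    linear_combination h3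
  · intro h2
    refine h1.trans ((?_ : (0 : DiffPoly W) = _) ▸ SameFunctional.rfl' _)
    set S : DiffPoly W := ∑ i, ∑ k, C (dRh R k (p i) * (μ k - μ i) - dRh R k (q i) * (lam k - lam i))
      * (Rx R i * Rx R k) with hS
    -- The symmetric part of the coefficients of `S` vanishes.
    have h3 : S + S = 0 := by
      nth_rewrite 2 [hS]
      rw [Finset.sum_comm, hS, ← Finset.sum_add_distrib]
      refine Finset.sum_eq_zero fun i _ => ?_
      rw [← Finset.sum_add_distrib]
      refine Finset.sum_eq_zero fun k _ => ?_
      rw [mul_comm (Rx R k), ← add_mul, ← map_add]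
      have : dRh R k (p i) * (μ k - μ i) - dRh R k (q i) * (lam k - lam i)
          + (dRh R i (p k) * (μ i - μ k) - dRh R i (q k) * (lam i - lam k)) = 0 := by
        linear_combination h2 i k
      rw [this, map_zero, zero_mul]
    have h4 : (2 : ℂ) • S = 0 := by rw [two_smul, h3]
    exact ((smul_eq_zero.1 h4).resolve_left two_ne_zero).symm

/-- The equations for the second order correction `∑ i, ∑ j, e_{ij} R_{i,x} R_{j,x}` of a conservation
law, from the terms with a second derivative and from the cubic terms. -/
theorem HasSpeeds.quadratic_condition {R : Fin n → Hol W} (hR : IsCoord R) {h f : Hol W}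
    {lam μ : Fin n → Hol W} (hh : HasSpeeds η R h lam) (hf : HasSpeeds η R f μ)
    {d e : Fin n → Fin n → Hol W} (hd : ∀ i j, d i j = d j i) (he : ∀ i j, e i j = e j i)
    (hde : SameFunctional (bracket η (∑ i, ∑ j, C (d i j) * (Rx R i * Rx R j)) (C f)
      - bracket η (∑ i, ∑ j, C (e i j) * (Rx R i * Rx R j)) (C h)) 0) :
    (∀ i j, e i j * (lam i - lam j) = d i j * (μ i - μ j)) ∧
    ∀ i j k, dRh R k (d i j) * (2 * μ k - μ i - μ j) + d i j * dRh R k (μ i + μ j)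
      + (dRh R j (d i k) * (2 * μ j - μ i - μ k) + d i k * dRh R j (μ i + μ k))
      + (dRh R i (d j k) * (2 * μ i - μ j - μ k) + d j k * dRh R i (μ j + μ k))
      = dRh R k (e i j) * (2 * lam k - lam i - lam j) + e i j * dRh R k (lam i + lam j)
      + (dRh R j (e i k) * (2 * lam j - lam i - lam k) + e i k * dRh R j (lam i + lam k))
      + (dRh R i (e j k) * (2 * lam i - lam j - lam k) + e j k * dRh R i (lam j + lam k)) := by
  have h1 := (hf.bracket_quadratic hR d).sub (hh.bracket_quadratic hR e)
  rw [add_sub_add_comm] at h1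
  simp only [← Finset.sum_sub_distrib, ← sub_mul, ← map_sub] at h1
  obtain ⟨hB, hT⟩ := hR.cubic_of_sameFunctional (h1.symm.trans hde)
  have h2 : ∀ {a b : Hol W}, 2 * a = 2 * b → a = b := fun hab =>
    sub_eq_zero.1 (Hol.two_mul_eq_zero (by rw [mul_sub, hab, sub_self]))
  refine ⟨fun i j => h2 ?_, fun i j k => h2 ?_⟩
  · have h3 := hB i j
    rw [hd j i, he j i] at h3
    linear_combination h3
  · have h3 := hT i j k
    rw [hd j i, he j i, hd k i, he k i, hd k j, he k j] at h3
    have h4 := congrArg (dRh R k) (hB i j)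
    have h5 := congrArg (dRh R j) (hB i k)
    have h6 := congrArg (dRh R i) (hB j k)
    rw [hd j i, he j i] at h4
    rw [hd k i, he k i] at h5
    rw [hd k j, he k j] at h6
    simp only [map_add, map_sub, Derivation.leibniz, smul_eq_mul] at h3 h4 h5 h6 ⊢
    linear_combination h3 + h4 + h5 + h6

end Brackets

section Existence

open MvPolynomial DiffPoly

variable {U W : TopologicalSpace.Opens (Fin n → ℂ)} {η : Matrix (Fin n) (Fin n) ℂ}

/-! ### Conservation laws with prescribed characteristic speeds -/

theorem Hol.fderiv_ext0_apply (f : Hol W) (w : W) (u : Fin n → ℂ) :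
    fderiv ℂ (Hol.ext0 f) w u = ∑ α, Hol.pd α f w * u α := by
  conv_lhs => rw [pi_eq_sum_univ' u]
  rw [map_sum]
  refine Finset.sum_congr rfl fun α _ => ?_
  rw [map_smul, smul_eq_mul, mul_comm, Hol.pd_apply]

theorem Hol.fderiv_ext0_res (h : W ≤ U) (f : Hol U) (w : W) (u : Fin n → ℂ) :
    fderiv ℂ (Hol.ext0 (Hol.res h f)) w u = fderiv ℂ (Hol.ext0 f) w u := by
  rw [Hol.fderiv_ext0_apply, Hol.fderiv_ext0_apply f ⟨w, h w.2⟩]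
  simp only [Hol.pd_res, Hol.res_apply]

theorem jacobian_mulVec (R : Fin n → Hol W) (w : W) (u : Fin n → ℂ) (k : Fin n) :
    (jacobian R w).mulVec u k = fderiv ℂ (Hol.ext0 (R k)) w u :=
  (Hol.fderiv_ext0_apply _ _ _).symm

theorem IsCoord.fderiv_ext0_eq {R : Fin n → Hol W} (hR : IsCoord R) (f : Hol W) (w : W)
    (u : Fin n → ℂ) :
    fderiv ℂ (Hol.ext0 f) w u = ∑ k, dRh R k f w * fderiv ℂ (Hol.ext0 (R k)) w u := by
  simp only [Hol.fderiv_ext0_apply, Finset.mul_sum]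
  rw [Finset.sum_comm]
  refine Finset.sum_congr rfl fun α _ => ?_
  rw [hR.pd_eq, Hol.sum_apply, Finset.sum_mul]
  refine Finset.sum_congr rfl fun k _ => ?_
  rw [Hol.mul_apply, jac_apply]
  ring

/-- If `u` is an eigenvector for the eigenvalue `s`, then `s` is the speed `μ_k` for each `k` such that
`u` has a component along `∂/∂R_k`. -/
theorem HasSpeeds.of_hess_mulVec {R : Fin n → Hol W} {f : Hol W}
    {μ : Fin n → Hol W} (hf : HasSpeeds η R f μ) {w : W} {u : Fin n → ℂ} {s : ℂ}
    (hu : (hess η f w).mulVec u = s • u) (k : Fin n) :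
    μ k w * fderiv ℂ (Hol.ext0 (R k)) w u = s * fderiv ℂ (Hol.ext0 (R k)) w u := by
  have h1 : jacobian R w * hess η f w = Matrix.diagonal (fun i => μ i w) * jacobian R w := by
    ext i γ
    have h2 := congrArg (Hol.ev w) (congrFun (congrFun hf i) γ)
    rw [Matrix.mul_apply, Matrix.diagonal_mul, map_sum] at h2
    rw [Matrix.mul_apply, Matrix.diagonal_mul]
    refine Eq.trans (Finset.sum_congr rfl fun α _ => ?_) h2
    rw [map_mul, ← hessH_apply]
    rfl
  have h3 := congrFun (congrArg (fun M : Matrix (Fin n) (Fin n) ℂ => M.mulVec u) h1) k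
  simp only [← Matrix.mulVec_mulVec, hu] at h3
  rw [Matrix.mulVec_smul, Matrix.mulVec_diagonal, Pi.smul_apply, jacobian_mulVec] at h3
  exact h3.symm

/-- Every conservation law, generic or not, has the Riemann invariants of the system. -/
theorem IsConserved.exists_hasSpeeds (hη : η.IsSymm) {h₀ : Hol U} {lam R : Fin n → Hol U}
    (hR : IsCompleteRiemannInvariants η h₀ lam R) (h_dist : ∀ i j, i ≠ j → ∀ v : U, lam i v ≠ lam j v)
    {hW : W ≤ U} {f : Hol W} (hf : IsConserved η h₀ hW f) :
    ∃ μ, HasSpeeds η (fun i => Hol.res hW (R i)) f μ :=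
  HasSpeeds.exists_of_involution hη (IsCoord.res hW hR.1)
    ((hasSpeeds_of_isCompleteRiemannInvariants hR).res hW)
    (fun i j hij w => h_dist i j hij ⟨w, hW w.2⟩) hf

theorem HasSpeeds.isGeneric {R : Fin n → Hol W} (hR : IsCoord R) {f : Hol W}
    {μ : Fin n → Hol W} (hf : HasSpeeds η R f μ)
    (hμ : ∀ i j, i ≠ j → ∀ w, μ i w ≠ μ j w) : IsGeneric η f := by
  intro w
  refine ⟨fun i => μ i w, fun i j hij => ?_, fun i => ?_⟩
  · by_contra h
    exact hμ i j h w hij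
  · refine Module.End.hasEigenvalue_of_hasEigenvector (x := fun α => frame R α i w)
      (Module.End.hasEigenvector_iff.2 ⟨Module.End.mem_eigenspace_iff.2 ?_, fun h0 => ?_⟩)
    · ext α
      have h1 := congrArg (Hol.ev w) (congrFun (congrFun (hf.hessH_mul_frame hR) α) i)
      rw [Matrix.mul_apply, Matrix.mul_diagonal, map_sum, map_mul] at h1
      rw [Matrix.toLin'_apply, Pi.smul_apply, smul_eq_mul, mul_comm]
      change ∑ β, hess η f w α β * frame R β i w = _
      refine Eq.trans (Finset.sum_congr rfl fun β _ => ?_) h1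
      rw [map_mul, ← hessH_apply]
      rfl
    · have h1 := congrArg (Hol.ev w) (hR.sum_jac_frame i i)
      rw [if_pos rfl, map_sum, map_one] at h1
      refine one_ne_zero (h1.symm.trans (Finset.sum_eq_zero fun α _ => ?_))
      rw [map_mul]
      exact mul_eq_zero_of_right _ (congrFun h0 α)

/-- The points of `W` where the functions `μ_i` take distinct values. -/
def distinctSet (μ : Fin n → Hol W) : TopologicalSpace.Opens (Fin n → ℂ) where
  carrier := Subtype.val '' {w : W | ∀ i j, i ≠ j → μ i w ≠ μ j w}
  is_open' := by
    refine W.isOpen.isOpenMap_subtype_val _ ?_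
    simp only [Set.ofPred_forall]
    exact isOpen_iInter_of_finite fun i => isOpen_iInter_of_finite fun j =>
      isOpen_iInter_of_finite fun _ => isOpen_ne_fun (Hol.continuous _) (Hol.continuous _)

/-- Integrability of the dispersionless system provides, near each point `v₀`, conservation laws
for which the characteristic speeds `μ_i` and their derivatives `μ_{i,i}` at `v₀` are arbitrary.
The velocity of the `i`-th curve at `v₀` has to be a multiple of one of the `∂/∂R_k`, as one sees
from a conservation law with distinct speeds; along the curve the value of `μ_k` is prescribed. -/
theorem exists_conserved (hη : η.IsSymm) {h₀ : Hol U} {lam R : Fin n → Hol U}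
    (h_int : IsIntegrable η h₀) (hR : IsCompleteRiemannInvariants η h₀ lam R)
    (h_dist : ∀ i j, i ≠ j → ∀ v : U, lam i v ≠ lam j v) (v₀ : U) (x y : Fin n → ℂ)
    (hx : Function.Injective x) :
    ∃ (W : TopologicalSpace.Opens (Fin n → ℂ)) (hW : W ≤ U) (f : Hol W) (μ : Fin n → Hol W)
      (hv : (v₀ : Fin n → ℂ) ∈ W), IsConserved η h₀ hW f ∧ IsGeneric η f ∧
      HasSpeeds η (fun i => Hol.res hW (R i)) f μ ∧ (∀ i, μ i ⟨v₀, hv⟩ = x i) ∧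
      ∀ i, dRh (fun i => Hol.res hW (R i)) i (μ i) ⟨v₀, hv⟩ = y i := by
  obtain ⟨γ, hγ, hlin, hex⟩ := h_int v₀ v₀.2
  have hγ0 : ∀ i, γ i 0 = v₀ := fun i => (hγ i).2
  -- `c i k` is the component of the velocity of `γ_i` along `∂/∂R_k`.
  set c : Fin n → Fin n → ℂ := fun i k => fderiv ℂ (Hol.ext0 (R k)) v₀ (deriv (γ i) 0) with hc
  obtain ⟨W₁, hW₁, f₁, hv₁, hf₁, hg₁⟩ := hex (fun i _ => ((i : ℕ) : ℂ)) fun i => analyticAt_const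
  obtain ⟨μ₁, hμ₁⟩ := hf₁.exists_hasSpeeds hη hR h_dist
  have hrel : ∀ i k, μ₁ k ⟨v₀, hv₁⟩ * c i k = ((i : ℕ) : ℂ) * c i k := fun i k => by
    obtain ⟨ht, h1⟩ := (hg₁ i).self_of_nhds
    have h2 := hμ₁.of_hess_mulVec h1 k
    have h3 : (⟨γ i 0, ht⟩ : W₁) = ⟨v₀, hv₁⟩ := Subtype.ext (hγ0 i)
    rw [h3, Hol.fderiv_ext0_res] at h2
    exact h2
  have hne : ∀ i, ∃ k, c i k ≠ 0 := fun i => by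
    by_contra! h
    refine hlin.ne_zero i ?_
    have h1 : (jacobian R v₀).mulVec (deriv (γ i) 0) = 0 := funext fun k => by
      rw [jacobian_mulVec]; exact h k
    have h2 := congrArg (jacobian R v₀)⁻¹.mulVec h1
    rwa [Matrix.mulVec_mulVec, Matrix.nonsing_inv_mul _ (hR.1 v₀), Matrix.one_mulVec,
      Matrix.mulVec_zero] at h2
  choose κ hκ using hne
  have hμκ : ∀ i, μ₁ (κ i) ⟨v₀, hv₁⟩ = ((i : ℕ) : ℂ) := fun i =>
    mul_right_cancel₀ (hκ i) (hrel i (κ i))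
  have hinj : Function.Injective κ := fun i j hij => by
    have h1 := hμκ i
    rw [hij, hμκ j] at h1
    exact Fin.ext (Nat.cast_injective h1).symm
  have hsurj : Function.Surjective κ := Finite.injective_iff_surjective.1 hinj
  have hc0 : ∀ i k, k ≠ κ i → c i k = 0 := fun i k hk => by
    obtain ⟨j, rfl⟩ := hsurj k
    have h1 := hrel i (κ j)
    rw [hμκ j] at h1
    have h2 : (((j : ℕ) : ℂ) - ((i : ℕ) : ℂ)) * c i (κ j) = 0 := by linear_combination h1
    refine (mul_eq_zero.1 h2).resolve_left fun h3 => hk ?_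
    rw [sub_eq_zero, Nat.cast_inj] at h3
    rw [Fin.ext h3]
  obtain ⟨W₂, hW₂, f₂, hv₂, hf₂, hg₂⟩ :=
    hex (fun i t => x (κ i) + t * (y (κ i) * c i (κ i))) fun i => by fun_prop
  obtain ⟨μ₂, hμ₂⟩ := hf₂.exists_hasSpeeds hη hR h_dist
  -- Along the curve `γ_i` the component of the velocity along `∂/∂R_{κ i}` does not vanish.
  have hgerm : ∀ i, (fun t => Hol.ext0 (μ₂ (κ i)) (γ i t)) =ᶠ[𝓝 0]
      fun t => x (κ i) + t * (y (κ i) * c i (κ i)) := fun i => by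
    have hcont : ContinuousAt (fun t => fderiv ℂ (Hol.ext0 (R (κ i))) (γ i t) (deriv (γ i) t)) 0 := by
      refine ContinuousAt.clm_apply ?_ (hγ i).1.deriv.continuousAt
      refine ContinuousAt.comp (f := γ i) (g := fderiv ℂ (Hol.ext0 (R (κ i)))) ?_
        (hγ i).1.continuousAt
      rw [hγ0]
      exact (Hol.analyticAt (R (κ i)) v₀.2).fderiv.continuousAt
    have hne0 : ∀ᶠ t in 𝓝 (0 : ℂ), fderiv ℂ (Hol.ext0 (R (κ i))) (γ i t) (deriv (γ i) t) ≠ 0 := by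
      refine hcont.eventually_ne ?_
      rw [hγ0]
      exact hκ i
    filter_upwards [hne0, hg₂ i] with t ht1 ht2
    obtain ⟨ht, h1⟩ := ht2
    have h2 := hμ₂.of_hess_mulVec h1 (κ i)
    rw [Hol.fderiv_ext0_res] at h2
    rw [Hol.ext0_of_mem _ ht]
    exact mul_right_cancel₀ ht1 h2
  have hxval : ∀ k, μ₂ k ⟨v₀, hv₂⟩ = x k := fun k => by
    obtain ⟨i, rfl⟩ := hsurj k
    have h1 := (hgerm i).self_of_nhds
    simp only [hγ0, zero_mul, add_zero] at h1
    rwa [Hol.ext0_of_mem _ hv₂] at h1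
  have hyval : ∀ k, dRh (fun i => Hol.res hW₂ (R i)) k (μ₂ k) ⟨v₀, hv₂⟩ = y k := fun k => by
    obtain ⟨i, rfl⟩ := hsurj k
    have h1 : HasDerivAt (fun t => x (κ i) + t * (y (κ i) * c i (κ i))) (y (κ i) * c i (κ i)) 0 := by
      simpa using ((hasDerivAt_id (0 : ℂ)).mul_const (y (κ i) * c i (κ i))).const_add (x (κ i))
    have h2 : HasDerivAt (fun t => Hol.ext0 (μ₂ (κ i)) (γ i t))
        (fderiv ℂ (Hol.ext0 (μ₂ (κ i))) v₀ (deriv (γ i) 0)) 0 := by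
      refine HasFDerivAt.comp_hasDerivAt (f := γ i) (0 : ℂ) ?_ (hγ i).1.differentiableAt.hasDerivAt
      rw [hγ0]
      exact (Hol.differentiableAt (μ₂ (κ i)) hv₂).hasFDerivAt
    have h3 := h2.unique (h1.congr_of_eventuallyEq (hgerm i))
    rw [(IsCoord.res hW₂ hR.1).fderiv_ext0_eq (μ₂ (κ i)) ⟨v₀, hv₂⟩] at h3
    have e : ∀ k, fderiv ℂ (Hol.ext0 (Hol.res hW₂ (R k))) v₀ (deriv (γ i) 0) = c i k :=
      fun k => Hol.fderiv_ext0_res hW₂ (R k) ⟨v₀, hv₂⟩ _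
    simp only [e] at h3
    rw [Finset.sum_eq_single (κ i) (fun k _ hk => mul_eq_zero_of_right _ (hc0 i k hk))
      (fun h => absurd (Finset.mem_univ _) h)] at h3
    exact mul_right_cancel₀ (hκ i) h3
  -- Near `v₀` the speeds remain distinct, so that the conservation law is generic there.
  have hW₃ : distinctSet μ₂ ≤ W₂ := by rintro _ ⟨w, _, rfl⟩; exact w.2
  have hv₃ : (v₀ : Fin n → ℂ) ∈ distinctSet μ₂ :=
    ⟨⟨v₀, hv₂⟩, fun i j hij => by rw [hxval, hxval]; exact hx.ne hij, rfl⟩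
  have hspeeds := hμ₂.res hW₃
  refine ⟨distinctSet μ₂, hW₃.trans hW₂, Hol.res hW₃ f₂, fun i => Hol.res hW₃ (μ₂ i), hv₃,
    hf₂.res hW₃, ?_, hspeeds, hxval, fun i => ?_⟩
  · refine hspeeds.isGeneric ((IsCoord.res hW₂ hR.1).res hW₃) fun i j hij w => ?_
    obtain ⟨w', hw', hww'⟩ := w.2
    have : (⟨w, hW₃ w.2⟩ : W₂) = w' := Subtype.ext hww'.symm
    rw [Hol.res_apply, Hol.res_apply, this]
    exact hw' i j hij
  · rw [← hyval i]
    have := (IsCoord.res hW₂ hR.1).dRh_res hW₃ i (μ₂ i)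
    exact congrFun (congrArg Subtype.val this) ⟨v₀, hv₃⟩

end Existence

/-! ### The Poincaré lemma for germs of analytic two-forms -/

section Poincare

variable {E : Type*} [NormedAddCommGroup E] [NormedSpace ℂ E]

/-- The equation `y · ∂g + (m + 1) g = f` at the origin is solved term by term: the homogeneous
part of degree `k` of `f` is to be divided by `k + m + 1`. -/
theorem exists_euler {f : E → ℂ} (hf : AnalyticAt ℂ f 0) (m : ℕ) :
    ∃ g : E → ℂ, AnalyticAt ℂ g 0 ∧ ∀ᶠ y in 𝓝 0, fderiv ℂ g y y + (m + 1) * g y = f y := by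
  obtain ⟨p, r, hp⟩ := hf
  let q : FormalMultilinearSeries ℂ E ℂ := fun k => ((k : ℂ) + m + 1)⁻¹ • p k
  have hk : ∀ k : ℕ, ((k : ℂ) + m + 1) ≠ 0 := fun k => by exact_mod_cast Nat.succ_ne_zero (k + m)
  have hq : r ≤ q.radius := by
    refine ENNReal.le_of_forall_nnreal_lt fun s hs => ?_
    obtain ⟨C, -, hC⟩ := p.norm_mul_pow_le_of_lt_radius (hs.trans_le hp.r_le)
    refine q.le_radius_of_bound C fun k => le_trans ?_ (hC k)
    gcongr
    rw [norm_smul, norm_inv]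
    refine mul_le_of_le_one_left (norm_nonneg _) (inv_le_one_of_one_le₀ ?_)
    have : ((k : ℂ) + m + 1) = ((k + m + 1 : ℕ) : ℂ) := by push_cast; ring
    rw [this, Complex.norm_natCast]
    exact_mod_cast Nat.succ_le_succ (Nat.zero_le _)
  have hg : HasFPowerSeriesOnBall q.sum q 0 r :=
    (q.hasFPowerSeriesOnBall (hp.r_pos.trans_le hq)).mono hp.r_pos hq
  refine ⟨q.sum, hg.analyticAt, ?_⟩
  filter_upwards [Metric.eball_mem_nhds (0 : E) hp.r_pos] with y hy
  have h1 := hg.hasSum hy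
  have h2 := hp.hasSum hy
  have h3 := (hg.fderiv.hasSum hy).mapL (ContinuousLinearMap.apply ℂ ℂ y)
  rw [zero_add] at h1 h2 h3
  have h4 : HasSum (fun k : ℕ => (k : ℂ) * q k fun _ => y) (fderiv ℂ q.sum y y) := by
    rw [← hasSum_nat_add_iff' 1]
    simpa [FormalMultilinearSeries.derivSeries_apply_diag, add_mul] using h3
  refine (h4.add (h1.mul_left ((m : ℂ) + 1))).unique ?_
  refine h2.congr_fun fun k => ?_
  change (k : ℂ) * (((k : ℂ) + m + 1)⁻¹ * p k fun _ => y) +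
    (m + 1) * (((k : ℂ) + m + 1)⁻¹ * p k fun _ => y) = p k fun _ => y
  field_simp [hk k]
  ring

/-- The operator `y · ∂ + (m + 1)` is injective on germs: `t ^ (m + 1) * g (t y)` does not depend on
`t` if `g` is in its kernel. -/
theorem euler_unique {g : E → ℂ} (hg : AnalyticAt ℂ g 0) (m : ℕ)
    (h : ∀ᶠ y in 𝓝 0, fderiv ℂ g y y + (m + 1) * g y = 0) : ∀ᶠ y in 𝓝 0, g y = 0 := by
  obtain ⟨r, hr, hball⟩ := Metric.eventually_nhds_iff_ball.1 (hg.eventually_analyticAt.and h)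
  refine Metric.eventually_nhds_iff_ball.2 ⟨r, hr, fun y hy => ?_⟩
  let T : Set ℂ := (fun t : ℂ => t • y) ⁻¹' Metric.ball 0 r
  have hT : IsOpen T := Metric.isOpen_ball.preimage (by fun_prop)
  have hT' : IsPreconnected T :=
    ((convex_ball (0 : E) r).is_linear_preimage
      ⟨fun a b => add_smul a b y, fun a b => smul_assoc a b y⟩).isPreconnected
  have hd : ∀ t ∈ T, HasDerivAt (fun t : ℂ => t ^ (m + 1) * g (t • y)) 0 t := fun t ht => by
    have h1 : HasDerivAt (fun t : ℂ => g (t • y)) (fderiv ℂ g (t • y) ((1 : ℂ) • y)) t :=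
      HasFDerivAt.comp_hasDerivAt t (hball _ ht).1.differentiableAt.hasFDerivAt
        ((hasDerivAt_id t).smul_const y)
    have h2 := (hball _ ht).2
    rw [map_smul, smul_eq_mul] at h2
    refine ((hasDerivAt_pow (m + 1) t).mul h1).congr_deriv ?_
    rw [one_smul, Nat.add_sub_cancel]
    push_cast
    linear_combination t ^ m * h2
  have h1 := hT.is_const_of_deriv_eq_zero hT'
    (fun t ht => (hd t ht).differentiableAt.differentiableWithinAt) (fun t ht => (hd t ht).deriv)
    (x := 1) (y := 0) (by simpa [T] using hy) (by simpa [T] using hr)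
  simpa using h1

/-- Differentiation of the equation `y · ∂g + (m + 1) g = f` in the direction `u`. -/
theorem euler_fderiv {f g : E → ℂ} (hg : AnalyticAt ℂ g 0) (m : ℕ)
    (h : ∀ᶠ y in 𝓝 0, fderiv ℂ g y y + (m + 1) * g y = f y) (u : E) :
    ∀ᶠ y in 𝓝 0, fderiv ℂ (fun z => fderiv ℂ g z u) y y + ((m + 1 : ℕ) + 1) * fderiv ℂ g y u
      = fderiv ℂ f y u := by
  filter_upwards [h.eventually_nhds, hg.eventually_analyticAt] with y h1 hy
  have e : f =ᶠ[𝓝 y] fun y => fderiv ℂ g y y + (m + 1) * g y := by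
    filter_upwards [h1] with z hz using hz.symm
  have d2 : DifferentiableAt ℂ (fderiv ℂ g) y := hy.fderiv.differentiableAt
  have e1 : HasFDerivAt (fun z => fderiv ℂ g z z)
      ((fderiv ℂ g y).comp (ContinuousLinearMap.id ℂ E) + (fderiv ℂ (fderiv ℂ g) y).flip y) y :=
    d2.hasFDerivAt.clm_apply (hasFDerivAt_id y)
  have e2 := e1.fun_add (hy.differentiableAt.hasFDerivAt.const_mul ((m : ℂ) + 1))
  have e3 : HasFDerivAt (fun z => fderiv ℂ g z u) ((fderiv ℂ (fderiv ℂ g) y).flip u) y := by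
    simpa using! d2.hasFDerivAt.clm_apply (hasFDerivAt_const u y)
  have hs : fderiv ℂ (fderiv ℂ g) y u y = fderiv ℂ (fderiv ℂ g) y y u :=
    (hy.contDiffAt (n := 2)).isSymmSndFDerivAt (by simp) u y
  rw [e.fderiv_eq, e3.fderiv, HasFDerivAt.fderiv e2]
  simp [hs]
  ring

/-- The Poincaré lemma for two-forms: with `T` the inverse of `y · ∂ + 2`, the one-form
`q_k = ∑ i, y_i T(Q_{ik})` is a primitive. -/
theorem exists_primitive_germ (Q : Fin n → Fin n → (Fin n → ℂ) → ℂ)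
    (hQ : ∀ i k, AnalyticAt ℂ (Q i k) 0) (hanti : ∀ i k, ∀ᶠ y in 𝓝 0, Q i k y = - Q k i y)
    (hclosed : ∀ l i k, ∀ᶠ y in 𝓝 0, fderiv ℂ (Q i k) y (Pi.single l 1) +
      fderiv ℂ (Q k l) y (Pi.single i 1) + fderiv ℂ (Q l i) y (Pi.single k 1) = 0) :
    ∃ q : Fin n → (Fin n → ℂ) → ℂ, (∀ k, AnalyticAt ℂ (q k) 0) ∧ ∀ l k, ∀ᶠ y in 𝓝 0,
      fderiv ℂ (q k) y (Pi.single l 1) - fderiv ℂ (q l) y (Pi.single k 1) = Q l k y := by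
  choose T hT hTQ using fun i k => exists_euler (hQ i k) 1
  have hTanti : ∀ i k, ∀ᶠ y in 𝓝 0, T i k y = - T k i y := fun i k => by
    have h1 := euler_unique ((hT i k).add (hT k i)) 1 (by
      filter_upwards [hTQ i k, hTQ k i, hanti i k, (hT i k).eventually_analyticAt,
        (hT k i).eventually_analyticAt] with y h1 h2 h3 h4 h5
      rw [fderiv_add h4.differentiableAt h5.differentiableAt, add_apply,
        Pi.add_apply]
      linear_combination h1 + h2 + h3)
    filter_upwards [h1] with y hy
    exact eq_neg_of_add_eq_zero_left hy
  have hD : ∀ i k (u : Fin n → ℂ), AnalyticAt ℂ (fun z => fderiv ℂ (T i k) z u) 0 := fun i k u =>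
    ((ContinuousLinearMap.apply ℂ ℂ u).analyticAt _).comp (hT i k).fderiv
  have hTclosed : ∀ l i k, ∀ᶠ y in 𝓝 0, fderiv ℂ (T i k) y (Pi.single l 1) +
      fderiv ℂ (T k l) y (Pi.single i 1) + fderiv ℂ (T l i) y (Pi.single k 1) = 0 :=
    fun l i k => by
      refine euler_unique (((hD i k (Pi.single l 1)).add (hD k l (Pi.single i 1))).add
        (hD l i (Pi.single k 1))) 2 ?_
      filter_upwards [euler_fderiv (hT i k) 1 (hTQ i k) (Pi.single l 1),
        euler_fderiv (hT k l) 1 (hTQ k l) (Pi.single i 1),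
        euler_fderiv (hT l i) 1 (hTQ l i) (Pi.single k 1), hclosed l i k,
        (hD i k (Pi.single l 1)).eventually_analyticAt,
        (hD k l (Pi.single i 1)).eventually_analyticAt,
        (hD l i (Pi.single k 1)).eventually_analyticAt] with y h1 h2 h3 h4 h5 h6 h7
      rw [fderiv_fun_add (h5.differentiableAt.fun_add h6.differentiableAt) h7.differentiableAt,
        fderiv_fun_add h5.differentiableAt h6.differentiableAt, add_apply,
        add_apply]
      push_cast at h1 h2 h3 ⊢
      linear_combination h1 + h2 + h3 + h4
  have hderiv : ∀ k, ∀ᶠ y in 𝓝 0, ∀ l, fderiv ℂ (fun y => ∑ i, y i * T i k y) y (Pi.single l 1)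
      = T l k y + ∑ i, y i * fderiv ℂ (T i k) y (Pi.single l 1) := fun k => by
    filter_upwards [Filter.eventually_all.2 fun i => (hT i k).eventually_analyticAt] with y hy l
    have h1 : HasFDerivAt (fun y : Fin n → ℂ => ∑ i, y i * T i k y)
        (∑ i, (y i • fderiv ℂ (T i k) y + T i k y • ContinuousLinearMap.proj i)) y :=
      HasFDerivAt.fun_sum fun i _ =>
        (ContinuousLinearMap.proj (R := ℂ) (φ := fun _ : Fin n => ℂ) i).hasFDerivAt.mul
          (hy i).differentiableAt.hasFDerivAt
    rw [h1.fderiv, sum_apply]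
    simp only [add_apply, smul_apply, smul_eq_mul,
      ContinuousLinearMap.proj_apply, Finset.sum_add_distrib, Pi.single_apply, mul_ite, mul_one,
      mul_zero, Finset.sum_ite_eq', Finset.mem_univ, if_true]
    ring
  refine ⟨fun k y => ∑ i, y i * T i k y, fun k => ?_, fun l k => ?_⟩
  · refine Finset.analyticAt_fun_sum _ fun i _ => ?_
    exact ((ContinuousLinearMap.proj (R := ℂ) (φ := fun _ : Fin n => ℂ) i).analyticAt _).mul (hT i k)
  · filter_upwards [hderiv k, hderiv l, hTQ l k, hTanti l k,
      Filter.eventually_all.2 fun i => hTclosed l i k,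
      Filter.eventually_all.2 fun i => (hTanti l i).eventually_nhds,
      (hTanti l k).eventually_nhds] with y h1 h2 h3 h4 h5 h6 h7
    have e1 : ∀ i, fderiv ℂ (T i l) y (Pi.single k 1) = - fderiv ℂ (T l i) y (Pi.single k 1) :=
      fun i => by
        have : T l i =ᶠ[𝓝 y] - T i l := h6 i
        rw [this.fderiv_eq, fderiv_neg]; simp
    have e2 : ∀ i, fderiv ℂ (T k l) y (Pi.single i 1) = - fderiv ℂ (T l k) y (Pi.single i 1) :=
      fun i => by
        have : T l k =ᶠ[𝓝 y] - T k l := h7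
        rw [this.fderiv_eq, fderiv_neg]; simp
    have e3 : fderiv ℂ (T l k) y y = ∑ i, y i * fderiv ℂ (T l k) y (Pi.single i 1) := by
      have h8 := congrArg (fderiv ℂ (T l k) y) (pi_eq_sum_univ' y)
      simpa only [map_sum, map_smul, smul_eq_mul] using h8
    have e4 : ∑ i, y i * fderiv ℂ (T i k) y (Pi.single l 1)
        - ∑ i, y i * fderiv ℂ (T i l) y (Pi.single k 1)
        = ∑ i, y i * fderiv ℂ (T l k) y (Pi.single i 1) := by
      rw [← Finset.sum_sub_distrib]
      refine Finset.sum_congr rfl fun i _ => ?_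
      have := h5 i
      rw [e2 i] at this
      rw [e1 i]
      linear_combination y i * this
    rw [h1, h2]
    rw [e3] at h3
    push_cast at h3
    linear_combination h3 - h4 + e4

end Poincare

/-! ### Coordinate charts -/

section Chart

variable {U W : TopologicalSpace.Opens (Fin n → ℂ)}

/-- Functions with invertible Jacobian matrix are local coordinates: `x ↦ ψ x` is the inverse of
`v ↦ R(v) - R(v₀)`, on a ball for the supremum norm, that is, a polydisc. -/
theorem IsCoord.exists_chart {R : Fin n → Hol W} (hR : IsCoord R) (v₀ : W) :
    ∃ (ψ : (Fin n → ℂ) → (Fin n → ℂ)) (r : ℝ), 0 < r ∧ ψ 0 = v₀ ∧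
      (∀ x ∈ Metric.ball 0 r, AnalyticAt ℂ ψ x ∧ ψ x ∈ W ∧
        ∀ i, Hol.ext0 (R i) (ψ x) = R i v₀ + x i) ∧
      ∀ᶠ v in 𝓝 (v₀ : Fin n → ℂ), ψ (fun i => Hol.ext0 (R i) v - R i v₀) = v := by
  set F : (Fin n → ℂ) → (Fin n → ℂ) := fun v i => Hol.ext0 (R i) v - R i v₀ with hF
  have hFa : AnalyticAt ℂ F v₀ := AnalyticAt.pi fun i => (Hol.analyticAt (R i) v₀.2).sub analyticAt_const
  have hF0 : F v₀ = 0 := funext fun i => by simp [hF, Hol.ext0_coe]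
  let e : (Fin n → ℂ) ≃L[ℂ] (Fin n → ℂ) :=
    (Matrix.toLinearEquiv' (jacobian R v₀)
      (Matrix.invertibleOfIsUnitDet _ (hR v₀))).toContinuousLinearEquiv
  have he : fderiv ℂ F v₀ = e := by
    ext1 u
    funext k
    have h1 : HasFDerivAt F (ContinuousLinearMap.pi fun i => fderiv ℂ (Hol.ext0 (R i)) v₀) v₀ :=
      hasFDerivAt_pi.2 fun i => (Hol.differentiableAt (R i) v₀.2).hasFDerivAt.sub_const _
    rw [h1.fderiv]
    exact (jacobian_mulVec R v₀ u k).symm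
  have hs : HasStrictFDerivAt F (e : (Fin n → ℂ) →L[ℂ] (Fin n → ℂ)) v₀ := by
    rw [← he]; exact hFa.hasStrictFDerivAt
  let φ := hs.toOpenPartialHomeomorph F
  have hφ : ∀ v, φ v = F v := fun v => rfl
  have hφ0 : (v₀ : Fin n → ℂ) ∈ φ.source := hs.mem_toOpenPartialHomeomorph_source
  have ht : (0 : Fin n → ℂ) ∈ φ.target := by
    have := φ.map_source hφ0
    rwa [hφ, hF0] at this
  have hψ0 : φ.symm 0 = v₀ := by
    have := φ.left_inv hφ0
    rwa [hφ, hF0] at this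
  have hψa : AnalyticAt ℂ φ.symm 0 :=
    φ.analyticAt_symm ht (i := e) (by rw [hψ0]; exact hFa) (by rw [hψ0]; exact he)
  have hmem : ∀ᶠ x in 𝓝 0, φ.symm x ∈ W :=
    hψa.continuousAt.eventually_mem (by rw [hψ0]; exact W.isOpen.mem_nhds v₀.2)
  obtain ⟨r, hr, hball⟩ := Metric.eventually_nhds_iff_ball.1
    ((hψa.eventually_analyticAt.and hmem).and (φ.open_target.mem_nhds ht))
  refine ⟨φ.symm, r, hr, hψ0, fun x hx => ⟨(hball x hx).1.1, (hball x hx).1.2, fun i => ?_⟩, ?_⟩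
  · have h1 := congrFun (φ.right_inv (hball x hx).2) i
    rw [hφ] at h1
    linear_combination h1
  · filter_upwards [φ.open_source.mem_nhds hφ0] with v hv
    exact φ.left_inv hv

/-- The differential of a function in the coordinate chart has the components `dRh R l f`. -/
theorem IsCoord.hasFDerivAt_chart {R : Fin n → Hol W} (hR : IsCoord R) {v₀ : W}
    {ψ : (Fin n → ℂ) → (Fin n → ℂ)} {r : ℝ}
    (hψ : ∀ x ∈ Metric.ball 0 r, AnalyticAt ℂ ψ x ∧ ψ x ∈ W ∧
      ∀ i, Hol.ext0 (R i) (ψ x) = R i v₀ + x i)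
    {x : Fin n → ℂ} (hx : x ∈ Metric.ball 0 r) (f : Hol W) :
    HasFDerivAt (fun x => Hol.ext0 f (ψ x))
      (∑ l, dRh R l f ⟨ψ x, (hψ x hx).2.1⟩ •
        (ContinuousLinearMap.proj l : (Fin n → ℂ) →L[ℂ] ℂ)) x := by
  have hd : ∀ g : Hol W, HasFDerivAt (fun x => Hol.ext0 g (ψ x))
      ((fderiv ℂ (Hol.ext0 g) (ψ x)).comp (fderiv ℂ ψ x)) x := fun g =>
    (Hol.differentiableAt g (hψ x hx).2.1).hasFDerivAt.comp x (hψ x hx).1.differentiableAt.hasFDerivAt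
  have hproj : ∀ k, (fderiv ℂ (Hol.ext0 (R k)) (ψ x)).comp (fderiv ℂ ψ x)
      = ContinuousLinearMap.proj k := fun k => by
    refine (hd (R k)).unique ?_
    have h1 : HasFDerivAt (fun x : Fin n → ℂ => R k v₀ + x k)
        (ContinuousLinearMap.proj k : (Fin n → ℂ) →L[ℂ] ℂ) x :=
      ((ContinuousLinearMap.proj k : (Fin n → ℂ) →L[ℂ] ℂ).hasFDerivAt).const_add _
    refine h1.congr_of_eventuallyEq ?_
    filter_upwards [Metric.isOpen_ball.mem_nhds hx] with y hy using (hψ y hy).2.2 k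
  refine (hd f).congr_fderiv ?_
  ext1 u
  rw [ContinuousLinearMap.comp_apply, hR.fderiv_ext0_eq f ⟨ψ x, (hψ x hx).2.1⟩, sum_apply]
  refine Finset.sum_congr rfl fun l _ => ?_
  rw [smul_apply, ← hproj l]
  rfl

/-- The derivation `dRh R l` at a point, applied to a function of the coordinates, is the partial
derivative. -/
theorem IsCoord.dRh_comp {R : Fin n → Hol W} (hR : IsCoord R) {w : W} {a : Fin n → ℂ}
    {q : (Fin n → ℂ) → ℂ} (hq : DifferentiableAt ℂ q (fun i => R i w - a i)) {f : Hol W}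
    (hf : ∀ᶠ v in 𝓝 (w : Fin n → ℂ), Hol.ext0 f v = q (fun i => Hol.ext0 (R i) v - a i))
    (l : Fin n) : dRh R l f w = fderiv ℂ q (fun i => R i w - a i) (Pi.single l 1) := by
  have h0 : (fun i => Hol.ext0 (R i) w - a i) = fun i => R i w - a i :=
    funext fun i => by rw [Hol.ext0_coe]
  have h1 : HasFDerivAt (fun v i => Hol.ext0 (R i) v - a i)
      (ContinuousLinearMap.pi fun i => fderiv ℂ (Hol.ext0 (R i)) w) (w : Fin n → ℂ) :=
    hasFDerivAt_pi.2 fun i => (Hol.differentiableAt (R i) w.2).hasFDerivAt.sub_const _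
  have h2 : HasFDerivAt (Hol.ext0 f) _ (w : Fin n → ℂ) :=
    (HasFDerivAt.comp (w : Fin n → ℂ) (f := fun v i => Hol.ext0 (R i) v - a i)
      (by rw [h0]; exact hq.hasFDerivAt) h1).congr_of_eventuallyEq hf
  have h3 : ∀ g : Hol W, dRh R l g w
      = fderiv ℂ (Hol.ext0 g) w (fun α => frame R α l w) := fun g => by
    rw [Hol.fderiv_ext0_apply, dRh_apply, Hol.sum_apply]
    refine Finset.sum_congr rfl fun α _ => ?_
    rw [Hol.mul_apply, mul_comm]
  rw [h3, h2.fderiv, ContinuousLinearMap.comp_apply]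
  congr 1
  funext k
  rw [ContinuousLinearMap.pi_apply, ← h3, hR.dRh_self, Pi.single_apply]
  by_cases h : k = l
  · rw [if_pos h, if_pos (by rw [h])]; rfl
  · rw [if_neg h, if_neg h]; rfl

/-- The Poincaré lemma for two-forms in the coordinates `R`: locally, closed forms are exact. -/
theorem IsCoord.exists_primitive {R : Fin n → Hol W} (hR : IsCoord R) {Q : Fin n → Fin n → Hol W}
    (hanti : ∀ i k, Q i k = - Q k i)
    (hclosed : ∀ l i k, dRh R l (Q i k) + dRh R i (Q k l) + dRh R k (Q l i) = 0) (v₀ : W) :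
    ∃ (W' : TopologicalSpace.Opens (Fin n → ℂ)) (h : W' ≤ W) (q : Fin n → Hol W'),
      (v₀ : Fin n → ℂ) ∈ W' ∧ ∀ l k, dRh (fun i => Hol.res h (R i)) l (q k)
        - dRh (fun i => Hol.res h (R i)) k (q l) = Hol.res h (Q l k) := by
  obtain ⟨ψ, r, hr, hψ0, hψ, hinv⟩ := hR.exists_chart v₀
  have hball : ∀ᶠ x in 𝓝 (0 : Fin n → ℂ), x ∈ Metric.ball (0 : Fin n → ℂ) r :=
    Metric.isOpen_ball.mem_nhds (Metric.mem_ball_self hr)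
  have hd : ∀ f : Hol W, ∀ x (hx : x ∈ Metric.ball 0 r) l,
      fderiv ℂ (fun x => Hol.ext0 f (ψ x)) x (Pi.single l 1) = dRh R l f ⟨ψ x, (hψ x hx).2.1⟩ := by
    intro f x hx l
    rw [(hR.hasFDerivAt_chart hψ hx f).fderiv, sum_apply]
    simp [Pi.single_apply]
  obtain ⟨q, hq, hqQ⟩ := exists_primitive_germ (fun i k x => Hol.ext0 (Q i k) (ψ x))
    (fun i k => by
      refine AnalyticAt.comp (g := Hol.ext0 (Q i k)) (f := ψ) ?_ (hψ 0 (Metric.mem_ball_self hr)).1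
      rw [hψ0]; exact Hol.analyticAt _ v₀.2)
    (fun i k => by
      filter_upwards [hball] with x hx
      rw [Hol.ext0_of_mem _ (hψ x hx).2.1, Hol.ext0_of_mem _ (hψ x hx).2.1, hanti i k]
      rfl)
    (fun l i k => by
      filter_upwards [hball] with x hx
      rw [hd _ x hx, hd _ x hx, hd _ x hx]
      exact congrArg (Hol.ev ⟨ψ x, (hψ x hx).2.1⟩) (hclosed l i k))
  set F : (Fin n → ℂ) → (Fin n → ℂ) := fun v i => Hol.ext0 (R i) v - R i v₀ with hF
  have hFc : ContinuousAt F v₀ := continuousAt_pi.2 fun i =>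
    (Hol.differentiableAt (R i) v₀.2).continuousAt.sub continuousAt_const
  have hF0 : F v₀ = 0 := funext fun i => by simp [hF, Hol.ext0_coe]
  have hqall := (Filter.eventually_all.2 fun k => (hq k).eventually_analyticAt).and
    (Filter.eventually_all.2 fun l => Filter.eventually_all.2 fun k => hqQ l k)
  rw [← hF0] at hqall
  obtain ⟨S, hS, hSo, hvS⟩ := eventually_nhds_iff.1 ((hFc.eventually hqall).and hinv)
  let W' : TopologicalSpace.Opens (Fin n → ℂ) := ⟨S ∩ W, hSo.inter W.isOpen⟩
  have h : W' ≤ W := Set.inter_subset_right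
  have hFan : ∀ v ∈ W, AnalyticAt ℂ F v := fun v hv =>
    AnalyticAt.pi fun i => (Hol.analyticAt (R i) hv).sub analyticAt_const
  let p : Fin n → Hol W' := fun k => Hol.mk' (fun v => q k (F v)) fun v hv =>
    AnalyticAt.comp (g := q k) (f := F) ((hS v hv.1).1.1 k) (hFan v hv.2)
  refine ⟨W', h, p, ⟨hvS, v₀.2⟩, fun l k => Hol.ext_iff'.2 fun w => ?_⟩
  have hFw : (fun i => Hol.res h (R i) w - R i v₀) = F w := funext fun i => by
    rw [Hol.res_apply, hF, ← Hol.ext0_of_mem]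
  have hp : ∀ k l, dRh (fun i => Hol.res h (R i)) l (p k) w
      = fderiv ℂ (q k) (F w) (Pi.single l 1) := fun k l => by
    rw [← hFw]
    refine (hR.res h).dRh_comp ?_ ?_ l
    · rw [hFw]; exact ((hS w w.2.1).1.1 k).differentiableAt
    · filter_upwards [W'.isOpen.mem_nhds w.2] with v hv
      rw [Hol.ext0_of_mem _ hv]
      change q k (F v) = _
      congr 1
      funext i
      rw [Hol.ext0_of_mem _ hv, Hol.res_apply, hF, ← Hol.ext0_of_mem]
  rw [Hol.sub_apply, hp, hp, (hS w w.2.1).1.2 l k, (hS w w.2.1).2, Hol.ext0_of_mem _ w.2.2]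
  rfl

/-- A function whose derivatives along all coordinates except `R_i` vanish depends on `R_i` only:
near each point by integration in a polydisc, and then globally on connected level sets. -/
theorem IsCoord.isFunctionOf {R : Fin n → Hol W} (hR : IsCoord R) {i : Fin n} {f : Hol W}
    (hf : ∀ j, j ≠ i → dRh R j f = 0) : IsFunctionOf (R i) f := by
  -- The local form, together with a local section of `R_i`.
  have key : ∀ v₀ : W, ∃ (c : ℂ → ℂ) (s : ℂ → (Fin n → ℂ)), AnalyticAt ℂ c (R i v₀) ∧
      (∀ᶠ v in 𝓝 (v₀ : Fin n → ℂ), Hol.ext0 f v = c (Hol.ext0 (R i) v)) ∧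
      ContinuousAt s (R i v₀) ∧ s (R i v₀) = v₀ ∧
      ∀ᶠ z in 𝓝 (R i v₀), Hol.ext0 (R i) (s z) = z := by
    intro v₀
    obtain ⟨ψ, r, hr, hψ0, hψ, hinv⟩ := hR.exists_chart v₀
    let L : ℂ → (Fin n → ℂ) := fun z => Pi.single i (z - R i v₀)
    have hLa : AnalyticAt ℂ L (R i v₀) := by
      refine AnalyticAt.comp (g := fun z : ℂ => (Pi.single i z : Fin n → ℂ)) ?_
        (analyticAt_id.sub analyticAt_const)
      exact (ContinuousLinearMap.single ℂ (fun _ : Fin n => ℂ) i).analyticAt _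
    have hL0 : L (R i v₀) = 0 := by simp [L]
    have hψ0' := (hψ 0 (Metric.mem_ball_self hr)).1
    have hsa : AnalyticAt ℂ (fun z => ψ (L z)) (R i v₀) :=
      AnalyticAt.comp (g := ψ) (f := L) (by rw [hL0]; exact hψ0') hLa
    have hs0 : ψ (L (R i v₀)) = v₀ := by rw [hL0, hψ0]
    have hLball : ∀ᶠ z in 𝓝 (R i v₀), L z ∈ Metric.ball (0 : Fin n → ℂ) r :=
      hLa.continuousAt.eventually_mem (by
        rw [hL0]; exact Metric.isOpen_ball.mem_nhds (Metric.mem_ball_self hr))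
    refine ⟨fun z => Hol.ext0 f (ψ (L z)), fun z => ψ (L z), ?_, ?_, hsa.continuousAt, hs0, ?_⟩
    · exact AnalyticAt.comp (g := Hol.ext0 f) (f := fun z => ψ (L z))
        (by rw [hs0]; exact Hol.analyticAt f v₀.2) hsa
    · have hFc : ContinuousAt (fun v i => Hol.ext0 (R i) v - R i v₀) (v₀ : Fin n → ℂ) :=
        continuousAt_pi.2 fun i =>
          (Hol.differentiableAt (R i) v₀.2).continuousAt.sub continuousAt_const
      have hmem : ∀ᶠ v in 𝓝 (v₀ : Fin n → ℂ),
          (fun i => Hol.ext0 (R i) v - R i v₀) ∈ Metric.ball (0 : Fin n → ℂ) r :=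
        hFc.eventually_mem (Metric.isOpen_ball.mem_nhds (by
          simpa only [Hol.ext0_coe, sub_self] using! Metric.mem_ball_self hr))
      filter_upwards [hmem, hinv] with v hv1 hv2
      set x : Fin n → ℂ := fun i => Hol.ext0 (R i) v - R i v₀ with hx
      have hx' : L (Hol.ext0 (R i) v) ∈ Metric.ball (0 : Fin n → ℂ) r := by
        rw [mem_ball_zero_iff] at hv1 ⊢
        exact lt_of_le_of_lt ((Pi.norm_single (G := fun _ : Fin n => ℂ) (x i)).le.trans
          (norm_le_pi_norm x i)) hv1
      rw [← hv2]
      -- `f ∘ ψ` is constant on the segment from `x` to `x_i e_i`: the coordinate `i` does not vary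
      -- there, and the derivatives along the other coordinates vanish.
      let T : Set ℂ := {t | x + t • (L (Hol.ext0 (R i) v) - x) ∈ Metric.ball (0 : Fin n → ℂ) r}
      have hT : IsOpen T := Metric.isOpen_ball.preimage (by fun_prop)
      have hTc : Convex ℝ T := by
        intro a ha b hb α β hα hβ hαβ
        have h1 := convex_ball (0 : Fin n → ℂ) r ha hb hα hβ hαβ
        refine (congrArg (· ∈ Metric.ball (0 : Fin n → ℂ) r) ?_).mp h1
        have h2 : (α : ℂ) + β = 1 := by exact_mod_cast hαβ
        funext j
        simp only [Pi.add_apply, Pi.smul_apply, smul_eq_mul, Complex.real_smul]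
        linear_combination x j * h2
      have hd : ∀ t ∈ T, HasDerivAt
          (fun t : ℂ => Hol.ext0 f (ψ (x + t • (L (Hol.ext0 (R i) v) - x)))) 0 t := fun t ht => by
        have h1 := (hR.hasFDerivAt_chart hψ ht f).comp_hasDerivAt (t : ℂ)
          (((hasDerivAt_id t).smul_const (L (Hol.ext0 (R i) v) - x)).const_add x)
        refine h1.congr_deriv ?_
        rw [sum_apply]
        refine Finset.sum_eq_zero fun l _ => ?_
        by_cases hl : l = i
        · subst hl
          simp [L, hx]
        · rw [hf l hl]
          simp
      have h1 := hT.is_const_of_deriv_eq_zero hTc.isPreconnected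
        (fun t ht => (hd t ht).differentiableAt.differentiableWithinAt)
        (fun t ht => (hd t ht).deriv) (x := 0) (y := 1)
        (by simpa [T] using hv1) (by simpa [T] using hx')
      simpa [hv2] using h1
    · filter_upwards [hLball] with z hz
      rw [(hψ _ hz).2.2 i]
      simp [L]
  refine ⟨fun v => ?_, fun S hS hconn => ?_⟩
  · obtain ⟨c, -, hc, hcf, -⟩ := key v
    refine ⟨c, hc, ?_⟩
    filter_upwards [continuous_subtype_val.continuousAt.eventually hcf] with w hw
    rwa [Hol.ext0_coe, Hol.ext0_coe] at hw
  · have hloc : ∀ v : W, ∃ c : ℂ → ℂ, ∀ᶠ w in 𝓝 v, f w = c (R i w) := fun v => by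
      obtain ⟨c, -, hc, hcf, -⟩ := key v
      refine ⟨c, ?_⟩
      filter_upwards [continuous_subtype_val.continuousAt.eventually hcf] with w hw
      rwa [Hol.ext0_coe, Hol.ext0_coe] at hw
    have hlev : ∀ v ∈ S, ∀ w ∈ S, R i v = R i w → f v = f w := fun v hv w hw hvw => by
      refine (hconn (R i w)).induction₂ (fun a b => f a = f b) (fun a ha => ?_)
        (fun _ _ _ _ _ _ h1 h2 => h1.trans h2) (fun _ _ _ _ h => h.symm) ⟨hv, hvw⟩ ⟨hw, rfl⟩
      obtain ⟨c, hc⟩ := hloc a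
      filter_upwards [nhdsWithin_le_nhds hc, self_mem_nhdsWithin] with b hb hb'
      rw [hc.self_of_nhds, hb, ha.2, hb'.2]
    classical
    let c : ℂ → ℂ := fun z => if h : ∃ w ∈ S, R i w = z then f h.choose else 0
    have hc : ∀ w ∈ S, f w = c (R i w) := fun w hw => by
      have h : ∃ w' ∈ S, R i w' = R i w := ⟨w, hw, rfl⟩
      simp only [c, dif_pos h]
      exact hlev w hw _ h.choose_spec.1 h.choose_spec.2.symm
    refine ⟨c, ?_, hc⟩
    rintro _ ⟨w, hw, rfl⟩
    obtain ⟨c', s, hc', hcf, hs, hs0, hsR⟩ := key w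
    refine hc'.congr ?_
    have hSw : Subtype.val '' S ∈ 𝓝 (w : Fin n → ℂ) :=
      (W.isOpen.isOpenMap_subtype_val S hS).mem_nhds ⟨w, hw, rfl⟩
    filter_upwards [hs.eventually (by rw [hs0]; exact hcf),
      hs.eventually_mem (by rw [hs0]; exact hSw), hsR] with z h1 h2 h3
    obtain ⟨w', hw', hw'z⟩ := h2
    rw [← hw'z] at h1 h3
    rw [Hol.ext0_coe] at h1 h3
    rw [Hol.ext0_coe, h3] at h1
    rw [← h1, hc w' hw', h3]

end Chart

/-! ### First order: compatibility of the two-form -/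

section FirstOrder

open MvPolynomial DiffPoly

variable {U W : TopologicalSpace.Opens (Fin n → ℂ)} {η : Matrix (Fin n) (Fin n) ℂ}

/-- The functions `lam_i` take pairwise distinct values at every point. -/
def DistinctValues (lam : Fin n → Hol W) : Prop := ∀ i j, i ≠ j → ∀ v, lam i v ≠ lam j v

/-- The holomorphic function `1 / (lam_i - lam_j)`; this is meant for `i ≠ j` and distinct values,
otherwise it is the inverse of a non-unit, which is `0`. -/
def speedInv (lam : Fin n → Hol W) (i j : Fin n) : Hol W := Ring.inverse (lam i - lam j)

theorem DistinctValues.res (h : W ≤ U) {lam : Fin n → Hol U} (hl : DistinctValues lam) :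
    DistinctValues (fun i => Hol.res h (lam i)) := fun i j hij w => hl i j hij ⟨w, h w.2⟩

theorem DistinctValues.isUnit_sub {lam : Fin n → Hol W} (hl : DistinctValues lam) {i j : Fin n}
    (hij : i ≠ j) : IsUnit (lam i - lam j) :=
  Hol.isUnit_of_forall_ne_zero fun w => sub_ne_zero.2 (hl i j hij w)

theorem DistinctValues.sub_mul_speedInv {lam : Fin n → Hol W} (hl : DistinctValues lam)
    {i j : Fin n} (hij : i ≠ j) : (lam i - lam j) * speedInv lam i j = 1 :=
  Ring.mul_inverse_cancel _ (hl.isUnit_sub hij)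

theorem DistinctValues.speedInv_apply {lam : Fin n → Hol W} (hl : DistinctValues lam)
    {i j : Fin n} (hij : i ≠ j) (w : W) : speedInv lam i j w = (lam i w - lam j w)⁻¹ :=
  eq_inv_of_mul_eq_one_right (congrArg (Hol.ev w) (hl.sub_mul_speedInv hij))

theorem DistinctValues.speedInv_comm {lam : Fin n → Hol W} (hl : DistinctValues lam)
    {i j : Fin n} (hij : i ≠ j) : speedInv lam j i = - speedInv lam i j := by
  linear_combination (-speedInv lam j i) * hl.sub_mul_speedInv hij
    - speedInv lam i j * hl.sub_mul_speedInv hij.symm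

theorem DistinctValues.res_speedInv (h : W ≤ U) {lam : Fin n → Hol U} (hl : DistinctValues lam)
    {i j : Fin n} (hij : i ≠ j) :
    Hol.res h (speedInv lam i j) = speedInv (fun i => Hol.res h (lam i)) i j :=
  Hol.ext_iff'.2 fun w => by
    rw [Hol.res_apply, hl.speedInv_apply hij, (hl.res h).speedInv_apply hij]
    rfl

/-- The holomorphic function `a_{ij} = lam_{i,j} / (lam_i - lam_j)`, for `i ≠ j`. -/
def aHol (lam R : Fin n → Hol W) (i j : Fin n) : Hol W := dRh R j (lam i) * speedInv lam i j

/-- The holomorphic function `ω_{ij} = (p_{i,j} - p_{j,i}) / (lam_i - lam_j)`, for `i ≠ j`. -/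
def omegaHol (lam R p : Fin n → Hol W) (i j : Fin n) : Hol W :=
  (dRh R j (p i) - dRh R i (p j)) * speedInv lam i j

theorem aCoef_eq {lam R : Fin n → Hol W} (hR : IsCoord R) (hl : DistinctValues lam) {i j : Fin n}
    (hij : i ≠ j) (w : W) : aCoef lam R i j w = aHol lam R i j w := by
  rw [aHol, Hol.mul_apply, hl.speedInv_apply hij, ← hR.dR_eq]
  rfl

theorem omega_eq {lam R : Fin n → Hol W} (hR : IsCoord R) (hl : DistinctValues lam)
    (p : Fin n → Hol W) {i j : Fin n} (hij : i ≠ j) :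
    omega lam R p i j = (omegaHol lam R p i j : W → ℂ) := by
  funext w
  rw [omegaHol, Hol.mul_apply, hl.speedInv_apply hij, Hol.sub_apply, ← hR.dR_eq, ← hR.dR_eq]
  rfl

theorem res_aHol (h : W ≤ U) {lam R : Fin n → Hol U} (hR : IsCoord R) (hl : DistinctValues lam)
    {i j : Fin n} (hij : i ≠ j) : Hol.res h (aHol lam R i j)
      = aHol (fun i => Hol.res h (lam i)) (fun i => Hol.res h (R i)) i j := by
  rw [aHol, aHol, map_mul, hl.res_speedInv h hij, hR.dRh_res]

theorem res_omegaHol (h : W ≤ U) {lam R : Fin n → Hol U} (hR : IsCoord R) (hl : DistinctValues lam)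
    (p : Fin n → Hol U) {i j : Fin n} (hij : i ≠ j) : Hol.res h (omegaHol lam R p i j)
      = omegaHol (fun i => Hol.res h (lam i)) (fun i => Hol.res h (R i))
        (fun i => Hol.res h (p i)) i j := by
  rw [omegaHol, omegaHol, map_mul, hl.res_speedInv h hij, map_sub, hR.dRh_res, hR.dRh_res]

theorem omegaHol_comm {lam : Fin n → Hol W} (hl : DistinctValues lam) (R p : Fin n → Hol W)
    (i j : Fin n) : omegaHol lam R p i j = omegaHol lam R p j i := by
  rcases eq_or_ne i j with rfl | hij
  · rfl
  · rw [omegaHol, omegaHol, hl.speedInv_comm hij]; ring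

/-- The difference of the two sides of the compatibility condition
`ω_{ij,k} - ω_{ik,j} = a_{ij} ω_{ik} + a_{ji} ω_{jk} - a_{ik} ω_{ij} - a_{ki} ω_{kj}`. -/
def compatDefect {A : Type*} [CommRing A] [Algebra ℂ A] (D : Fin n → Derivation ℂ A A)
    (a ω : Fin n → Fin n → A) (i j k : Fin n) : A :=
  D k (ω i j) - D j (ω i k) - (a i j * ω i k + a j i * ω j k - a i k * ω i j - a k i * ω k j)

/-- The exterior derivative of the two-form with components `ω_{ij} (μ_i - μ_j)` is a linear
combination of the speeds `μ_i`, whose coefficients do not depend on the conservation law. -/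
theorem cyclic_sum_eq_compatDefect {A : Type*} [CommRing A] [Algebra ℂ A]
    (D : Fin n → Derivation ℂ A A) {a ω : Fin n → Fin n → A} {μ : Fin n → A}
    (hω : ∀ i j, ω i j = ω j i) (hμ : ∀ i j, i ≠ j → D j (μ i) = a i j * (μ i - μ j))
    {i j k : Fin n} (hij : i ≠ j) (hjk : j ≠ k) (hik : i ≠ k) :
    D k (ω i j * (μ i - μ j)) + D i (ω j k * (μ j - μ k)) + D j (ω k i * (μ k - μ i))
      = μ i * compatDefect D a ω i j k + μ j * compatDefect D a ω j k i
        + μ k * compatDefect D a ω k i j := by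
  simp only [compatDefect, Derivation.leibniz, smul_eq_mul, map_sub, hμ i j hij, hμ j i hij.symm,
    hμ j k hjk, hμ k j hjk.symm, hμ i k hik, hμ k i hik.symm]
  rw [hω j i, hω k j, hω k i]
  ring

/-- A conservation law with speeds `μ` extends to first order, with the term `∑ i, q_i R_{i,x}`, if
and only if the exterior derivative of `q` is the two-form with components `ω_{ij} (μ_i - μ_j)`. -/
theorem HasSpeeds.first_order_iff {R : Fin n → Hol W} (hR : IsCoord R) {h f : Hol W}
    {lam μ : Fin n → Hol W} (hl : DistinctValues lam) (hh : HasSpeeds η R h lam)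
    (hf : HasSpeeds η R f μ) (p q : Fin n → Hol W) :
    SameFunctional (bracket η (∑ i, C (p i) * Rx R i) (C f)
      - bracket η (∑ i, C (q i) * Rx R i) (C h)) 0 ↔
    ∀ i j, dRh R j (q i) - dRh R i (q j) = omegaHol lam R p i j * (μ i - μ j) := by
  rw [hh.linear_condition hR hf]
  refine forall₂_congr fun i j => ?_
  rcases eq_or_ne i j with rfl | hij
  · simp
  · have h1 := hl.sub_mul_speedInv hij
    unfold omegaHol
    constructor
    · intro h2
      linear_combination speedInv lam i j * h2 - (dRh R j (q i) - dRh R i (q j)) * h1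
    · intro h2
      linear_combination (lam i - lam j) * h2
        + (dRh R j (p i) - dRh R i (p j)) * (μ i - μ j) * h1

theorem HasSpeeds.dRh_eq_aHol {R : Fin n → Hol W} (hR : IsCoord R) {h f : Hol W}
    {lam μ : Fin n → Hol W} (hl : DistinctValues lam) (hh : HasSpeeds η R h lam)
    (hf : HasSpeeds η R f μ) (i j : Fin n) (hij : i ≠ j) :
    dRh R j (μ i) = aHol lam R i j * (μ i - μ j) := by
  unfold aHol
  linear_combination speedInv lam i j * hh.dRh_eq hR hf hij
    - dRh R j (μ i) * hl.sub_mul_speedInv hij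

/-- The first order part of `{H, F}`, for `F₀ = ∫ f dx`. -/
theorem bracket_first_order (hη : η.IsSymm) {hW : W ≤ U} {h₀ : Hol U} {f : Hol W}
    {H : ℕ → DiffPoly U} (h0 : H 0 = DiffPoly.ofHol h₀) {F : ℕ → DiffPoly W} (hF : F 0 = C f)
    {P Q : DiffPoly W} (hP : SameFunctional (DiffPoly.res hW (H 1)) P) (hQ : F 1 = Q) :
    SameFunctional (∑ a ∈ Finset.range (1 + 1),
        DiffPoly.bracket η (DiffPoly.res hW (H a)) (F (1 - a))) 0 ↔
      SameFunctional (bracket η P (C f) - bracket η Q (C (Hol.res hW h₀))) 0 := by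
  have e : ∑ a ∈ Finset.range (1 + 1), DiffPoly.bracket η (DiffPoly.res hW (H a)) (F (1 - a))
      = bracket η (C (Hol.res hW h₀)) Q + bracket η P (C f) := by
    rw [Finset.sum_range_succ, Finset.sum_range_one, h0, hP.bracket_eq η (SameFunctional.rfl' _),
      ← hQ, ← hF]
    unfold ofHol
    rw [res_C]
  have h1 := (bracket_skew hη (C (Hol.res hW h₀)) Q).add (SameFunctional.rfl' (bracket η P (C f)))
  rw [e]
  rw [neg_add_eq_sub] at h1
  exact ⟨fun h2 => h1.symm.trans h2, fun h2 => h1.trans h2⟩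

theorem res_linear (hW : W ≤ U) (R p : Fin n → Hol U) :
    DiffPoly.res hW (∑ i, DiffPoly.ofHol (p i) * Rx R i)
      = ∑ i, C (Hol.res hW (p i)) * Rx (fun j => Hol.res hW (R j)) i := by
  rw [res_sum]
  refine Finset.sum_congr rfl fun i _ => ?_
  unfold ofHol
  rw [res_mul, res_C, res_Rx]

theorem linear_homogeneous (R q : Fin n → Hol W) :
    IsHomogeneousOfDegree (W := W) (∑ i, C (q i) * Rx R i) 1 := by
  refine MvPolynomial.IsWeightedHomogeneous.sum _ _ _ fun i _ => ?_
  simpa using (isWeightedHomogeneous_C (fun i : Fin n × ℕ => i.2 + 1) (q i)).mul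
    (Rx_homogeneous R i)

theorem res_compatDefect (h : W ≤ U) {lam R : Fin n → Hol U} (hR : IsCoord R)
    (hl : DistinctValues lam) (p : Fin n → Hol U) {i j k : Fin n} (hij : i ≠ j) (hjk : j ≠ k)
    (hik : i ≠ k) :
    Hol.res h (compatDefect (dRh R) (aHol lam R) (omegaHol lam R p) i j k)
      = compatDefect (dRh fun i => Hol.res h (R i))
        (aHol (fun i => Hol.res h (lam i)) fun i => Hol.res h (R i))
        (omegaHol (fun i => Hol.res h (lam i)) (fun i => Hol.res h (R i))
          fun i => Hol.res h (p i)) i j k := by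
  unfold compatDefect
  simp only [map_sub, map_add, map_mul]
  rw [res_aHol _ hR hl hij, res_aHol _ hR hl hij.symm, res_aHol _ hR hl hik,
    res_aHol _ hR hl hik.symm, ← hR.dRh_res, ← hR.dRh_res, res_omegaHol _ hR hl p hij,
    res_omegaHol _ hR hl p hik, res_omegaHol _ hR hl p hjk, res_omegaHol _ hR hl p hjk.symm]

theorem injective_update {ι α : Type*} [DecidableEq ι] {x : ι → α} (hx : Function.Injective x)
    (i : ι) {a : α} (ha : ∀ j, x j ≠ a) : Function.Injective (Function.update x i a) := by
  intro j k hjk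
  by_cases hj : j = i <;> by_cases hk : k = i
  · rw [hj, hk]
  · rw [hj, Function.update_self, Function.update_of_ne hk] at hjk
    exact absurd hjk.symm (ha k)
  · rw [hk, Function.update_self, Function.update_of_ne hj] at hjk
    exact absurd hjk (ha j)
  · rw [Function.update_of_ne hj, Function.update_of_ne hk] at hjk
    exact hx hjk

/-- If a conservation law with speeds `μ` extends to first order, the two-form with components
`ω_{ij} (μ_i - μ_j)` is exact. That it is closed is a linear relation between the speeds. -/
theorem HasSpeeds.sum_compatDefect {R : Fin n → Hol W} (hR : IsCoord R) {h f : Hol W}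
    {lam μ : Fin n → Hol W} (hl : DistinctValues lam) (hh : HasSpeeds η R h lam)
    (hf : HasSpeeds η R f μ) {p q : Fin n → Hol W}
    (hpq : SameFunctional (bracket η (∑ i, C (p i) * Rx R i) (C f)
      - bracket η (∑ i, C (q i) * Rx R i) (C h)) 0)
    {i j k : Fin n} (hij : i ≠ j) (hjk : j ≠ k) (hik : i ≠ k) :
    μ i * compatDefect (dRh R) (aHol lam R) (omegaHol lam R p) i j k
      + μ j * compatDefect (dRh R) (aHol lam R) (omegaHol lam R p) j k i
      + μ k * compatDefect (dRh R) (aHol lam R) (omegaHol lam R p) k i j = 0 := by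
  have h2 := (hh.first_order_iff hR hl hf p q).1 hpq
  rw [← cyclic_sum_eq_compatDefect (dRh R) (omegaHol_comm hl R p) (hh.dRh_eq_aHol hR hl hf)
    hij hjk hik, ← h2, ← h2, ← h2, map_sub, map_sub, map_sub, hR.dRh_comm k i, hR.dRh_comm k j,
    hR.dRh_comm j i]
  ring

/-- Extendability of enough conservation laws to first order implies the compatibility condition:
in the vanishing linear combination of `μ_i`, `μ_j`, `μ_k` the value of `μ_i` is arbitrary. -/
theorem compatDefect_eq_zero (hη : η.IsSymm) {h₀ : Hol U} {lam R : Fin n → Hol U}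
    (hR : IsCompleteRiemannInvariants η h₀ lam R) (hl : DistinctValues lam) {p : Fin n → Hol U}
    {H : ℕ → DiffPoly U} (h0 : H 0 = DiffPoly.ofHol h₀)
    (hH : SameFunctional (H 1) (∑ i, DiffPoly.ofHol (p i) * Rx R i))
    (hint : IsIntegrableUpTo η h₀ H 1) {i j k : Fin n} (hij : i ≠ j) (hjk : j ≠ k) (hik : i ≠ k)
    (v : U) : compatDefect (dRh R) (aHol lam R) (omegaHol lam R p) i j k v = 0 := by
  have hh := hasSpeeds_of_isCompleteRiemannInvariants hR
  have hRc : IsCoord R := hR.1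
  have key : ∀ x : Fin n → ℂ, Function.Injective x →
      x i * compatDefect (dRh R) (aHol lam R) (omegaHol lam R p) i j k v
        + x j * compatDefect (dRh R) (aHol lam R) (omegaHol lam R p) j k i v
        + x k * compatDefect (dRh R) (aHol lam R) (omegaHol lam R p) k i j v = 0 := by
    intro x hx
    obtain ⟨W, hW, f, μ, hv, hf, hgen, hμ, hμx, -⟩ :=
      exists_conserved hη hint.1 hR hl v x 0 hx
    obtain ⟨W', hW', F, hv', hF0, hFd, hF⟩ := hint.2 W hW f hf hgen v hv
    obtain ⟨q, hq⟩ := (hRc.res (hW'.trans hW)).exists_degree_one (hFd 1)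
    have h1 := (bracket_first_order hη h0 hF0 (hH.res (hW'.trans hW)) hq).1 (hF 1 le_rfl)
    rw [res_linear] at h1
    have h3 := HasSpeeds.sum_compatDefect (hRc.res (hW'.trans hW)) (hl.res (hW'.trans hW))
      (hh.res (hW'.trans hW)) (hμ.res hW') h1 hij hjk hik
    rw [← res_compatDefect _ hRc hl p hij hjk hik,
      ← res_compatDefect _ hRc hl p hjk hik.symm hij.symm,
      ← res_compatDefect _ hRc hl p hik.symm hij hjk.symm] at h3
    have h5 := congrArg (Hol.ev (⟨v, hv'⟩ : W')) h3
    rw [map_add, map_add, map_mul, map_mul, map_mul, map_zero] at h5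
    rw [← hμx i, ← hμx j, ← hμx k]
    exact h5
  have hx : Function.Injective fun m : Fin n => ((m : ℕ) : ℂ) := fun a b hab =>
    Fin.ext (Nat.cast_injective hab)
  have h1 := key _ hx
  have h2 := key _ (injective_update hx i (a := n) fun m hm => m.2.ne (Nat.cast_injective hm))
  rw [Function.update_self, Function.update_of_ne hij.symm, Function.update_of_ne hik.symm] at h2
  generalize compatDefect (dRh R) (aHol lam R) (omegaHol lam R p) i j k v = E at h1 h2 ⊢
  have h3 : ((n : ℂ) - (i : ℕ)) * E = 0 := by linear_combination h2 - h1
  refine (mul_eq_zero.1 h3).resolve_left fun h4 => i.2.ne' ?_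
  rwa [sub_eq_zero, Nat.cast_inj] at h4

/-- Under the compatibility condition the two-form with components `ω_{ij} (μ_i - μ_j)` is closed, and
the Poincaré lemma provides the first order correction of the conservation law. -/
theorem HasSpeeds.exists_first_order {R : Fin n → Hol W} (hR : IsCoord R) {h f : Hol W}
    {lam μ : Fin n → Hol W} (hl : DistinctValues lam) (hh : HasSpeeds η R h lam)
    (hf : HasSpeeds η R f μ) (p : Fin n → Hol W)
    (hE : ∀ i j k, i ≠ j → j ≠ k → i ≠ k →
      compatDefect (dRh R) (aHol lam R) (omegaHol lam R p) i j k = 0) (w : W) :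
    ∃ (W' : TopologicalSpace.Opens (Fin n → ℂ)) (hW' : W' ≤ W) (q : Fin n → Hol W'),
      (w : Fin n → ℂ) ∈ W' ∧ SameFunctional
        (bracket η (∑ i, C (Hol.res hW' (p i)) * Rx (fun i => Hol.res hW' (R i)) i)
            (C (Hol.res hW' f))
          - bracket η (∑ i, C (q i) * Rx (fun i => Hol.res hW' (R i)) i) (C (Hol.res hW' h))) 0 := by
  have hω := omegaHol_comm hl R p
  obtain ⟨W', hW', q, hw', hq⟩ := hR.exists_primitive
    (Q := fun i j => omegaHol lam R p i j * (μ j - μ i))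
    (fun i j => by rw [hω i j]; ring)
    (fun k i j => by
      have h1 : ∀ a b, omegaHol lam R p a b * (μ b - μ a)
        = -(omegaHol lam R p a b * (μ a - μ b)) := fun a b => by ring
      simp only [h1, map_neg]
      rcases eq_or_ne i j with rfl | hij
      · rw [hω k i, ← neg_sub (μ i) (μ k), mul_neg, map_neg, sub_self, mul_zero, map_zero]
        ring
      rcases eq_or_ne j k with rfl | hjk
      · rw [hω j i, ← neg_sub (μ i) (μ j), mul_neg, map_neg, sub_self, mul_zero, map_zero]
        ring
      rcases eq_or_ne i k with rfl | hik
      · rw [hω j i, ← neg_sub (μ i) (μ j), mul_neg, map_neg, sub_self, mul_zero, map_zero]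
        ring
      have h2 := cyclic_sum_eq_compatDefect (dRh R) hω (hh.dRh_eq_aHol hR hl hf) hij hjk hik
      rw [hE i j k hij hjk hik, hE j k i hjk hik.symm hij.symm, hE k i j hik.symm hij hjk.symm] at h2
      linear_combination -h2) w
  refine ⟨W', hW', q, hw', ((hh.res hW').first_order_iff (hR.res hW') (hl.res hW') (hf.res hW')
    _ q).2 fun i j => (hq j i).trans ?_⟩
  rcases eq_or_ne i j with rfl | hij
  · rw [sub_self, sub_self, mul_zero, mul_zero, map_zero]
  · rw [map_mul, map_sub, hω j i, res_omegaHol _ hR hl p hij]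

theorem extends_of_compatDefect (hη : η.IsSymm) {h₀ : Hol U} {lam R : Fin n → Hol U}
    (hR : IsCompleteRiemannInvariants η h₀ lam R) (hl : DistinctValues lam) {p : Fin n → Hol U}
    {H : ℕ → DiffPoly U} (h0 : H 0 = DiffPoly.ofHol h₀)
    (hH : SameFunctional (H 1) (∑ i, DiffPoly.ofHol (p i) * Rx R i))
    (hE : ∀ i j k, i ≠ j → j ≠ k → i ≠ k →
      compatDefect (dRh R) (aHol lam R) (omegaHol lam R p) i j k = 0)
    {hW : W ≤ U} {f : Hol W} (hf : IsConserved η h₀ hW f) : Extends η H 1 hW f := by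
  intro w hw
  obtain ⟨μ, hμ⟩ := hf.exists_hasSpeeds hη hR hl
  have hRc : IsCoord R := hR.1
  obtain ⟨W', hW', q, hw', hq⟩ := HasSpeeds.exists_first_order (hRc.res hW) (hl.res hW)
    ((hasSpeeds_of_isCompleteRiemannInvariants hR).res hW) hμ (fun i => Hol.res hW (p i))
    (fun i j k hij hjk hik => by
      rw [← res_compatDefect hW hRc hl p hij hjk hik, hE i j k hij hjk hik, map_zero]) ⟨w, hw⟩
  let F : ℕ → DiffPoly W' := fun m => match m with
    | 0 => C (Hol.res hW' f)
    | 1 => ∑ i, C (q i) * Rx (fun i => Hol.res hW' (Hol.res hW (R i))) i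
    | _ + 2 => 0
  refine ⟨W', hW', F, hw', rfl, fun m => ?_, fun m hm => ?_⟩
  · match m with
    | 0 => exact isWeightedHomogeneous_C _ _
    | 1 => exact linear_homogeneous _ _
    | _ + 2 => exact isWeightedHomogeneous_zero _ _ _
  · have hm' : m ≤ 1 := by exact_mod_cast hm
    interval_cases m
    · have h1 : F (0 - 0) = C (Hol.res hW' f) := rfl
      rw [zero_add, Finset.sum_range_one, h0, h1]
      unfold ofHol
      rw [res_C]
      exact hf.res hW'
    · refine (bracket_first_order hη h0 (F := F) rfl (hH.res (hW'.trans hW)) rfl).2 ?_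
      rw [res_linear]
      exact hq

end FirstOrder

/-! ### Second order -/

section SecondOrder

open MvPolynomial DiffPoly

variable {U W : TopologicalSpace.Opens (Fin n → ℂ)} {η : Matrix (Fin n) (Fin n) ℂ}

/-- Modulo total derivatives, a differential polynomial of degree two is a quadratic form in the
`R_{i,x}`: the second derivatives are removed by integration by parts. -/
theorem IsCoord.exists_quadratic {R : Fin n → Hol W} (hR : IsCoord R) {P : DiffPoly W}
    (hP : P.IsHomogeneousOfDegree 2) : ∃ e : Fin n → Fin n → Hol W, (∀ i j, e i j = e j i) ∧
      SameFunctional P (∑ i, ∑ j, C (e i j) * (Rx R i * Rx R j)) := by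
  obtain ⟨ρ, σ, rfl⟩ := hR.exists_degree_two hP
  have h1 : SameFunctional (∑ i, C (ρ i) * totalD (Rx R i))
      (∑ i, ∑ j, C (-dRh R j (ρ i)) * (Rx R i * Rx R j)) := by
    refine SameFunctional.sum _ fun i _ => ?_
    have h2 := (SameFunctional.parts (Rx R i) (C (ρ i)))
    rw [mul_comm, hR.totalD_C, Finset.mul_sum, ← Finset.sum_neg_distrib] at h2
    have h3 : ∀ j, C (-dRh R j (ρ i)) * (Rx R i * Rx R j)
        = -(Rx R i * (C (dRh R j (ρ i)) * Rx R j)) := fun j => by rw [map_neg]; ring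
    simp only [h3]
    exact h2
  have h2 := h1.add (SameFunctional.rfl' (∑ i, ∑ j, C (σ i j) * (Rx R i * Rx R j)))
  simp only [← Finset.sum_add_distrib, ← add_mul, ← map_add] at h2
  set s : Fin n → Fin n → Hol W := fun i j => -dRh R j (ρ i) + σ i j with hs
  have hhalf : ∀ g : Hol W, (1 / 2 : ℂ) • g + (1 / 2 : ℂ) • g = g := fun g => by
    rw [← add_smul, add_halves, one_smul]
  refine ⟨fun i j => (1 / 2 : ℂ) • s i j + (1 / 2 : ℂ) • s j i, fun i j => add_comm _ _, ?_⟩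
  rw [← Finset.sum_add_distrib]
  have h4 : ∑ i, ∑ j, C ((1 / 2 : ℂ) • s i j + (1 / 2 : ℂ) • s j i) * (Rx R i * Rx R j)
      = ∑ i, ∑ j, C (s i j) * (Rx R i * Rx R j) := by
    have h5 : ∑ i, ∑ j, C ((1 / 2 : ℂ) • s j i) * (Rx R i * Rx R j)
        = ∑ i, ∑ j, C ((1 / 2 : ℂ) • s i j) * (Rx R i * Rx R j) := by
      rw [Finset.sum_comm]
      refine Finset.sum_congr rfl fun i _ => Finset.sum_congr rfl fun j _ => ?_
      rw [mul_comm (Rx R j)]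
    simp only [map_add, add_mul, Finset.sum_add_distrib]
    rw [h5]
    simp only [← Finset.sum_add_distrib, ← add_mul, ← map_add, hhalf]
  rw [h4]
  exact h2

theorem bracket_zero_left (η : Matrix (Fin n) (Fin n) ℂ) (Q : DiffPoly W) : bracket η 0 Q = 0 := by
  have h : ∀ α, varDeriv α (0 : DiffPoly W) = 0 := fun α => by
    simpa using varDeriv_totalD (W := W) α 0
  unfold bracket
  simp only [h, zero_mul, smul_zero, Finset.sum_const_zero]

/-- The second order part of `{H, F}`, for `F₀ = ∫ f dx` and `H₁ = 0`. -/
theorem bracket_second_order (hη : η.IsSymm) {hW : W ≤ U} {h₀ : Hol U} {f : Hol W}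
    {H : ℕ → DiffPoly U} (h0 : H 0 = DiffPoly.ofHol h₀) (h1 : SameFunctional (H 1) 0)
    {F : ℕ → DiffPoly W} (hF : F 0 = C f)
    {P Q : DiffPoly W} (hP : SameFunctional (DiffPoly.res hW (H 2)) P) (hQ : SameFunctional (F 2) Q)
    (hHF : SameFunctional (∑ a ∈ Finset.range (2 + 1),
        DiffPoly.bracket η (DiffPoly.res hW (H a)) (F (2 - a))) 0) :
    SameFunctional (bracket η P (C f) - bracket η Q (C (Hol.res hW h₀))) 0 := by
  have h1' := h1.res hW
  rw [res_zero] at h1'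
  have e : ∑ a ∈ Finset.range (2 + 1), DiffPoly.bracket η (DiffPoly.res hW (H a)) (F (2 - a))
      = bracket η (C (Hol.res hW h₀)) Q + bracket η P (C f) := by
    rw [Finset.sum_range_succ, Finset.sum_range_succ, Finset.sum_range_one, h0,
      hP.bracket_eq η (SameFunctional.rfl' _), h1'.bracket_eq η (SameFunctional.rfl' _),
      bracket_zero_left, add_zero, ← hF, (SameFunctional.rfl' _).bracket_eq η hQ]
    unfold ofHol
    rw [res_C]
  have h2 := (bracket_skew hη (C (Hol.res hW h₀)) Q).add (SameFunctional.rfl' (bracket η P (C f)))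
  rw [e] at hHF
  rw [neg_add_eq_sub] at h2
  exact h2.symm.trans hHF

theorem res_quadratic (hW : W ≤ U) (R : Fin n → Hol U) (d : Fin n → Fin n → Hol U) :
    DiffPoly.res hW (∑ i, ∑ j, DiffPoly.ofHol (d i j) * Rx R i * Rx R j)
      = ∑ i, ∑ j, C (Hol.res hW (d i j)) *
        (Rx (fun j => Hol.res hW (R j)) i * Rx (fun j => Hol.res hW (R j)) j) := by
  simp only [res_sum]
  refine Finset.sum_congr rfl fun i _ => Finset.sum_congr rfl fun j _ => ?_
  unfold ofHol
  rw [res_mul, res_mul, res_C, res_Rx, res_Rx, mul_assoc]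

/-- The second order condition, for conservation laws near `v` with prescribed values of the speeds
`μ_i` and of `μ_{i,i}` at `v`. -/
theorem exists_second_order (hη : η.IsSymm) {h₀ : Hol U} {lam R : Fin n → Hol U}
    (hR : IsCompleteRiemannInvariants η h₀ lam R) (hl : DistinctValues lam)
    {d : Fin n → Fin n → Hol U} {H : ℕ → DiffPoly U} {N : ℕ∞} (hN : 2 ≤ N)
    (h0 : H 0 = DiffPoly.ofHol h₀) (h1 : SameFunctional (H 1) 0)
    (h2 : SameFunctional (H 2) (∑ i, ∑ j, DiffPoly.ofHol (d i j) * Rx R i * Rx R j))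
    (hint : IsIntegrableUpTo η h₀ H N) (v : U) {x : Fin n → ℂ} (hx : Function.Injective x)
    (y : Fin n → ℂ) :
    ∃ (W : TopologicalSpace.Opens (Fin n → ℂ)) (hW : W ≤ U) (f : Hol W) (μ : Fin n → Hol W)
      (e : Fin n → Fin n → Hol W) (hv : (v : Fin n → ℂ) ∈ W),
      HasSpeeds η (fun i => Hol.res hW (R i)) f μ ∧ (∀ i j, e i j = e j i) ∧
      SameFunctional (bracket η (∑ i, ∑ j, C (Hol.res hW (d i j)) *
          (Rx (fun j => Hol.res hW (R j)) i * Rx (fun j => Hol.res hW (R j)) j)) (C f)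
        - bracket η (∑ i, ∑ j, C (e i j) *
          (Rx (fun j => Hol.res hW (R j)) i * Rx (fun j => Hol.res hW (R j)) j))
          (C (Hol.res hW h₀))) 0 ∧
      (∀ i, μ i ⟨v, hv⟩ = x i) ∧
      ∀ i, dRh (fun i => Hol.res hW (R i)) i (μ i) ⟨v, hv⟩ = y i := by
  have hRc : IsCoord R := hR.1
  obtain ⟨W, hW, f, μ, hv, hf, hgen, hμ, hμx, hμy⟩ := exists_conserved hη hint.1 hR hl v x y hx
  obtain ⟨W', hW', F, hv', hF0, hFd, hF⟩ := hint.2 W hW f hf hgen v hv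
  obtain ⟨e, he, hFe⟩ := (hRc.res (hW'.trans hW)).exists_quadratic (hFd 2)
  have h3 := bracket_second_order hη h0 h1 hF0 (h2.res (hW'.trans hW)) hFe (hF 2 hN)
  rw [res_quadratic] at h3
  refine ⟨W', hW'.trans hW, Hol.res hW' f, fun i => Hol.res hW' (μ i), e, hv', hμ.res hW', he, h3,
    hμx, fun i => (congrArg (Hol.ev (⟨v, hv'⟩ : W')) ((hRc.res hW).dRh_res hW' i (μ i))).trans
      (hμy i)⟩

/-- The elimination of `e_{ii}` and `e_{ij}`. Here `lij` stands for `lam_{i,j}`, `liij` for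
`lam_{i,ij}`, `mij` for `μ_{i,j}`, `diij` for `d_{ii,j}`, `diji` for `d_{ij,i}`, and so on. -/
theorem diagonal_algebra {A : Type*} [CommRing A]
    {li lj lii lij lji liij mi mj mii mij mji miij dii diij dij diji eii eiij eij eiji : A}
    (h1 : eii * lii = dii * mii) (h2 : eii * liij + lii * eiij = dii * miij + mii * diij)
    (h3 : eij * (li - lj) = dij * (mi - mj))
    (h4 : eij * (lii - lji) + (li - lj) * eiji = dij * (mii - mji) + (mi - mj) * diji)
    (h5 : (li - lj) * mij = (mi - mj) * lij) (h6 : (lj - li) * mji = (mj - mi) * lji)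
    (h7 : (li - lj) * miij + mij * (lii - lji) = (mi - mj) * liij + lij * (mii - mji))
    (h8 : diij * (mj - mi) + dii * mij + diji * (mi - mj) + dij * (mii + mji)
      = eiij * (lj - li) + eii * lij + eiji * (li - lj) + eij * (lii + lji)) :
    (li - lj) * (((li - lj) * mii - (mi - mj) * lii) * (diij * lii - dii * liij)) = 0 := by
  have h9 : (li - lj) * (-diij * (mi - mj) + dii * mij + eiij * (li - lj) - eii * lij) = 0 := by
    linear_combination (li - lj) * h8 + (li - lj) * h4 + 2 * dij * h6 + 2 * lji * h3
  linear_combination lii ^ 2 * h9 - (li - lj) ^ 2 * lii * h2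
    + ((li - lj) ^ 2 * liij + lii * (li - lj) * lij) * h1 - (li - lj) * lii * dii * h7
    - lii * dii * (lij * h6 + lji * h5)

/-- The part of the second order condition for the indices `i, i, j`: eliminating the unknown `e`
leaves a multiple of the Wronskian of `d_{ii}` and `lam_{i,i}`. -/
theorem HasSpeeds.diagonal_condition {R : Fin n → Hol W} (hR : IsCoord R) {h f : Hol W}
    {lam μ : Fin n → Hol W} (hh : HasSpeeds η R h lam) (hf : HasSpeeds η R f μ)
    {d e : Fin n → Fin n → Hol W} (hd : ∀ i j, d i j = d j i) (he : ∀ i j, e i j = e j i)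
    (hde : SameFunctional (bracket η (∑ i, ∑ j, C (d i j) * (Rx R i * Rx R j)) (C f)
      - bracket η (∑ i, ∑ j, C (e i j) * (Rx R i * Rx R j)) (C h)) 0)
    {i j : Fin n} (hij : i ≠ j) :
    (lam i - lam j) * (((lam i - lam j) * dRh R i (μ i) - (μ i - μ j) * dRh R i (lam i)) *
      (dRh R j (d i i) * dRh R i (lam i) - d i i * dRh R j (dRh R i (lam i)))) = 0 := by
  obtain ⟨hI, hII⟩ := hh.quadratic_condition hR hf hd he hde
  -- All indices equal: the equation determines `e_{ii}`.
  have hiii : e i i * dRh R i (lam i) = d i i * dRh R i (μ i) := by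
    have h1 := hII i i i
    simp only [map_add] at h1
    have h2 : (2 : Hol W) * (3 * (e i i * dRh R i (lam i) - d i i * dRh R i (μ i))) = 0 := by
      linear_combination -h1
    refine sub_eq_zero.1 (Hol.natCast_mul_eq_zero three_ne_zero ?_)
    rw [Nat.cast_ofNat]
    exact Hol.two_mul_eq_zero h2
  have hiiij := congrArg (dRh R j) hiii
  have hIij := congrArg (dRh R i) (hI i j)
  have hμij := hh.dRh_eq hR hf hij
  have hμji := hh.dRh_eq hR hf hij.symm
  have hμiij := congrArg (dRh R i) hμij
  have hIIij := hII i i j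
  simp only [Derivation.leibniz, smul_eq_mul, map_sub, map_add, hR.dRh_comm i j] at *
  refine diagonal_algebra hiii hiiij (hI i j) hIij hμij hμji hμiij ?_
  refine sub_eq_zero.1 (Hol.two_mul_eq_zero ?_)
  linear_combination hIIij

/-- The cubic terms for distinct indices, with `d_{ij} = u (lam_i - lam_j)`, `e_{ij} = u (μ_i - μ_j)`,
and likewise `v` for `j, k` and `w` for `k, i`; `uk` stands for `u_{,k}`, `lij` for `lam_{i,j}`, `mij`
for `μ_{i,j}`. The terms without derivatives of `u`, `v`, `w` cancel. -/
theorem cyclic_algebra {A : Type*} [CommRing A]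
    {li lj lk mi mj mk aij aji aik aki ajk akj lij lji lik lki ljk lkj mij mji mik mki mjk mkj
      u uk v vi w wj : A}
    (h1 : lij = aij * (li - lj)) (h2 : lji = aji * (lj - li)) (h3 : lik = aik * (li - lk))
    (h4 : lki = aki * (lk - li)) (h5 : ljk = ajk * (lj - lk)) (h6 : lkj = akj * (lk - lj))
    (h7 : mij = aij * (mi - mj)) (h8 : mji = aji * (mj - mi)) (h9 : mik = aik * (mi - mk))
    (h10 : mki = aki * (mk - mi)) (h11 : mjk = ajk * (mj - mk)) (h12 : mkj = akj * (mk - mj))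
    (h : (u * (lik - ljk) + (li - lj) * uk) * (2 * mk - mi - mj) + u * (li - lj) * (mik + mjk)
        + ((w * (lkj - lij) + (lk - li) * wj) * (2 * mj - mi - mk) + w * (lk - li) * (mij + mkj))
        + ((v * (lji - lki) + (lj - lk) * vi) * (2 * mi - mj - mk) + v * (lj - lk) * (mji + mki))
      = (u * (mik - mjk) + (mi - mj) * uk) * (2 * lk - li - lj) + u * (mi - mj) * (lik + ljk)
        + ((w * (mkj - mij) + (mk - mi) * wj) * (2 * lj - li - lk) + w * (mk - mi) * (lij + lkj))
        + ((v * (mji - mki) + (mj - mk) * vi) * (2 * li - lj - lk) + v * (mj - mk) * (lji + lki))) :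
    2 * ((li * mk - lk * mi + (lj * mi - li * mj) + (lk * mj - lj * mk)) * (uk + vi + wj)) = 0 := by
  subst h1 h2 h3 h4 h5 h6 h7 h8 h9 h10 h11 h12
  linear_combination h

/-- The part of the second order condition for pairwise distinct indices, in terms of the
quotients `ε_{ij} = d_{ij} / (lam_i - lam_j)`. -/
theorem HasSpeeds.cyclic_condition {R : Fin n → Hol W} (hR : IsCoord R) {h f : Hol W}
    {lam μ : Fin n → Hol W} (hl : DistinctValues lam) (hh : HasSpeeds η R h lam)
    (hf : HasSpeeds η R f μ)
    {d e ε : Fin n → Fin n → Hol W} (hd : ∀ i j, d i j = d j i) (he : ∀ i j, e i j = e j i)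
    (hε : ∀ i j, ε i j = d i j * speedInv lam i j)
    (hde : SameFunctional (bracket η (∑ i, ∑ j, C (d i j) * (Rx R i * Rx R j)) (C f)
      - bracket η (∑ i, ∑ j, C (e i j) * (Rx R i * Rx R j)) (C h)) 0)
    {i j k : Fin n} (hij : i ≠ j) (hjk : j ≠ k) (hik : i ≠ k) :
    (lam i * μ k - lam k * μ i + (lam j * μ i - lam i * μ j) + (lam k * μ j - lam j * μ k)) *
      (dRh R k (ε i j) + dRh R i (ε j k) + dRh R j (ε k i)) = 0 := by
  obtain ⟨hI, hII⟩ := hh.quadratic_condition hR hf hd he hde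
  have hdε : ∀ a b, a ≠ b → d a b = ε a b * (lam a - lam b) := fun a b hab => by
    rw [hε]
    linear_combination -d a b * hl.sub_mul_speedInv hab
  have heε : ∀ a b, a ≠ b → e a b = ε a b * (μ a - μ b) := fun a b hab => by
    rw [hε]
    linear_combination speedInv lam a b * hI a b - e a b * hl.sub_mul_speedInv hab
  have hlam := hh.dRh_eq_aHol hR hl hh
  have hμ := hh.dRh_eq_aHol hR hl hf
  have h1 := hII i j k
  rw [hd i k, he i k, heε i j hij, heε j k hjk, heε k i hik.symm, hdε i j hij, hdε j k hjk,
    hdε k i hik.symm] at h1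
  simp only [Derivation.leibniz, smul_eq_mul, map_sub, map_add] at h1
  refine Hol.two_mul_eq_zero ?_
  exact cyclic_algebra (hlam i j hij) (hlam j i hij.symm) (hlam i k hik) (hlam k i hik.symm)
    (hlam j k hjk) (hlam k j hjk.symm) (hμ i j hij) (hμ j i hij.symm) (hμ i k hik)
    (hμ k i hik.symm) (hμ j k hjk) (hμ k j hjk.symm) h1

end SecondOrder

section SecondOrderConsequences

open MvPolynomial DiffPoly

variable {U W : TopologicalSpace.Opens (Fin n → ℂ)} {η : Matrix (Fin n) (Fin n) ℂ}

theorem injective_natCast_fin : Function.Injective fun m : Fin n => ((m : ℕ) : ℂ) := fun _ _ hab =>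
  Fin.ext (Nat.cast_injective hab)

/-- The Wronskian of `d_{ii}` and `lam_{i,i}` with respect to `R_j` vanishes: its factor in
`HasSpeeds.diagonal_condition` does not vanish for a suitable value of `μ_{i,i}`. -/
theorem wronskian_eq_zero (hη : η.IsSymm) {h₀ : Hol U} {lam R : Fin n → Hol U}
    (hR : IsCompleteRiemannInvariants η h₀ lam R) (hl : DistinctValues lam)
    {d : Fin n → Fin n → Hol U} (hd : ∀ i j, d i j = d j i) {H : ℕ → DiffPoly U} {N : ℕ∞}
    (hN : 2 ≤ N) (h0 : H 0 = DiffPoly.ofHol h₀) (h1 : SameFunctional (H 1) 0)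
    (h2 : SameFunctional (H 2) (∑ i, ∑ j, DiffPoly.ofHol (d i j) * Rx R i * Rx R j))
    (hint : IsIntegrableUpTo η h₀ H N) {i j : Fin n} (hij : i ≠ j) :
    dRh R j (d i i) * dRh R i (lam i) - d i i * dRh R j (dRh R i (lam i)) = 0 := by
  refine Hol.ext_iff'.2 fun v => ?_
  have hL : lam i v - lam j v ≠ 0 := sub_ne_zero.2 (hl i j hij v)
  obtain ⟨W, hW, f, μ, e, hv, hμ, he, hde, hx, hy⟩ := exists_second_order hη hR hl hN h0 h1 h2 hint v
    injective_natCast_fin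
    fun _ => (((i : ℕ) : ℂ) - ((j : ℕ) : ℂ)) * dRh R i (lam i) v * (lam i v - lam j v)⁻¹ + 1
  have hRc : IsCoord R := hR.1
  have h3 := ((hasSpeeds_of_isCompleteRiemannInvariants hR).res hW).diagonal_condition
    (hRc.res hW) hμ (d := fun i j => Hol.res hW (d i j)) (fun i j => congrArg _ (hd i j)) he hde hij
  rw [hRc.dRh_res, hRc.dRh_res, hRc.dRh_res] at h3
  have h4 := congrArg (Hol.ev (⟨v, hv⟩ : W)) h3
  simp only [map_mul, map_sub, map_zero, Hol.ev_apply, Hol.res_apply, hx, hy] at h4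
  have h5 := (mul_eq_zero.1 h4).resolve_left hL
  refine (mul_eq_zero.1 h5).resolve_left ?_
  have h6 : (lam i v - lam j v) * ((((i : ℕ) : ℂ) - ((j : ℕ) : ℂ)) * dRh R i (lam i) v
      * (lam i v - lam j v)⁻¹ + 1) - (((i : ℕ) : ℂ) - ((j : ℕ) : ℂ)) * dRh R i (lam i) v
      = lam i v - lam j v := by
    field_simp
    ring
  rw [h6]
  exact hL

/-- The cyclic sum of the derivatives of `d_{ij} / (lam_i - lam_j)` vanishes: its factor in
`HasSpeeds.cyclic_condition` does not vanish for a suitable value of `μ_k`. -/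
theorem cyclic_sum_eq_zero (hη : η.IsSymm) {h₀ : Hol U} {lam R : Fin n → Hol U}
    (hR : IsCompleteRiemannInvariants η h₀ lam R) (hl : DistinctValues lam)
    {d : Fin n → Fin n → Hol U} (hd : ∀ i j, d i j = d j i) {H : ℕ → DiffPoly U} {N : ℕ∞}
    (hN : 2 ≤ N) (h0 : H 0 = DiffPoly.ofHol h₀) (h1 : SameFunctional (H 1) 0)
    (h2 : SameFunctional (H 2) (∑ i, ∑ j, DiffPoly.ofHol (d i j) * Rx R i * Rx R j))
    (hint : IsIntegrableUpTo η h₀ H N) {i j k : Fin n} (hij : i ≠ j) (hjk : j ≠ k) (hik : i ≠ k)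
    (v : U) :
    dRh R k (d i j * speedInv lam i j) v + dRh R i (d j k * speedInv lam j k) v
      + dRh R j (d k i * speedInv lam k i) v = 0 := by
  have hRc : IsCoord R := hR.1
  have key : ∀ x : Fin n → ℂ, Function.Injective x →
      (lam i v * x k - lam k v * x i + (lam j v * x i - lam i v * x j)
        + (lam k v * x j - lam j v * x k)) * (dRh R k (d i j * speedInv lam i j) v
        + dRh R i (d j k * speedInv lam j k) v + dRh R j (d k i * speedInv lam k i) v) = 0 := by
    intro x hx
    obtain ⟨W, hW, f, μ, e, hv, hμ, he, hde, hμx, -⟩ :=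
      exists_second_order hη hR hl hN h0 h1 h2 hint v hx 0
    -- Off the diagonal `ε` restricts the functions of the statement; its diagonal is irrelevant.
    let ε : Fin n → Fin n → Hol W := fun a b =>
      Hol.res hW (d a b) * speedInv (fun i => Hol.res hW (lam i)) a b
    have hε : ∀ a b, a ≠ b → ε a b = Hol.res hW (d a b * speedInv lam a b) := fun a b hab => by
      rw [map_mul, hl.res_speedInv hW hab]
    have h3 := ((hasSpeeds_of_isCompleteRiemannInvariants hR).res hW).cyclic_condition
      (hRc.res hW) (hl.res hW) hμ (d := fun i j => Hol.res hW (d i j)) (ε := ε)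
      (fun i j => congrArg _ (hd i j)) he (fun _ _ => rfl) hde hij hjk hik
    rw [hε i j hij, hε j k hjk, hε k i hik.symm, hRc.dRh_res, hRc.dRh_res, hRc.dRh_res] at h3
    have h4 := congrArg (Hol.ev (⟨v, hv⟩ : W)) h3
    simp only [map_mul, map_sub, map_add, map_zero, Hol.ev_apply, hμx] at h4
    exact h4
  -- The first factor is affine in `x_k`, with the slope `lam_i - lam_j`.
  have h3 := key _ injective_natCast_fin
  have h4 := key _ (injective_update injective_natCast_fin k (a := n)
    fun m hm => m.2.ne (Nat.cast_injective hm))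
  rw [Function.update_self, Function.update_of_ne hik, Function.update_of_ne hjk] at h4
  generalize dRh R k (d i j * speedInv lam i j) v + dRh R i (d j k * speedInv lam j k) v
      + dRh R j (d k i * speedInv lam k i) v = S at h3 h4 ⊢
  have h5 : ((lam i v - lam j v) * ((n : ℂ) - (k : ℕ))) * S = 0 := by linear_combination h4 - h3
  refine (mul_eq_zero.1 h5).resolve_left (mul_ne_zero (sub_ne_zero.2 (hl i j hij v)) fun h6 => ?_)
  rw [sub_eq_zero, Nat.cast_inj] at h6
  exact k.2.ne' h6

/-- The functions `C_i = -d_{ii} / lam_{i,i}`. -/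
theorem exists_isFunctionOf {lam R : Fin n → Hol U} (hR : IsCoord R)
    {d : Fin n → Fin n → Hol U} (hlam : ∀ i, ∀ v : U, dRh R i (lam i) v ≠ 0)
    (h : ∀ i j, i ≠ j →
      dRh R j (d i i) * dRh R i (lam i) - d i i * dRh R j (dRh R i (lam i)) = 0) :
    ∃ C : Fin n → Hol U, (∀ i, IsFunctionOf (R i) (C i)) ∧
      ∀ i, d i i = - C i * dRh R i (lam i) := by
  have hinv : ∀ i, ∃ κ, dRh R i (lam i) * κ = 1 := fun i =>
    (Hol.isUnit_of_forall_ne_zero (hlam i)).exists_right_inv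
  choose κ hκ using hinv
  refine ⟨fun i => -(d i i * κ i), fun i => hR.isFunctionOf fun j hj => ?_, fun i => ?_⟩
  · have h1 := congrArg (dRh R j) (hκ i)
    rw [Derivation.leibniz, Derivation.map_one_eq_zero, smul_eq_mul, smul_eq_mul] at h1
    rw [map_neg, Derivation.leibniz, smul_eq_mul, smul_eq_mul]
    linear_combination (-κ i ^ 2) * h i j hj.symm - d i i * κ i * h1
      + (d i i * dRh R j (κ i) + κ i * dRh R j (d i i)) * hκ i
  · linear_combination (-d i i) * hκ i

end SecondOrderConsequences

end HamPert

end

theorem theorem1 (n : ℕ) (U : TopologicalSpace.Opens (Fin n → ℂ))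
    (η : Matrix (Fin n) (Fin n) ℂ) (hη : η.IsSymm) (hη_inv : IsUnit η.det)
    (h₀ : HamPert.Hol U) (lam R : Fin n → HamPert.Hol U)
    (h_int : HamPert.IsIntegrable η h₀)
    (hR : HamPert.IsCompleteRiemannInvariants η h₀ lam R)
    (h_dist : ∀ i j, i ≠ j → ∀ v : U, lam i v ≠ lam j v) :
    (∀ (p : Fin n → HamPert.Hol U) (H : ℕ → HamPert.DiffPoly U),
      HamPert.IsPerturbation h₀ H →
      HamPert.DiffPoly.SameFunctional (H 1)
        (∑ i, HamPert.DiffPoly.ofHol (p i) * HamPert.Rx R i) →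
      List.TFAE [
        HamPert.IsIntegrableUpTo η h₀ H 1,
        HamPert.IsStronglyIntegrableUpTo η h₀ H 1,
        ∀ i j k, i ≠ j → j ≠ k → i ≠ k → ∀ v : U,
          HamPert.dR R k (HamPert.omega lam R p i j) v
              - HamPert.dR R j (HamPert.omega lam R p i k) v
            = HamPert.aCoef lam R i j v * HamPert.omega lam R p i k v
              + HamPert.aCoef lam R j i v * HamPert.omega lam R p j k v
              - HamPert.aCoef lam R i k v * HamPert.omega lam R p i j v
              - HamPert.aCoef lam R k i v * HamPert.omega lam R p k j v]) ∧
    ((∀ i, ∀ v : U, HamPert.dR R i (lam i) v ≠ 0) →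
      ∀ (d : Fin n → Fin n → HamPert.Hol U) (H : ℕ → HamPert.DiffPoly U) (N : ℕ∞),
        (∀ i j, d i j = d j i) →
        HamPert.IsPerturbation h₀ H →
        HamPert.DiffPoly.SameFunctional (H 1) 0 →
        HamPert.DiffPoly.SameFunctional (H 2)
          (∑ i, ∑ j, HamPert.DiffPoly.ofHol (d i j) * HamPert.Rx R i * HamPert.Rx R j) →
        2 ≤ N →
        HamPert.IsIntegrableUpTo η h₀ H N →
        (∃ C : Fin n → HamPert.Hol U,
          (∀ i, HamPert.IsFunctionOf (R i) (C i)) ∧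
          ∀ i, ∀ v : U, d i i v = - C i v * HamPert.dR R i (lam i) v) ∧
        ∀ i j k, i ≠ j → j ≠ k → i ≠ k → ∀ v : U,
          HamPert.dR R k (fun w => d i j w / (lam i w - lam j w)) v
            + HamPert.dR R i (fun w => d j k w / (lam j w - lam k w)) v
            + HamPert.dR R j (fun w => d k i w / (lam k w - lam i w)) v = 0) := by
  have hRc : HamPert.IsCoord R := hR.1
  have hl : HamPert.DistinctValues lam := h_dist
  refine ⟨fun p H hH hH1 => ?_, fun hlam d H N hd hH hH1 hH2 hN hint => ⟨?_, ?_⟩⟩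
  · have hcompat : ∀ i j k, i ≠ j → j ≠ k → i ≠ k → ∀ v : U,
        (HamPert.dR R k (HamPert.omega lam R p i j) v
              - HamPert.dR R j (HamPert.omega lam R p i k) v
            = HamPert.aCoef lam R i j v * HamPert.omega lam R p i k v
              + HamPert.aCoef lam R j i v * HamPert.omega lam R p j k v
              - HamPert.aCoef lam R i k v * HamPert.omega lam R p i j v
              - HamPert.aCoef lam R k i v * HamPert.omega lam R p k j v) ↔
        HamPert.compatDefect (HamPert.dRh R) (HamPert.aHol lam R) (HamPert.omegaHol lam R p)
          i j k v = 0 := by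
      intro i j k hij hjk hik v
      rw [HamPert.omega_eq hRc hl p hij, HamPert.omega_eq hRc hl p hik,
        HamPert.omega_eq hRc hl p hjk, HamPert.omega_eq hRc hl p hjk.symm,
        HamPert.aCoef_eq hRc hl hij, HamPert.aCoef_eq hRc hl hij.symm,
        HamPert.aCoef_eq hRc hl hik, HamPert.aCoef_eq hRc hl hik.symm, hRc.dR_eq, hRc.dR_eq,
        ← sub_eq_zero]
      rfl
    tfae_have 2 → 1 := fun h => ⟨h.1, fun W hW f hf _ => h.2 W hW f hf⟩
    tfae_have 1 → 3 := fun h i j k hij hjk hik v => (hcompat i j k hij hjk hik v).2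
      (HamPert.compatDefect_eq_zero hη hR hl hH.1 hH1 h hij hjk hik v)
    tfae_have 3 → 2 := fun h => ⟨h_int, fun W hW f hf =>
      HamPert.extends_of_compatDefect hη hR hl hH.1 hH1 (fun i j k hij hjk hik =>
        HamPert.Hol.ext_iff'.2 fun v => (hcompat i j k hij hjk hik v).1 (h i j k hij hjk hik v)) hf⟩
    tfae_finish
  · obtain ⟨C, hC, hCd⟩ := HamPert.exists_isFunctionOf hRc (d := d)
      (fun i v => by rw [← hRc.dR_eq]; exact hlam i v)
      fun i j hij => HamPert.wronskian_eq_zero hη hR hl hd hN hH.1 hH1 hH2 hint hij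
    refine ⟨C, hC, fun i v => ?_⟩
    rw [hRc.dR_eq]
    exact congrArg (HamPert.Hol.ev v) (hCd i)
  · intro i j k hij hjk hik v
    have h1 : ∀ a b, a ≠ b → (fun w => d a b w / (lam a w - lam b w))
        = ((d a b * HamPert.speedInv lam a b : HamPert.Hol U) : U → ℂ) := fun a b hab => by
      funext w
      rw [HamPert.Hol.mul_apply, hl.speedInv_apply hab, div_eq_mul_inv]
    rw [h1 i j hij, h1 j k hjk, h1 k i hik.symm, hRc.dR_eq, hRc.dR_eq, hRc.dR_eq]
    exact HamPert.cyclic_sum_eq_zero hη hR hl hd hN hH.1 hH1 hH2 hint hij hjk hik v
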